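/- **Conventions.** Let $m,n\ge 0$. The superspace $\mathbb{R}^{m|2n}$ is the supermanifold $(\mathbb{R}^m,\ \mathcal{O}=\mathcal{C}^\infty\otimes\Lambda_{2n})$, where $\Lambda_{2n}$ is the real Grassmann algebra on $2n$ generators. Its coordinates are $X_1,\dots,X_{m+2n}$, with parity $[i]=0$ (the coordinates of $\mathbb{R}^m$) for $i\le m$ and $[i]=1$ (the Grassmann generators) for $i>m$. A diffeomorphism $\Phi=(\phi,\phi^\sharp)$ of $\mathbb{R}^{m|2n}$ is an invertible morphism of supermanifolds (a smooth map $\phi$ with a morphism of sheaves of superalgebras $\phi^\sharp:\mathcal{O}\to\phi_*\mathcal{O}$); $\phi^\sharp$ also denotes the induced map on superfunctions $\mathcal{O}(\mathbb{R}^{m|2n})$. Vector fields are the elements of $\mathrm{Der}\,\mathcal{O}(\mathbb{R}^{m|2n})$ (superderivations), and $\delta_p^\sharp f=[f]_0(p)$ is evaluation at $p\in\mathbb{R}^m$, $[f]_0$ being the part of $f$ without Grassmann generators. Let $g=\mathrm{diag}(I_m,J)$, where $J$ is block diagonal with $n$ blocks $\tfrac12\begin{pmatrix}0&-1\\1&0\end{pmatrix}$.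 Put $X^j=\sum_i X_i g^{ij}$ with $g^{ij}$ the entries of $g$, $\nabla_j=\partial_{X^j}=\sum_k (g^{-1})_{jk}\partial_{X_k}$ (left derivatives) and $\nabla^j=\sum_i g^{ij}\nabla_i=(-1)^{[j]}\partial_{X_j}$. The metric on vector fields is $\langle f\nabla_j, h\nabla^k\rangle=(-1)^{|h|[j]}\delta_j^k fh$, so that $\langle\nabla^l,\nabla^k\rangle=g^{kl}$. **The isometry supergroup fixing the origin** is the pair $(\mathcal{H}_0,\mathfrak{h})$, where * $\mathcal{H}_0$ is the group (under composition) of all diffeomorphisms $\Phi$ of $\mathbb{R}^{m|2n}$ with $\phi^\sharp\langle Y_\phi,Z_\phi\rangle=\langle Y,Z\rangle$ for all vector fields $Y,Z$, where $Y_\phi=(\phi^\sharp)^{-1}\circ Y\circ\phi^\sharp$, and with $\delta_0^\sharp\circ\phi^\sharp=\delta_0^\sharp$. It carries the topology of pointwise convergence: the coarsest one for which the coefficients in $\Lambda_{2n}$ of $(\phi^\sharp f)(p)$ depend continuously on $\Phi$, for all superfunctions $f$ and points $p$; * $\mathfrak{h}$ is the space of vector fields $F$ with $\delta_0^\sharp\circ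 F=0$ in the span of the homogeneous Killing fields, i.e. of the homogeneous vector fields $F$ with $F\langle Y,Z\rangle=\langle[F,Y],Z\rangle+(-1)^{|F||Y|}\langle Y,[F,Z]\rangle$ for all homogeneous vector fields $Y,Z$; its superbracket is the supercommutator; * $\Phi\in\mathcal{H}_0$ acts on $\mathfrak{h}$ by $F\mapsto F_\phi$. **The Harish-Chandra pair of $OSp(m|2n)$** is $(O(m)\times Sp(2n),\mathfrak{osp}(m|2n))$, where $Sp(2n)=\{B\in GL_{2n}(\mathbb{R}): B^TJB=J\}$, $O(m)\times Sp(2n)$ consists of the block diagonal matrices $S=\mathrm{diag}(A,B)$, and $\mathfrak{osp}(m|2n)$ is the Lie superalgebra spanned by the homogeneous real $(m+2n)\times(m+2n)$ supermatrices $A$ with $\beta(Ae_l,e_k)+(-1)^{|A|[l]}\beta(e_l,Ae_k)=0$ for all $k,l$, $\beta$ being the bilinear form $\beta(e_l,e_k)=g^{kl}$; the adjoint action is $A\mapsto SAS^{-1}$. **Theorem.** The pair $(\mathcal{H}_0,\mathfrak{h})$ is a Harish-Chandra pair isomorphic to $(O(m)\times Sp(2n),\mathfrak{osp}(m|2n))$.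 Precisely, there are an isomorphism of topological groups $\Theta:O(m)\times Sp(2n)\to\mathcal{H}_0$ and a linear isomorphism $\rho:\mathfrak{osp}(m|2n)\to\mathfrak{h}$ such that: 1. $O(m)\times Sp(2n)$ acts linearly: for $\Phi=\Theta(S)$ and every superfunction $f$, $(\phi^\sharp)^{-1}f=f(S^{-1}\cdot\mathbf{x})$, where $(S\cdot \mathbf{x})_j=\sum_k S_{jk}X_k$. 2. $\mathfrak{osp}(m|2n)$ acts by linear vector fields: for $A$ homogeneous, $\rho(A)$ is the vector field with $X_i\mapsto-(-1)^{|A|[i]}\sum_kA_{ik}X_k$ (extended linearly in $A$). 3. $\mathfrak{h}$ is the real linear span of the operators $L_{ij}=X_i\partial_{X^j}-(-1)^{[i][j]}X_j\partial_{X^i}$. 4. $\rho$ preserves and reflects parity, $\mathfrak{osp}(m|2n)$ is closed under the superbracket and $\rho$ respects the superbrackets. 5. $\mathfrak{osp}(m|2n)$ is stable under $A\mapsto SAS^{-1}$ for $S\in O(m)\times Sp(2n)$, and $\rho(SAS^{-1})=\rho(A)_\phi$ for $\Phi=\Theta(S)$. 6. The even part of $\mathfrak{osp}(m|2n)$ is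 the Lie algebra of $O(m)\times Sp(2n)$: a real matrix $A$ belongs to it if and only if $\exp(tA)\in O(m)\times Sp(2n)$ for all $t\in\mathbb{R}$. 7. On the even part $\rho$ is the differential of the group action: for $A$ even in $\mathfrak{osp}(m|2n)$, every superfunction $f$ and every point $p$, $\frac{d}{dt}\big|_{t=0} f(\exp(-tA)\cdot\mathbf{x})=\rho(A)f$ at $p$, coefficientwise in $\Lambda_{2n}$. -/

import Mathlib

open scoped Manifold ContDiff TensorProduct Matrix
open TopologicalSpace

noncomputable section

namespace Superspace

/-! ### The supermanifold `ℝ^{m|2n}` -/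

/-- The underlying manifold `ℝ^m`. -/
abbrev Body (m : ℕ) : Type := Fin m → ℝ

/-- The Grassmann algebra `Λ_{2n}`; its `2n` generators are indexed by `Fin n × Fin 2`, the pair
`(j, 0), (j, 1)` standing for the two generators numbered `2j-1, 2j` when `j` runs over `1..n`. -/
abbrev Grass (n : ℕ) : Type := ExteriorAlgebra ℝ (Fin n × Fin 2 → ℝ)

/-- Smooth real functions on an open subset of `ℝ^m`. -/
abbrev Smooth {m : ℕ} (U : Opens (Body m)) : Type :=
  C^∞⟮𝓘(ℝ, Body m), U; 𝓘(ℝ, ℝ), ℝ⟯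

/-- Sections over `U` of the structure sheaf `C^∞ ⊗ Λ_{2n}` of `ℝ^{m|2n}`. -/
abbrev SuperFun {m : ℕ} (n : ℕ) (U : Opens (Body m)) : Type :=
  Smooth U ⊗[ℝ] Grass n

/-- Pull-back of smooth functions along a smooth map between open sets. -/
def smoothComp {m : ℕ} {U V : Opens (Body m)}
    (F : C^∞⟮𝓘(ℝ, Body m), V; 𝓘(ℝ, Body m), U⟯) : Smooth U →ₐ[ℝ] Smooth V where
  toFun f := f.comp F
  map_one' := rfl
  map_mul' _ _ := rfl
  map_zero' := rfl
  map_add' _ _ := rfl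
  commutes' _ := rfl

/-- Restriction maps of the structure sheaf. -/
def res {m : ℕ} (n : ℕ) {U V : Opens (Body m)} (h : V ≤ U) :
    SuperFun n U →ₐ[ℝ] SuperFun n V :=
  Algebra.TensorProduct.map (smoothComp ⟨Set.inclusion h, contMDiff_inclusion h⟩)
    (AlgHom.id ℝ (Grass n))

/-- The homogeneous superfunctions of parity `p`. -/
def parity {m : ℕ} (n : ℕ) (U : Opens (Body m)) (p : ZMod 2) : Submodule ℝ (SuperFun n U) :=
  LinearMap.range (LinearMap.lTensor (Smooth U)
    (CliffordAlgebra.evenOdd (0 : QuadraticForm ℝ (Fin n × Fin 2 → ℝ)) p).subtype)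

/-- The parity automorphism `f ↦ (-1)^{|f|} f`. -/
def gradeInv {m : ℕ} (n : ℕ) (U : Opens (Body m)) : SuperFun n U →ₐ[ℝ] SuperFun n U :=
  Algebra.TensorProduct.map (AlgHom.id ℝ (Smooth U)) CliffordAlgebra.involute

/-- A morphism of supermanifolds `ℝ^{m|2n} → ℝ^{m|2n}`: a smooth map `φ` together with a morphism
of sheaves of superalgebras `φ♯ : 𝒪 → φ_* 𝒪`. -/
structure SuperEnd (m n : ℕ) where
  base : C(Body m, Body m)
  smooth : ContDiff ℝ ∞ base
  pull : ∀ U : Opens (Body m), SuperFun n U →ₐ[ℝ] SuperFun n (Opens.comap base U)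
  pull_parity : ∀ (U : Opens (Body m)) (p : ZMod 2), ∀ f ∈ parity n U p,
    pull U f ∈ parity n (Opens.comap base U) p
  pull_res : ∀ (U V : Opens (Body m)) (h : V ≤ U) (f : SuperFun n U),
    pull V (res n h f) = res n (Opens.comap_mono base h) (pull U f)

theorem SuperEnd.ext' {m n : ℕ} {Φ Ψ : SuperEnd m n} (hb : Φ.base = Ψ.base)
    (hp : HEq Φ.pull Ψ.pull) : Φ = Ψ := by
  cases Φ
  cases Ψ
  cases hb
  cases hp
  rfl

/-- Composition `Φ ∘ Ψ`. -/
def SuperEnd.comp {m n : ℕ} (Φ Ψ : SuperEnd m n) : SuperEnd m n where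
  base := Φ.base.comp Ψ.base
  smooth := Φ.smooth.comp Ψ.smooth
  pull := fun U => (Ψ.pull (Opens.comap Φ.base U)).comp (Φ.pull U)
  pull_parity := fun U p f hf =>
    Ψ.pull_parity (Opens.comap Φ.base U) p (Φ.pull U f) (Φ.pull_parity U p f hf)
  pull_res := fun U V h f => by
    have h1 := Φ.pull_res U V h f
    have h2 := Ψ.pull_res (Opens.comap Φ.base U) (Opens.comap Φ.base V)
      (Opens.comap_mono Φ.base h) (Φ.pull U f)
    exact (congrArg (Ψ.pull (Opens.comap Φ.base V)) h1).trans h2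

/-- The identity morphism. -/
def SuperEnd.id (m n : ℕ) : SuperEnd m n where
  base := ContinuousMap.id _
  smooth := contDiff_id
  pull := fun U => AlgHom.id ℝ (SuperFun n U)
  pull_parity := fun _ _ _ hf => hf
  pull_res := fun U V h f => by
    exact Eq.refl (res n h f)

instance (m n : ℕ) : Monoid (SuperEnd m n) where
  mul Φ Ψ := Φ.comp Ψ
  one := SuperEnd.id m n
  mul_assoc Φ Ψ Χ := by
    refine SuperEnd.ext' (Φ := (Φ.comp Ψ).comp Χ) (Ψ := Φ.comp (Ψ.comp Χ)) rfl ?_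
    exact HEq.refl fun U => ((Χ.pull (Opens.comap Ψ.base (Opens.comap Φ.base U))).comp
      (Ψ.pull (Opens.comap Φ.base U))).comp (Φ.pull U)
  one_mul Φ := SuperEnd.ext' (Φ := (SuperEnd.id m n).comp Φ) rfl (HEq.refl Φ.pull)
  mul_one Φ := SuperEnd.ext' (Φ := Φ.comp (SuperEnd.id m n)) rfl (HEq.refl Φ.pull)

/-- Supermanifold diffeomorphisms of `ℝ^{m|2n}`: the invertible endomorphisms, under composition. -/
abbrev SuperDiffeo (m n : ℕ) : Type := (SuperEnd m n)ˣ

/-- The superalgebra `𝒪(ℝ^{m|2n})` of superfunctions (global sections). -/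
abbrev Glob (m n : ℕ) : Type := SuperFun n (⊤ : Opens (Body m))

/-- The homomorphism `φ♯` induced on global sections (the preimage of `ℝ^m` being `ℝ^m`). -/
def sharp {m n : ℕ} (Φ : SuperEnd m n) : Glob m n →ₐ[ℝ] Glob m n :=
  (res n (V := ⊤) (U := Opens.comap Φ.base ⊤) (fun _ _ => trivial)).comp (Φ.pull ⊤)

theorem res_refl {m n : ℕ} {U : Opens (Body m)} (h : U ≤ U) (f : SuperFun n U) :
    res n h f = f := by
  have : res n h = AlgHom.id ℝ (SuperFun n U) := by
    refine Algebra.TensorProduct.ext ?_ ?_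
    · ext f
      rfl
    · ext v
      simp [res]
  rw [this]
  rfl

theorem sharp_apply {m n : ℕ} (Φ : SuperEnd m n) (f : Glob m n) : sharp Φ f = Φ.pull ⊤ f :=
  res_refl (n := n) (U := Opens.comap Φ.base ⊤) le_rfl _

theorem sharp_mul {m n : ℕ} (Φ Ψ : SuperEnd m n) (f : Glob m n) :
    sharp (Φ * Ψ) f = sharp Ψ (sharp Φ f) := by
  rw [sharp_apply, sharp_apply, sharp_apply]
  rfl

theorem sharp_one {m n : ℕ} (f : Glob m n) : sharp (1 : SuperEnd m n) f = f := by
  rw [sharp_apply]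
  rfl

theorem sharp_parity {m n : ℕ} (Φ : SuperEnd m n) (p : ZMod 2) (f : Glob m n)
    (hf : f ∈ parity n ⊤ p) : sharp Φ f ∈ parity n ⊤ p := by
  rw [sharp_apply]
  exact Φ.pull_parity ⊤ p f hf

theorem sharp_inv_sharp {m n : ℕ} (Φ : SuperDiffeo m n) (f : Glob m n) :
    sharp (↑Φ⁻¹ : SuperEnd m n) (sharp (Φ : SuperEnd m n) f) = f := by
  rw [← sharp_mul, Units.mul_inv, sharp_one]

theorem sharp_sharp_inv {m n : ℕ} (Φ : SuperDiffeo m n) (f : Glob m n) :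
    sharp (Φ : SuperEnd m n) (sharp (↑Φ⁻¹ : SuperEnd m n) f) = f := by
  rw [← sharp_mul, Units.inv_mul, sharp_one]

/-- Evaluation of the smooth coefficients of a superfunction at a point, with value in `Λ_{2n}`. -/
def evalGrass {m n : ℕ} (p : Body m) : Glob m n →ₐ[ℝ] Grass n :=
  Algebra.TensorProduct.lift
    ((Algebra.ofId ℝ (Grass n)).comp
      ((Pi.evalAlgHom ℝ (fun _ => ℝ) (⟨p, trivial⟩ : (⊤ : Opens (Body m)))).comp
        ContMDiffMap.coeFnAlgHom))
    (AlgHom.id ℝ (Grass n)) (fun f v => Algebra.commutes (R := ℝ) (A := Grass n) (f ⟨p, trivial⟩) v)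

/-- The evaluation `δ_p♯ f = [f]_0(p)` of a superfunction at a point. -/
def delta {m n : ℕ} (p : Body m) : Glob m n →ₐ[ℝ] ℝ :=
  ExteriorAlgebra.algebraMapInv.comp (evalGrass p)

/-! ### Vector fields -/

/-- The sign `(-1)^{ab}`. -/
def koszul (a b : ZMod 2) : ℝ := if a = 1 ∧ b = 1 then -1 else 1

/-- Linear endomorphisms of the space of superfunctions. -/
abbrev Op (m n : ℕ) : Type := Glob m n →ₗ[ℝ] Glob m n

/-- Homogeneous vector fields of parity `p`: superderivations of parity `p` of the superalgebra of
superfunctions. -/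
def HomDer (m n : ℕ) (p : ZMod 2) : Submodule ℝ (Op m n) where
  carrier := {D | (∀ q, ∀ f ∈ parity n ⊤ q, D f ∈ parity n ⊤ (p + q)) ∧
    ∀ q, ∀ f ∈ parity n ⊤ q, ∀ h, D (f * h) = D f * h + koszul p q • (f * D h)}
  zero_mem' := by simp
  add_mem' := by
    rintro D E ⟨h1, h2⟩ ⟨h3, h4⟩
    refine ⟨fun q f hf => add_mem (h1 q f hf) (h3 q f hf), fun q f hf h => ?_⟩
    simp only [LinearMap.add_apply, h2 q f hf, h4 q f hf, add_mul, mul_add, smul_add]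
    abel
  smul_mem' := by
    rintro c D ⟨h1, h2⟩
    refine ⟨fun q f hf => Submodule.smul_mem _ _ (h1 q f hf), fun q f hf h => ?_⟩
    simp only [LinearMap.smul_apply, h2 q f hf, smul_add, smul_mul_assoc, mul_smul_comm]
    rw [smul_comm]

/-- All vector fields `Der 𝒪(ℝ^{m|2n})`. -/
def Der (m n : ℕ) : Submodule ℝ (Op m n) := HomDer m n 0 ⊔ HomDer m n 1

/-- The supercommutator `D E - (-1)^{ab} E D` of operators of parities `a`, `b`. -/
def superComm {m n : ℕ} (a b : ZMod 2) (D E : Op m n) : Op m n :=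
  D ∘ₗ E - koszul a b • (E ∘ₗ D)

/-- Index set of the `m + 2n` coordinates. -/
abbrev Idx (m n : ℕ) : Type := Fin m ⊕ (Fin n × Fin 2)

/-- The parity `[i]` of an index. -/
def deg {m n : ℕ} : Idx m n → ZMod 2 := Sum.elim (fun _ => 0) (fun _ => 1)

/-- The bosonic coordinate functions. -/
def bosCoord {m : ℕ} (i : Fin m) : Smooth (⊤ : Opens (Body m)) :=
  ⟨fun x => (x : Body m) i,
    (contDiff_apply ℝ ℝ i).contMDiff.comp contMDiff_subtype_val⟩

/-- The coordinates `X_i` of the supervector. -/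
def coord {m n : ℕ} : Idx m n → Glob m n :=
  Sum.elim (fun i => bosCoord i ⊗ₜ 1) (fun k => 1 ⊗ₜ ExteriorAlgebra.ι ℝ (Pi.single k 1))

/-- A smooth function on all of `ℝ^m`, as a function on the vector space. -/
def toBody {m : ℕ} (f : Smooth (⊤ : Opens (Body m))) (x : Body m) : ℝ := f ⟨x, trivial⟩

theorem contDiff_toBody {m : ℕ} (f : Smooth (⊤ : Opens (Body m))) :
    ContDiff ℝ ∞ (toBody f) := by
  rw [← contMDiff_iff_contDiff]
  refine f.contMDiff.comp (?_ : ContMDiff 𝓘(ℝ, Body m) 𝓘(ℝ, Body m) ∞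
    (fun x : Body m => (⟨x, trivial⟩ : (⊤ : Opens (Body m)))))
  exact (ContMDiff.subtypeVal_comp_iff (⊤ : Opens (Body m)) _).1 contMDiff_id

/-- Partial derivatives of smooth functions. -/
def bosPartial {m : ℕ} (i : Fin m) :
    Smooth (⊤ : Opens (Body m)) →ₗ[ℝ] Smooth (⊤ : Opens (Body m)) where
  toFun f := ⟨fun x => fderiv ℝ (toBody f) x (Pi.single i 1), by
    have h : ContDiff ℝ ∞ (fun x => fderiv ℝ (toBody f) x (Pi.single i 1)) :=
      ((contDiff_toBody f).fderiv_right (by simp)).clm_apply contDiff_const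
    exact h.contMDiff.comp contMDiff_subtype_val⟩
  map_add' f h := by
    ext x
    have := fderiv_add (x := (x : Body m)) ((contDiff_toBody f).differentiable (by simp) _)
      ((contDiff_toBody h).differentiable (by simp) _)
    exact congrArg (fun L => L (Pi.single i 1)) this
  map_smul' c f := by
    ext x
    have := fderiv_const_smul (x := (x : Body m))
      ((contDiff_toBody f).differentiable (by simp) _) c
    exact congrArg (fun L => L (Pi.single i 1)) this

/-- The (left) partial derivatives `∂_{X_i}` on superfunctions. -/
def partialX {m n : ℕ} : Idx m n → Op m n :=
  Sum.elim (fun i => LinearMap.rTensor (Grass n) (bosPartial i))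
    (fun k => LinearMap.lTensor (Smooth (⊤ : Opens (Body m)))
      (CliffordAlgebra.contractLeft (Q := (0 : QuadraticForm ℝ (Fin n × Fin 2 → ℝ)))
        (LinearMap.proj k)))

/-! ### The orthosymplectic metric -/

/-- The matrix `J`, block diagonal with `n` blocks `½ (0, -1; 1, 0)`. -/
def matJ (n : ℕ) : Matrix (Fin n × Fin 2) (Fin n × Fin 2) ℝ :=
  Matrix.of fun k l => if k.1 = l.1 then !![0, -1 / 2; 1 / 2, 0] k.2 l.2 else 0

/-- The orthosymplectic metric `g = diag(I_m, J)`. -/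
def matG (m n : ℕ) : Matrix (Idx m n) (Idx m n) ℝ := Matrix.fromBlocks 1 0 0 (matJ n)

/-- `X^j = ∑_i X_i g^{ij}`. -/
def coordUp {m n : ℕ} (j : Idx m n) : Glob m n := ∑ i, matG m n i j • coord i

/-- `∇_j = ∂_{X^j}`, the partial derivatives for the coordinates `X^j`; by the chain rule and
`X_k = ∑_j X^j (g⁻¹)_{jk}` they are `∑_k (g⁻¹)_{jk} ∂_{X_k}`. -/
def nablaDown {m n : ℕ} (j : Idx m n) : Op m n := ∑ k, (matG m n)⁻¹ j k • partialX k

/-- The metric on vector fields, `⟨f ∇_j, h ∇^k⟩ = (-1)^{|h|[j]} δ_j^k f h`. The coefficients of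
`Y = ∑_j Y^j ∇_j` are `Y^j = Y(X^j)`, and those of `Z = ∑_j Z_j ∇^j` are
`Z_j = (-1)^{[j]} Z(X_j)`, because
`∇^j = ∑_i g^{ij} ∇_i = (-1)^{[j]} ∂_{X_j}`. -/
def metric {m n : ℕ} (Y Z : Op m n) : Glob m n :=
  ∑ j : Idx m n, Y (coordUp j) *
    (if deg j = 0 then Z (coord j) else gradeInv n ⊤ (-Z (coord j)))

/-! ### Isometries and Killing fields -/

/-- `Y_φ = (φ♯)⁻¹ ∘ Y ∘ φ♯`. -/
def push {m n : ℕ} (Φ : SuperDiffeo m n) (Y : Op m n) : Op m n :=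
  (sharp (↑Φ⁻¹ : SuperEnd m n)).toLinearMap ∘ₗ Y ∘ₗ (sharp (Φ : SuperEnd m n)).toLinearMap

theorem push_apply {m n : ℕ} (Φ : SuperDiffeo m n) (Y : Op m n) (f : Glob m n) :
    push Φ Y f = sharp (↑Φ⁻¹ : SuperEnd m n) (Y (sharp (Φ : SuperEnd m n) f)) := rfl

theorem push_mul {m n : ℕ} (Φ Ψ : SuperDiffeo m n) (Y : Op m n) :
    push (Φ * Ψ) Y = push Φ (push Ψ Y) := by
  apply LinearMap.ext
  intro f
  simp only [push_apply, mul_inv_rev, Units.val_mul, sharp_mul]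

theorem push_mem_Der {m n : ℕ} (Φ : SuperDiffeo m n) {Y : Op m n} (hY : Y ∈ Der m n) :
    push Φ Y ∈ Der m n := by
  have key : ∀ p, ∀ Y ∈ HomDer m n p, push Φ Y ∈ HomDer m n p := by
    rintro p Y ⟨h1, h2⟩
    refine ⟨fun q f hf => sharp_parity _ _ _ (h1 q _ (sharp_parity _ _ _ hf)),
      fun q f hf h => ?_⟩
    simp only [push_apply, map_mul, h2 q _ (sharp_parity _ _ _ hf), map_add, map_smul,
      sharp_inv_sharp]
  obtain ⟨Y0, h0, Y1, h1, rfl⟩ := Submodule.mem_sup.1 hY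
  have : push Φ (Y0 + Y1) = push Φ Y0 + push Φ Y1 := by
    apply LinearMap.ext
    intro f
    simp only [push_apply, LinearMap.add_apply, map_add]
  rw [this]
  exact add_mem (Submodule.mem_sup_left (key _ _ h0)) (Submodule.mem_sup_right (key _ _ h1))

/-- The group of isometries: diffeomorphisms `Φ` with `φ♯⟨Y_φ, Z_φ⟩ = ⟨Y, Z⟩`. -/
def isometryGroup (m n : ℕ) : Subgroup (SuperDiffeo m n) where
  carrier := {Φ | ∀ Y ∈ Der m n, ∀ Z ∈ Der m n,
    sharp (Φ : SuperEnd m n) (metric (push Φ Y) (push Φ Z)) = metric Y Z}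
  one_mem' Y _ Z _ := by
    have h : ∀ Y : Op m n, push 1 Y = Y := fun Y => by
      apply LinearMap.ext
      intro f
      simp only [push_apply, inv_one, Units.val_one, sharp_one]
    rw [h, h, Units.val_one, sharp_one]
  mul_mem' {Φ Ψ} hΦ hΨ Y hY Z hZ := by
    rw [push_mul, push_mul, Units.val_mul, sharp_mul,
      hΦ _ (push_mem_Der Ψ hY) _ (push_mem_Der Ψ hZ), hΨ Y hY Z hZ]
  inv_mem' {Φ} hΦ Y hY Z hZ := by
    have h : ∀ Y : Op m n, push Φ (push Φ⁻¹ Y) = Y := fun Y => by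
      apply LinearMap.ext
      intro f
      simp only [push_apply, inv_inv, sharp_inv_sharp]
    have := hΦ _ (push_mem_Der Φ⁻¹ hY) _ (push_mem_Der Φ⁻¹ hZ)
    rw [h, h] at this
    rw [← this, sharp_inv_sharp]

/-- The group `ℋ₀` of isometries stabilizing the origin: `δ_0♯ ∘ φ♯ = δ_0♯`. -/
def isometryGroup₀ (m n : ℕ) : Subgroup (SuperDiffeo m n) where
  carrier := {Φ | Φ ∈ isometryGroup m n ∧
    ∀ f : Glob m n, delta 0 (sharp (Φ : SuperEnd m n) f) = delta 0 f}
  one_mem' := ⟨one_mem _, fun f => by rw [Units.val_one, sharp_one]⟩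
  mul_mem' {Φ Ψ} hΦ hΨ :=
    ⟨mul_mem hΦ.1 hΨ.1, fun f => by rw [Units.val_mul, sharp_mul, hΨ.2, hΦ.2]⟩
  inv_mem' {Φ} hΦ := ⟨inv_mem hΦ.1, fun f => by
    rw [← hΦ.2 (sharp _ f), sharp_sharp_inv]⟩

/-- A homogeneous Killing vector field of parity `a`:
`F⟨Y, Z⟩ = ⟨[F, Y], Z⟩ + (-1)^{|F||Y|} ⟨Y, [F, Z]⟩` for all homogeneous vector fields `Y, Z`. -/
def IsKilling {m n : ℕ} (a : ZMod 2) (F : Op m n) : Prop :=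
  F ∈ HomDer m n a ∧ ∀ b c, ∀ Y ∈ HomDer m n b, ∀ Z ∈ HomDer m n c,
    F (metric Y Z) = metric (superComm a b F Y) Z + koszul a b • metric Y (superComm a c F Z)

/-- The space of Killing vector fields. -/
def killing (m n : ℕ) : Submodule ℝ (Op m n) := Submodule.span ℝ {F | ∃ a, IsKilling a F}

/-- The space `𝔥` of Killing vector fields `F` stabilizing the origin: `δ_0♯ ∘ F = 0`. -/
def killing₀ (m n : ℕ) : Submodule ℝ (Op m n) where
  carrier := {F | F ∈ killing m n ∧ ∀ f : Glob m n, delta 0 (F f) = 0}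
  zero_mem' := ⟨zero_mem _, fun f => by simp⟩
  add_mem' h h' := ⟨add_mem h.1 h'.1, fun f => by simp [h.2 f, h'.2 f]⟩
  smul_mem' c _ h := ⟨Submodule.smul_mem _ c h.1, fun f => by simp [h.2 f]⟩

/-- The operators `L_{ij} = X_i ∂_{X^j} - (-1)^{[i][j]} X_j ∂_{X^i}`. -/
def opL {m n : ℕ} (i j : Idx m n) : Op m n :=
  LinearMap.mulLeft ℝ (coord i) ∘ₗ nablaDown j -
    koszul (deg i) (deg j) • (LinearMap.mulLeft ℝ (coord j) ∘ₗ nablaDown i)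

/-! ### The Harish-Chandra pair `(O(m) × Sp(2n), 𝔬𝔰𝔭(m|2n))` -/

/-- `Sp(2n)`: the invertible real matrices `B` with `Bᵀ J B = J`. -/
def Sp (n : ℕ) : Subgroup (GL (Fin n × Fin 2) ℝ) where
  carrier := {B | (B : Matrix _ _ ℝ)ᵀ * matJ n * (B : Matrix _ _ ℝ) = matJ n}
  one_mem' := by simp
  mul_mem' {A B} hA hB := by
    simp only [Set.mem_ofPred_eq, Units.val_mul, Matrix.transpose_mul] at *
    calc _ = (B : Matrix _ _ ℝ)ᵀ * ((A : Matrix _ _ ℝ)ᵀ * matJ n * (A : Matrix _ _ ℝ)) *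
          (B : Matrix _ _ ℝ) := by simp only [Matrix.mul_assoc]
      _ = _ := by rw [hA, hB]
  inv_mem' {B} hB := by
    simp only [Set.mem_ofPred_eq] at *
    have h : (B : Matrix (Fin n × Fin 2) (Fin n × Fin 2) ℝ) * (B⁻¹).1 = 1 := by
      rw [← Units.val_mul, mul_inv_cancel, Units.val_one]
    have h' := congrArg Matrix.transpose h
    rw [Matrix.transpose_mul, Matrix.transpose_one] at h'
    calc _ = (B⁻¹).1ᵀ * (B.1ᵀ * matJ n * B.1) * (B⁻¹).1 := by rw [hB]
      _ = ((B⁻¹).1ᵀ * B.1ᵀ) * matJ n * (B.1 * (B⁻¹).1) := by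
        simp only [Matrix.mul_assoc]
      _ = _ := by rw [h, h', Matrix.one_mul, Matrix.mul_one]

/-- The Lie group `O(m) × Sp(2n)`. -/
abbrev EvenGroup (m n : ℕ) : Type := Matrix.orthogonalGroup (Fin m) ℝ × Sp n

/-- The block diagonal matrix of an element of `O(m) × Sp(2n)`. -/
def toMat {m n : ℕ} (S : EvenGroup m n) : Matrix (Idx m n) (Idx m n) ℝ :=
  Matrix.fromBlocks (S.1 : Matrix (Fin m) (Fin m) ℝ) 0 0
    ((S.2 : GL (Fin n × Fin 2) ℝ) : Matrix (Fin n × Fin 2) (Fin n × Fin 2) ℝ)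

/-- Pull-back of smooth functions along the linear map `x ↦ A x`. -/
def linPull {m : ℕ} (A : Matrix (Fin m) (Fin m) ℝ) :
    Smooth (⊤ : Opens (Body m)) →ₐ[ℝ] Smooth (⊤ : Opens (Body m)) :=
  smoothComp ⟨fun x => ⟨A *ᵥ (x : Body m), trivial⟩, by
    refine (ContMDiff.subtypeVal_comp_iff (⊤ : Opens (Body m)) _).1 ?_
    exact (Matrix.mulVecLin A).toContinuousLinearMap.contDiff.contMDiff.comp
      contMDiff_subtype_val⟩

/-- The linear substitution `f(x) ↦ f(S · x)`, `(S · x)_j = ∑_k S_{jk} X_k`. -/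
def subst {m n : ℕ} (S : EvenGroup m n) : Glob m n →ₐ[ℝ] Glob m n :=
  Algebra.TensorProduct.map (linPull (S.1 : Matrix (Fin m) (Fin m) ℝ))
    (ExteriorAlgebra.map (Matrix.toLin'
      ((S.2 : GL (Fin n × Fin 2) ℝ) : Matrix (Fin n × Fin 2) (Fin n × Fin 2) ℝ)ᵀ))

/-- The matrices of parity `a` in `𝔬𝔰𝔭(m|2n)`: those `A` of parity `a` with
`β(A e_l, e_k) + (-1)^{|A|[l]} β(e_l, A e_k) = 0` for the bilinear form `β(e_l, e_k) = g_{kl}`. -/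
def ospHom (m n : ℕ) (a : ZMod 2) : Submodule ℝ (Matrix (Idx m n) (Idx m n) ℝ) where
  carrier := {A | (∀ i j, deg i + deg j ≠ a → A i j = 0) ∧
    ∀ k l, (∑ i, A i l * matG m n k i) + koszul a (deg l) * ∑ i, A i k * matG m n i l = 0}
  zero_mem' := by simp
  add_mem' {A B} hA hB := by
    refine ⟨fun i j h => by simp [hA.1 i j h, hB.1 i j h], fun k l => ?_⟩
    have h1 := hA.2 k l
    have h2 := hB.2 k l
    simp only [Matrix.add_apply, add_mul, Finset.sum_add_distrib, mul_add]
    linarith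
  smul_mem' c A hA := by
    refine ⟨fun i j h => by simp [hA.1 i j h], fun k l => ?_⟩
    have h1 := hA.2 k l
    simp only [Matrix.smul_apply, smul_eq_mul, mul_assoc, ← Finset.mul_sum]
    rw [mul_left_comm, ← mul_add, h1, mul_zero]

/-- The orthosymplectic Lie superalgebra `𝔬𝔰𝔭(m|2n)`. -/
def osp (m n : ℕ) : Submodule ℝ (Matrix (Idx m n) (Idx m n) ℝ) := ospHom m n 0 ⊔ ospHom m n 1

/-- The superbracket `A B - (-1)^{ab} B A` of matrices of parities `a`, `b`. -/
def matComm {m n : ℕ} (a b : ZMod 2) (A B : Matrix (Idx m n) (Idx m n) ℝ) :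
    Matrix (Idx m n) (Idx m n) ℝ :=
  A * B - koszul a b • (B * A)

/-- The linear vector field of a matrix, `X_i ↦ -(-1)^{|A|[i]} ∑_k A_{ik} X_k`; the entry `A_{ik}`
has parity `[i] + [k]`. -/
def linField {m n : ℕ} (A : Matrix (Idx m n) (Idx m n) ℝ) : Op m n :=
  -∑ i, ∑ k, (koszul (deg i + deg k) (deg i) * A i k) •
    (LinearMap.mulLeft ℝ (coord k) ∘ₗ partialX i)

/-- The topology of pointwise convergence on diffeomorphisms: the coarsest one for which all real
coefficients of `(φ♯ f)(p)`, `f` a superfunction and `p` a point, depend continuously on `Φ`. -/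
instance (m n : ℕ) : TopologicalSpace (SuperDiffeo m n) :=
  TopologicalSpace.induced
    (fun Φ (x : Glob m n × Body m × Module.Dual ℝ (Grass n)) =>
      x.2.2 (evalGrass x.2.1 (sharp (Φ : SuperEnd m n) x.1))) inferInstance

end Superspace
end

open Superspace

open scoped Manifold ContDiff TensorProduct Matrix
open TopologicalSpace

noncomputable section

namespace Superspace

/-! ### Signs -/

/-! The metric sees a vector field only through its values on the coordinates (`metric_eq_pairing`).
Isometries and Killing fields therefore become equations for one column of superfunctions: φ_i =
φ♯X_i for an isometry, F X_i for a Killing field.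

What forces linearity is the graded form of the classical rigidity argument for flat space. For an
isometry, ⟨∂_aφ, ∂_bφ⟩ is constant. Differentiating it shows that T_{cab} = ⟨∂_c∂_aφ, ∂_bφ⟩ is
antisymmetric in a, b up to a sign, while supercommutation of the derivatives makes it symmetric in
c, a up to a sign; such a tensor is zero (`eq_zero_of_symm_antisymm`). Since the Jacobian is
invertible and the pairing nondegenerate, all ∂_c∂_aφ_i vanish (`partialX_partialX_sharp_coord`), so
φ is affine. Fixing the origin removes the constants, preservation of parity makes the matrix M
block diagonal, and the metric on the ∂_a gives MᵀgM = g. The linearized argument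
(`exists_of_isKilling`) shows that a Killing field is a constant field plus a linear one whose
matrix satisfies the defining relation of 𝔬𝔰𝔭. The converses are invariance computations for the
pairing (`pairing_linear`, `pairing_infinitesimal`).

Passing from coordinates back to the geometric objects uses two determination results, both resting
on Hadamard's lemma: a superderivation is determined by its values on the coordinates
(`HomDer_ext`), and so is a morphism whose pulled-back even coordinates have no nilpotent part
(`SuperEnd_ext`). For morphisms one must also recover the body map and the action on sections over
small open sets, which is done with invertible functions and bump functions.

The remaining clauses are linear algebra with signs and one-variable calculus: brackets and
conjugation are compared on coordinates, the L_{ij} arise by antisymmetrizing the coefficients after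
lowering an index, the even part is treated by differentiating exp(tA) at 0, and the topologies
agree because matrix entries are themselves coefficients of pulled-back coordinates. -/

theorem zmod_two_cases (a : ZMod 2) : a = 0 ∨ a = 1 := by
  revert a; decide

@[simp] theorem koszul_zero_left (a : ZMod 2) : koszul 0 a = 1 := by simp [koszul]

@[simp] theorem koszul_zero_right (a : ZMod 2) : koszul a 0 = 1 := by simp [koszul]

@[simp] theorem koszul_one_one : koszul 1 1 = -1 := by simp [koszul]

theorem koszul_comm (a b : ZMod 2) : koszul a b = koszul b a := by
  simp only [koszul, and_comm]

theorem koszul_mul_self (a b : ZMod 2) : koszul a b * koszul a b = 1 := by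
  unfold koszul; split_ifs <;> norm_num

theorem koszul_ne_zero (a b : ZMod 2) : koszul a b ≠ 0 := by
  unfold koszul; split_ifs <;> norm_num

theorem koszul_add_right (a b c : ZMod 2) : koszul a (b + c) = koszul a b * koszul a c := by
  have h2 : (1 : ZMod 2) + 1 = 0 := by decide
  rcases zmod_two_cases a with rfl | rfl <;> rcases zmod_two_cases b with rfl | rfl <;>
    rcases zmod_two_cases c with rfl | rfl <;> simp [h2]

theorem koszul_add_left (a b c : ZMod 2) : koszul (a + b) c = koszul a c * koszul b c := by
  rw [koszul_comm, koszul_add_right, koszul_comm c a, koszul_comm c b]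

/-! ### The Grassmann algebra -/

section Grass

variable {n : ℕ}

/-- The quadratic form whose Clifford algebra is the Grassmann algebra. -/
abbrev Q0 (n : ℕ) : QuadraticForm ℝ (Fin n × Fin 2 → ℝ) := 0

theorem grass_induction {P : Grass n → Prop} (h0 : ∀ r, P (algebraMap ℝ _ r))
    (hadd : ∀ x y, P x → P y → P (x + y))
    (hmul : ∀ x v, P x → P (ExteriorAlgebra.ι ℝ v * x)) (x : Grass n) : P x :=
  CliffordAlgebra.left_induction (Q0 n) (P := P) h0 hadd hmul x

theorem grass_mul_ι (x : Grass n) (v : Fin n × Fin 2 → ℝ) :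
    x * ExteriorAlgebra.ι ℝ v = ExteriorAlgebra.ι ℝ v *
      (CliffordAlgebra.involute (Q := Q0 n) x : Grass n) := by
  induction x using grass_induction with
  | h0 r => rw [AlgHom.commutes, Algebra.commutes]
  | hadd x y hx hy => rw [add_mul, hx, hy, ← mul_add, ← map_add]
  | hmul x u hx =>
    have h1 : ExteriorAlgebra.ι ℝ u * ExteriorAlgebra.ι ℝ v =
        -(ExteriorAlgebra.ι ℝ v * ExteriorAlgebra.ι ℝ u) :=
      eq_neg_of_add_eq_zero_left (ExteriorAlgebra.ι_add_mul_swap (R := ℝ) u v)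
    have h2 : (CliffordAlgebra.involute (Q := Q0 n) (ExteriorAlgebra.ι ℝ u) : Grass n) =
        -ExteriorAlgebra.ι ℝ u := CliffordAlgebra.involute_ι u
    rw [mul_assoc, hx, ← mul_assoc, h1, map_mul, h2]
    simp only [neg_mul, mul_neg, mul_assoc]

/-- Passing one generator applies the parity involution to `x`, so passing two applies it twice and
changes nothing. The induction can thus strip generators from `y` in pairs, leaving a scalar or a
single vector. -/
theorem grass_supercomm {q : ZMod 2} (y : Grass n) (hy : y ∈ CliffordAlgebra.evenOdd (Q0 n) q)
    (x : Grass n) :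
    x * y = y * (if q = 0 then x else (CliffordAlgebra.involute (Q := Q0 n) x : Grass n)) := by
  induction y, hy using CliffordAlgebra.evenOdd_induction generalizing x with
  | range_ι_pow y hy =>
    rcases zmod_two_cases q with rfl | rfl
    · obtain ⟨r, rfl⟩ := Submodule.mem_one.1 (by simpa using hy)
      simpa using (Algebra.commutes r x).symm
    · have hy' : y ∈ LinearMap.range (CliffordAlgebra.ι (Q0 n)) := by
        simpa [ZMod.val_one] using hy
      obtain ⟨v, rfl⟩ := hy'
      simpa using grass_mul_ι x v
  | add x' y' _ _ h1 h2 => rw [mul_add, h1, h2, add_mul]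
  | ι_mul_ι_mul u v y _ ih =>
    have hu := grass_mul_ι (n := n) x u
    have hv := grass_mul_ι (n := n) (CliffordAlgebra.involute (Q := Q0 n) x : Grass n) v
    have hi : (CliffordAlgebra.involute (Q := Q0 n)
      (CliffordAlgebra.involute (Q := Q0 n) x) : Grass n) = x :=
        CliffordAlgebra.involute_involute x
    rw [hi] at hv
    have key : x * (ExteriorAlgebra.ι ℝ u * ExteriorAlgebra.ι ℝ v) =
        ExteriorAlgebra.ι ℝ u * ExteriorAlgebra.ι ℝ v * x := by
      rw [← mul_assoc, hu, mul_assoc, hv, mul_assoc]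
    have e : (CliffordAlgebra.ι (Q0 n) u * CliffordAlgebra.ι (Q0 n) v * y : Grass n) =
      ExteriorAlgebra.ι ℝ u * ExteriorAlgebra.ι ℝ v * y := rfl
    rw [e, ← mul_assoc, key, mul_assoc, ih x, ← mul_assoc]

/-- Contraction with a linear form, as an operator on the Grassmann algebra. -/
def contract (d : Module.Dual ℝ (Fin n × Fin 2 → ℝ)) : Grass n →ₗ[ℝ] Grass n :=
  CliffordAlgebra.contractLeft (Q := Q0 n) d

/-- The parity automorphism of the Grassmann algebra. -/
def inv' (n : ℕ) : Grass n →ₐ[ℝ] Grass n := CliffordAlgebra.involute (Q := Q0 n)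

variable (d d' : Module.Dual ℝ (Fin n × Fin 2 → ℝ))

theorem inv'_ι (v : Fin n × Fin 2 → ℝ) :
    inv' n (ExteriorAlgebra.ι ℝ v) = -ExteriorAlgebra.ι ℝ v := CliffordAlgebra.involute_ι v

theorem contract_algebraMap (r : ℝ) : contract d (algebraMap ℝ (Grass n) r) = 0 :=
  CliffordAlgebra.contractLeft_algebraMap (Q := Q0 n) d r

theorem contract_ι_mul (v : Fin n × Fin 2 → ℝ) (x : Grass n) :
    contract d (ExteriorAlgebra.ι ℝ v * x) = d v • x - ExteriorAlgebra.ι ℝ v * contract d x :=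
  CliffordAlgebra.contractLeft_ι_mul (Q := Q0 n) d v x

theorem contract_ι (v : Fin n × Fin 2 → ℝ) :
    contract d (ExteriorAlgebra.ι ℝ v) = algebraMap ℝ (Grass n) (d v) :=
  CliffordAlgebra.contractLeft_ι (Q := Q0 n) d v

theorem contract_comm (x : Grass n) : contract d (contract d' x) = -contract d' (contract d x) :=
  CliffordAlgebra.contractLeft_comm (Q := Q0 n) d d' x

theorem contract_mul (x y : Grass n) :
    contract d (x * y) = contract d x * y + inv' n x * contract d y := by
  induction x using grass_induction with
  | h0 r =>
    rw [contract_algebraMap, zero_mul, zero_add, AlgHom.commutes, Algebra.algebraMap_eq_smul_one,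
      smul_mul_assoc, smul_mul_assoc, one_mul, one_mul, map_smul]
  | hadd x y hx hy => simp only [add_mul, map_add, hx, hy]; abel
  | hmul x v hx =>
    rw [mul_assoc, contract_ι_mul, hx, contract_ι_mul, map_mul, inv'_ι]
    simp only [mul_add, sub_mul, smul_mul_assoc, neg_mul, mul_assoc]
    abel

theorem inv'_contract (x : Grass n) : inv' n (contract d x) = -contract d (inv' n x) := by
  induction x using grass_induction with
  | h0 r => simp [contract_algebraMap]
  | hadd x y hx hy => simp only [map_add, hx, hy]; abel
  | hmul x v hx =>
    rw [contract_ι_mul, map_sub, map_mul, map_mul, hx, inv'_ι, neg_mul, neg_mul, map_neg,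
      contract_ι_mul, map_smul]
    simp

theorem inv'_of_mem {p : ZMod 2} {x : Grass n} (hx : x ∈ CliffordAlgebra.evenOdd (Q0 n) p) :
    inv' n x = koszul 1 p • x := by
  rcases zmod_two_cases p with rfl | rfl
  · rw [koszul_zero_right, one_smul]
    exact CliffordAlgebra.involute_eq_of_mem_even hx
  · rw [koszul_one_one, neg_one_smul]
    exact CliffordAlgebra.involute_eq_of_mem_odd hx

theorem exists_evenOdd_add (x : Grass n) :
    ∃ x0 ∈ CliffordAlgebra.evenOdd (Q0 n) 0, ∃ x1 ∈ CliffordAlgebra.evenOdd (Q0 n) 1,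
      x0 + x1 = x := by
  have : x ∈ CliffordAlgebra.evenOdd (Q0 n) 0 ⊔ CliffordAlgebra.evenOdd (Q0 n) 1 := by
    rw [(CliffordAlgebra.evenOdd_isCompl (Q0 n)).sup_eq_top]; trivial
  exact Submodule.mem_sup.1 this

/-- The Euler operator `∑ θ_k ∂_{θ_k}`. -/
def euler (n : ℕ) : Grass n →ₗ[ℝ] Grass n :=
  ∑ k, LinearMap.mulLeft ℝ (ExteriorAlgebra.ι ℝ (Pi.single k 1)) ∘ₗ contract (LinearMap.proj k)

theorem sum_smul_ι (v : Fin n × Fin 2 → ℝ) :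
    ∑ k, v k • (ExteriorAlgebra.ι ℝ (Pi.single k (1:ℝ)) : Grass n) = ExteriorAlgebra.ι ℝ v := by
  conv_rhs => rw [← Finset.univ_sum_single v, map_sum]
  refine Finset.sum_congr rfl fun k _ => ?_
  rw [← map_smul]
  congr 1
  ext j
  by_cases h : j = k
  · subst h; simp
  · simp [h]

/-- The contraction of the factor `v` reproduces `v` itself through `sum_smul_ι`; hence
multiplication by a vector raises the Euler eigenvalue by one. -/
theorem euler_ι_mul (v : Fin n × Fin 2 → ℝ) (x : Grass n) :
    euler n (ExteriorAlgebra.ι ℝ v * x) =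
      ExteriorAlgebra.ι ℝ v * x + ExteriorAlgebra.ι ℝ v * euler n x := by
  simp only [euler, LinearMap.sum_apply, LinearMap.comp_apply, LinearMap.mulLeft_apply,
    contract_ι_mul, mul_sub, Finset.sum_sub_distrib, LinearMap.proj_apply, Finset.mul_sum]
  rw [sub_eq_add_neg, ← Finset.sum_neg_distrib]
  congr 1
  · simp only [mul_smul_comm, ← smul_mul_assoc, ← Finset.sum_mul, sum_smul_ι]
  · refine Finset.sum_congr rfl fun k _ => ?_
    rw [← mul_assoc, ← mul_assoc, ← neg_mul]
    congr 1
    exact (eq_neg_of_add_eq_zero_right (ExteriorAlgebra.ι_add_mul_swap (R := ℝ) _ _)).symm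

theorem euler_of_mem (i : ℕ) (x : Grass n) (hx : x ∈ ⋀[ℝ]^i (Fin n × Fin 2 → ℝ)) :
    euler n x = (i : ℝ) • x := by
  induction i generalizing x with
  | zero =>
    obtain ⟨r, rfl⟩ := Submodule.mem_one.1 (by simpa using hx)
    simp [euler, contract_algebraMap]
  | succ i ih =>
    rw [ExteriorAlgebra.exteriorPower, pow_succ'] at hx
    refine Submodule.mul_induction_on hx ?_ ?_
    · rintro _ ⟨v, rfl⟩ y hy
      rw [euler_ι_mul, ih y hy, mul_smul_comm]
      push_cast
      module
    · intro x y hx hy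
      rw [map_add, hx, hy, smul_add]

/-- The Euler operator kills such an `x`, but it multiplies the component of exterior degree i by i.
In characteristic zero only the component of degree 0 can survive. -/
theorem eq_algebraMap_of_contract_eq_zero (x : Grass n)
    (hx : ∀ k, contract (LinearMap.proj k) x = 0) : ∃ r, x = algebraMap ℝ (Grass n) r := by
  classical
  have hE : euler n x = 0 := by simp [euler, hx]
  let A : ℕ → Submodule ℝ (Grass n) := fun i => ⋀[ℝ]^i (Fin n × Fin 2 → ℝ)
  have hs := DirectSum.sum_support_decompose A x
  have h2 : ∀ i : ℕ, (i : ℝ) • (DirectSum.decompose A x i : Grass n) = 0 := by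
    intro i
    have key : ∀ y, ((DirectSum.decompose A (euler n y) i : A i) : Grass n) =
        (i : ℝ) • (DirectSum.decompose A y i : Grass n) := by
      intro y
      induction y using DirectSum.Decomposition.inductionOn A with
      | zero => simp
      | @homogeneous j z =>
        rw [euler_of_mem j _ z.2, DirectSum.decompose_smul, DirectSum.decompose_coe]
        by_cases hj : j = i
        · subst hj
          rw [DirectSum.smul_apply, DirectSum.of_eq_same, Submodule.coe_smul]
        · rw [DirectSum.smul_apply, DirectSum.of_eq_of_ne _ _ _ (Ne.symm hj), smul_zero,
            ZeroMemClass.coe_zero, smul_zero]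
      | add y z hy hz =>
        simp only [map_add, DirectSum.decompose_add, DirectSum.add_apply, Submodule.coe_add, hy, hz,
          smul_add]
    rw [← key, hE]
    simp
  have h4 : x = (DirectSum.decompose A x 0 : Grass n) := by
    conv_lhs => rw [← hs]
    by_cases h0 : (0 : ℕ) ∈ (DirectSum.decompose A x).support
    · rw [Finset.sum_eq_single 0]
      · intro j _ hj
        exact (smul_eq_zero.1 (h2 j)).resolve_left (by exact_mod_cast hj)
      · exact fun h => absurd h0 h
    · have : DirectSum.decompose A x 0 = 0 := by simpa using h0
      rw [this, ZeroMemClass.coe_zero, Finset.sum_eq_zero]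
      intro j hj
      have hj' : j ≠ 0 := fun h => h0 (h ▸ hj)
      exact (smul_eq_zero.1 (h2 j)).resolve_left (by exact_mod_cast hj')
  have h5 : x ∈ A 0 := by rw [h4]; exact (DirectSum.decompose A x 0).2
  obtain ⟨r, hr⟩ := Submodule.mem_one.1 (by simpa [A] using h5)
  exact ⟨r, hr.symm⟩

end Grass

/-! ### Superfunctions -/

section SuperFun

variable {m n : ℕ} {U : Opens (Body m)}

/-- Evaluation of the coefficients of a superfunction on `U` at a point of `U`. -/
def evalAt (p : U) : SuperFun n U →ₐ[ℝ] Grass n :=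
  Algebra.TensorProduct.lift
    ((Algebra.ofId ℝ (Grass n)).comp
      ((Pi.evalAlgHom ℝ (fun _ => ℝ) p).comp ContMDiffMap.coeFnAlgHom))
    (AlgHom.id ℝ (Grass n)) (fun f v => Algebra.commutes (R := ℝ) (A := Grass n) (f p) v)

theorem neg_one_smul' (f : SuperFun n U) : (-1 : ℝ) • f = -f := neg_one_smul ℝ f

theorem sub_smul' (r s : ℝ) (f : SuperFun n U) : (r - s) • f = r • f - s • f := sub_smul r s f

theorem evalAt_tmul (p : U) (f : Smooth U) (x : Grass n) : evalAt p (f ⊗ₜ x) = f p • x := by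
  rw [Algebra.smul_def]
  rfl

theorem evalGrass_eq (p : Body m) :
    (evalGrass p : Glob m n →ₐ[ℝ] Grass n) = evalAt (U := ⊤) ⟨p, trivial⟩ := rfl

theorem evalGrass_tmul (p : Body m) (f : Smooth (⊤ : Opens (Body m))) (x : Grass n) :
    evalGrass p (f ⊗ₜ x : Glob m n) = toBody f p • x := evalAt_tmul _ _ _

/-- The smooth coefficient of a superfunction along a linear form on the Grassmann algebra. -/
def coefL (U : Opens (Body m)) (l : Module.Dual ℝ (Grass n)) : SuperFun n U →ₗ[ℝ] Smooth U :=
  (TensorProduct.rid ℝ (Smooth U)).toLinearMap ∘ₗ LinearMap.lTensor (Smooth U) l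

theorem coefL_tmul (l : Module.Dual ℝ (Grass n)) (f : Smooth U) (x : Grass n) :
    coefL U l (f ⊗ₜ x) = l x • f := by
  simp [coefL]

theorem coefL_apply (l : Module.Dual ℝ (Grass n)) (f : SuperFun n U) (p : U) :
    coefL U l f p = l (evalAt p f) := by
  induction f using TensorProduct.induction_on with
  | zero => simp
  | tmul f x =>
    rw [coefL_tmul, evalAt_tmul, map_smul, smul_eq_mul, mul_comm]
    rfl
  | add f g hf hg =>
    rw [map_add, map_add, map_add, ← hf, ← hg]
    rfl

/-- In a basis of the Grassmann algebra a section is a finite family of smooth functions, and each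
of these is determined by its values. Identities of sections can thus be tested pointwise in `Grass
n`. -/
theorem superFun_ext {f g : SuperFun n U} (h : ∀ p : U, evalAt p f = evalAt p g) : f = g := by
  classical
  let b := Module.Free.chooseBasis ℝ (Grass n)
  refine (TensorProduct.equivFinsuppOfBasisRight (M := Smooth U) b).injective ?_
  ext i p
  have key : ∀ f : SuperFun n U,
      TensorProduct.equivFinsuppOfBasisRight (M := Smooth U) b f i = coefL U (b.coord i) f := by
    intro f
    rw [TensorProduct.equivFinsuppOfBasisRight_apply]
    rfl
  rw [key, key, coefL_apply, coefL_apply, h]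

theorem glob_ext {f g : Glob m n} (h : ∀ p : Body m, evalGrass p f = evalGrass p g) : f = g :=
  superFun_ext fun p => h p

theorem evalAt_res {V : Opens (Body m)} (h : V ≤ U) (f : SuperFun n U) (p : V) :
    evalAt p (res n h f) = evalAt ⟨p, h p.2⟩ f := by
  induction f using TensorProduct.induction_on with
  | zero => simp
  | tmul f x => rw [evalAt_tmul]; exact evalAt_tmul _ _ _
  | add f g hf hg => simp only [map_add, hf, hg]

/-! ### Parity -/

theorem gradeInv_tmul (f : Smooth U) (x : Grass n) :
    gradeInv n U (f ⊗ₜ x) = f ⊗ₜ inv' n x := rfl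

theorem tmul_mem_parity {p : ZMod 2} (f : Smooth U) {x : Grass n}
    (hx : x ∈ CliffordAlgebra.evenOdd (Q0 n) p) : f ⊗ₜ x ∈ parity n U p :=
  ⟨f ⊗ₜ ⟨x, hx⟩, rfl⟩

theorem parity_induction {p : ZMod 2} {P : SuperFun n U → Prop}
    (ht : ∀ (f : Smooth U) (x : Grass n), x ∈ CliffordAlgebra.evenOdd (Q0 n) p → P (f ⊗ₜ x))
    (h0 : P 0) (hadd : ∀ f g, P f → P g → P (f + g)) {f : SuperFun n U}
    (hf : f ∈ parity n U p) : P f := by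
  obtain ⟨y, rfl⟩ := hf
  induction y using TensorProduct.induction_on with
  | zero => simpa using h0
  | tmul f x => exact ht f x x.2
  | add f g hf hg => rw [map_add]; exact hadd _ _ hf hg

theorem gradeInv_of_mem {p : ZMod 2} {f : SuperFun n U} (hf : f ∈ parity n U p) :
    gradeInv n U f = koszul 1 p • f := by
  refine parity_induction (P := fun f => gradeInv n U f = koszul 1 p • f) ?_ ?_ ?_ hf
  · intro f x hx
    rw [gradeInv_tmul, inv'_of_mem hx, TensorProduct.tmul_smul]
  · simp
  · intro f g hf hg
    rw [map_add, hf, hg, smul_add]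

theorem exists_parity_add (f : SuperFun n U) :
    ∃ f0 ∈ parity n U 0, ∃ f1 ∈ parity n U 1, f0 + f1 = f := by
  rw [← Submodule.mem_sup]
  induction f using TensorProduct.induction_on with
  | zero => exact zero_mem _
  | tmul f x =>
    obtain ⟨x0, h0, x1, h1, rfl⟩ := exists_evenOdd_add x
    rw [TensorProduct.tmul_add]
    exact add_mem (Submodule.mem_sup_left (tmul_mem_parity f h0))
      (Submodule.mem_sup_right (tmul_mem_parity f h1))
  | add f g hf hg => exact add_mem hf hg

/-- The parity subspaces are the ±1 eigenspaces of `gradeInv`, 2 being invertible. Parity claims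
then reduce to computing with an algebra automorphism. -/
theorem mem_parity_iff {p : ZMod 2} {f : SuperFun n U} :
    f ∈ parity n U p ↔ gradeInv n U f = koszul 1 p • f := by
  refine ⟨gradeInv_of_mem, fun h => ?_⟩
  obtain ⟨f0, h0, f1, h1, rfl⟩ := exists_parity_add f
  rw [map_add, gradeInv_of_mem h0, gradeInv_of_mem h1, koszul_zero_right, koszul_one_one, one_smul,
    neg_one_smul'] at h
  rcases zmod_two_cases p with rfl | rfl
  · rw [koszul_zero_right, one_smul] at h
    have h2 : (2 : ℝ) • f1 = 0 := by
      rw [two_smul]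
      have := add_left_cancel h
      nth_rewrite 1 [← this]
      simp
    rw [(smul_eq_zero.1 h2).resolve_left two_ne_zero, add_zero]
    exact h0
  · rw [koszul_one_one, neg_one_smul', neg_add] at h
    have h2 : (2 : ℝ) • f0 = 0 := by
      rw [two_smul]
      have := add_right_cancel h
      nth_rewrite 1 [this]
      simp
    rw [(smul_eq_zero.1 h2).resolve_left two_ne_zero, zero_add]
    exact h1

theorem mul_mem_parity {p q : ZMod 2} {f g : SuperFun n U} (hf : f ∈ parity n U p)
    (hg : g ∈ parity n U q) : f * g ∈ parity n U (p + q) := by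
  rw [mem_parity_iff, map_mul, gradeInv_of_mem hf, gradeInv_of_mem hg, koszul_add_right,
    smul_mul_smul_comm]

theorem algebraMap_mem_parity (r : ℝ) : algebraMap ℝ (SuperFun n U) r ∈ parity n U 0 := by
  rw [mem_parity_iff, AlgHom.commutes, koszul_zero_right, one_smul]

theorem one_mem_parity : (1 : SuperFun n U) ∈ parity n U 0 := by
  rw [mem_parity_iff, map_one, koszul_zero_right, one_smul]

theorem eq_zero_of_mem_parity {p q : ZMod 2} (hpq : p ≠ q) {f : SuperFun n U}
    (hp : f ∈ parity n U p) (hq : f ∈ parity n U q) : f = 0 := by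
  have h := (gradeInv_of_mem hp).symm.trans (gradeInv_of_mem hq)
  rw [← sub_eq_zero, ← sub_smul'] at h
  refine (smul_eq_zero.1 h).resolve_left ?_
  rcases zmod_two_cases p with rfl | rfl <;> rcases zmod_two_cases q with rfl | rfl <;>
    (simp at hpq ⊢; try norm_num)

theorem supercomm {p q : ZMod 2} {f g : SuperFun n U} (hf : f ∈ parity n U p)
    (hg : g ∈ parity n U q) : f * g = koszul p q • (g * f) := by
  refine parity_induction (P := fun f => f * g = koszul p q • (g * f)) ?_ (by simp) ?_ hf
  · intro f x hx
    refine parity_induction (P := fun g => (f ⊗ₜ x) * g = koszul p q • (g * (f ⊗ₜ x)))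
      ?_ (by simp) ?_ hg
    · intro g y hy
      rw [Algebra.TensorProduct.tmul_mul_tmul, Algebra.TensorProduct.tmul_mul_tmul, mul_comm f g,
        ← TensorProduct.tmul_smul, grass_supercomm y hy x]
      congr 1
      rcases zmod_two_cases q with rfl | rfl
      · simp
      · have : (CliffordAlgebra.involute (Q := Q0 n) x : Grass n) = koszul 1 p • x := inv'_of_mem hx
        rw [if_neg one_ne_zero, this, mul_smul_comm, koszul_comm]
    · intro g h hg hh
      rw [mul_add, hg, hh, add_mul, smul_add]
  · intro f h hf hh
    rw [add_mul, hf, hh, mul_add, smul_add]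

end SuperFun

/-! ### Coordinates and partial derivatives -/

section Partial

variable {m n : ℕ}

@[simp] theorem deg_inl (i : Fin m) : deg (Sum.inl i : Idx m n) = 0 := rfl

@[simp] theorem deg_inr (k : Fin n × Fin 2) : deg (Sum.inr k : Idx m n) = 1 := rfl

theorem coord_inl (i : Fin m) : (coord (Sum.inl i) : Glob m n) = bosCoord i ⊗ₜ 1 := rfl

theorem coord_inr (k : Fin n × Fin 2) :
    (coord (Sum.inr k) : Glob m n) = 1 ⊗ₜ ExteriorAlgebra.ι ℝ (Pi.single k 1) := rfl

theorem coord_mem_parity (i : Idx m n) : (coord i : Glob m n) ∈ parity n ⊤ (deg i) := by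
  rw [mem_parity_iff]
  rcases i with i | k
  · rw [coord_inl, gradeInv_tmul, map_one, deg_inl, koszul_zero_right, one_smul]
  · rw [coord_inr, gradeInv_tmul, inv'_ι, deg_inr, koszul_one_one, neg_one_smul',
      TensorProduct.tmul_neg]

theorem partialX_inl_tmul (i : Fin m) (f : Smooth (⊤ : Opens (Body m))) (x : Grass n) :
    partialX (Sum.inl i) (f ⊗ₜ x : Glob m n) = bosPartial i f ⊗ₜ x := rfl

theorem partialX_inr_tmul (k : Fin n × Fin 2) (f : Smooth (⊤ : Opens (Body m))) (x : Grass n) :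
    partialX (Sum.inr k) (f ⊗ₜ x : Glob m n) = f ⊗ₜ contract (LinearMap.proj k) x := rfl

theorem smooth_ext {f g : Smooth (⊤ : Opens (Body m))} (h : ∀ p, toBody f p = toBody g p) :
    f = g := by
  ext p
  exact h p

theorem toBody_bosPartial (i : Fin m) (f : Smooth (⊤ : Opens (Body m))) (p : Body m) :
    toBody (bosPartial i f) p = fderiv ℝ (toBody f) p (Pi.single i 1) := rfl

theorem toBody_bosCoord (i : Fin m) (p : Body m) : toBody (bosCoord i) p = p i := rfl

theorem differentiableAt_toBody (f : Smooth (⊤ : Opens (Body m))) (p : Body m) :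
    DifferentiableAt ℝ (toBody f) p := (contDiff_toBody f).differentiable (by simp) p

theorem bosPartial_mul (i : Fin m) (f g : Smooth (⊤ : Opens (Body m))) :
    bosPartial i (f * g) = bosPartial i f * g + f * bosPartial i g := by
  refine smooth_ext fun p => ?_
  have h : toBody (f * g) = toBody f * toBody g := rfl
  have h1 : toBody (bosPartial i f * g + f * bosPartial i g) p =
    toBody (bosPartial i f) p * toBody g p + toBody f p * toBody (bosPartial i g) p := rfl
  rw [h1, toBody_bosPartial, h, fderiv_mul (differentiableAt_toBody f p)
      (differentiableAt_toBody g p),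
    toBody_bosPartial, toBody_bosPartial]
  simp
  ring

theorem bosPartial_comm (i j : Fin m) (f : Smooth (⊤ : Opens (Body m))) :
    bosPartial i (bosPartial j f) = bosPartial j (bosPartial i f) := by
  refine smooth_ext fun p => ?_
  have key : ∀ i j : Fin m, toBody (bosPartial i (bosPartial j f)) p =
      fderiv ℝ (fderiv ℝ (toBody f)) p (Pi.single i 1) (Pi.single j 1) := by
    intro i j
    have h : toBody (bosPartial j f) = fun x => fderiv ℝ (toBody f) x (Pi.single j 1) := rfl
    have hd : DifferentiableAt ℝ (fderiv ℝ (toBody f)) p :=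
      ((contDiff_toBody f).fderiv_right (m := ∞) (by simp)).differentiable
        (by simp) p
    rw [toBody_bosPartial, h, fderiv_clm_apply hd (differentiableAt_const _)]
    simp
  rw [key, key]
  refine ContDiffAt.isSymmSndFDerivAt (n := ∞) (contDiff_toBody f).contDiffAt ?_ _ _
  rw [minSmoothness_of_isRCLikeNormedField]
  exact WithTop.coe_le_coe.2 (le_top : (2 : ℕ∞) ≤ ⊤)

theorem bosPartial_bosCoord (i j : Fin m) :
    bosPartial i (bosCoord j) = if i = j then 1 else 0 := by
  refine smooth_ext fun p => ?_
  have h : toBody (bosCoord j : Smooth (⊤ : Opens (Body m))) =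
    (ContinuousLinearMap.proj (R := ℝ) (φ := fun _ : Fin m => ℝ) j) := rfl
  rw [toBody_bosPartial, h, ContinuousLinearMap.fderiv]
  by_cases hij : i = j
  · subst hij
    simp [toBody]
  · simp [hij, toBody, Ne.symm hij]

theorem bosPartial_one (i : Fin m) : bosPartial i (1 : Smooth (⊤ : Opens (Body m))) = 0 := by
  have h := bosPartial_mul i (1 : Smooth (⊤ : Opens (Body m))) 1
  simpa using h

theorem gradeInv_partialX (i : Idx m n) (f : Glob m n) :
    gradeInv n ⊤ (partialX i f) = koszul 1 (deg i) • partialX i (gradeInv n ⊤ f) := by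
  induction f using TensorProduct.induction_on with
  | zero => simp
  | tmul f x =>
    rcases i with i | k
    · rw [partialX_inl_tmul, gradeInv_tmul, gradeInv_tmul, partialX_inl_tmul, deg_inl,
        koszul_zero_right, one_smul]
    · rw [partialX_inr_tmul, gradeInv_tmul, gradeInv_tmul, partialX_inr_tmul, deg_inr,
        koszul_one_one, inv'_contract, TensorProduct.tmul_neg, neg_one_smul']
  | add f g hf hg => simp only [map_add, hf, hg, smul_add]

theorem partialX_mul (i : Idx m n) (f g : Glob m n) :
    partialX i (f * g) = partialX i f * g +
      (if deg i = 0 then f else gradeInv n ⊤ f) * partialX i g := by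
  induction f using TensorProduct.induction_on with
  | zero => simp
  | tmul f x =>
    induction g using TensorProduct.induction_on with
    | zero => simp
    | tmul g y =>
      rcases i with i | k
      · simp only [Algebra.TensorProduct.tmul_mul_tmul, partialX_inl_tmul, bosPartial_mul, deg_inl,
          if_true, TensorProduct.add_tmul]
      · rw [Algebra.TensorProduct.tmul_mul_tmul, partialX_inr_tmul, partialX_inr_tmul,
          partialX_inr_tmul, deg_inr, if_neg one_ne_zero, gradeInv_tmul,
          Algebra.TensorProduct.tmul_mul_tmul, Algebra.TensorProduct.tmul_mul_tmul, contract_mul,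
          TensorProduct.tmul_add]
    | add g h hg hh => simp only [mul_add, map_add, hg, hh]; abel
  | add f h hf hh =>
    simp only [add_mul, map_add, hf, hh]
    split_ifs <;> simp only [add_mul] <;> abel

theorem partialX_comm (i j : Idx m n) (f : Glob m n) :
    partialX i (partialX j f) = koszul (deg i) (deg j) • partialX j (partialX i f) := by
  induction f using TensorProduct.induction_on with
  | zero => simp
  | tmul f x =>
    rcases i with i | i <;> rcases j with j | j
    · simp only [partialX_inl_tmul, bosPartial_comm i j, deg_inl, koszul_zero_right, one_smul]
    · simp only [partialX_inl_tmul, partialX_inr_tmul, deg_inl, koszul_zero_left, one_smul]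
    · simp only [partialX_inl_tmul, partialX_inr_tmul, deg_inl, koszul_zero_right, one_smul]
    · simp only [partialX_inr_tmul, deg_inr, koszul_one_one,
        contract_comm (LinearMap.proj i) (LinearMap.proj j)]
      rw [neg_one_smul', TensorProduct.tmul_neg]
  | add f g hf hg => simp only [map_add, hf, hg, smul_add]

theorem partialX_mem_HomDer (i : Idx m n) : (partialX i : Op m n) ∈ HomDer m n (deg i) := by
  refine ⟨fun q f hf => ?_, fun q f hf h => ?_⟩
  · rw [mem_parity_iff, gradeInv_partialX, gradeInv_of_mem hf, map_smul, smul_smul,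
      koszul_add_right]
  · rw [partialX_mul, gradeInv_of_mem hf]
    rcases zmod_two_cases (deg i) with h | h
    · simp [h]
    · rw [h, if_neg one_ne_zero, smul_mul_assoc]

theorem partialX_coord (i j : Idx m n) :
    partialX i (coord j : Glob m n) = if i = j then 1 else 0 := by
  rcases i with i | i <;> rcases j with j | j
  · rw [coord_inl, partialX_inl_tmul, bosPartial_bosCoord]
    by_cases h : i = j <;> simp [h, Algebra.TensorProduct.one_def]
  · rw [coord_inr, partialX_inl_tmul, bosPartial_one]
    simp
  · rw [coord_inl, partialX_inr_tmul]
    have := contract_algebraMap (n := n) (LinearMap.proj i) 1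
    rw [map_one] at this
    simp [this]
  · rw [coord_inr, partialX_inr_tmul, contract_ι]
    by_cases h : i = j
    · subst h; simp [Algebra.TensorProduct.one_def]
    · simp [h]

theorem HomDer_one {a : ZMod 2} {D : Op m n} (hD : D ∈ HomDer m n a) : D 1 = 0 := by
  have := hD.2 0 1 one_mem_parity 1
  simpa using this

theorem HomDer_algebraMap {a : ZMod 2} {D : Op m n} (hD : D ∈ HomDer m n a) (r : ℝ) :
    D (algebraMap ℝ _ r) = 0 := by
  rw [Algebra.algebraMap_eq_smul_one, map_smul, HomDer_one hD, smul_zero]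

theorem HomDer_mul_left {a b : ZMod 2} {D : Op m n} {f : Glob m n} (hf : f ∈ parity n ⊤ a)
    (hD : D ∈ HomDer m n b) : LinearMap.mulLeft ℝ f ∘ₗ D ∈ HomDer m n (a + b) := by
  refine ⟨fun q g hg => ?_, fun q g hg h => ?_⟩
  · rw [add_assoc]; exact mul_mem_parity hf (hD.1 q g hg)
  · simp only [LinearMap.comp_apply, LinearMap.mulLeft_apply, hD.2 q g hg, mul_add, mul_smul_comm]
    rw [← mul_assoc f g, supercomm hf hg, koszul_add_left, smul_mul_assoc, smul_smul, mul_assoc,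
      mul_assoc, mul_comm]

theorem superComm_mem_HomDer {a b : ZMod 2} {D E : Op m n} (hD : D ∈ HomDer m n a)
    (hE : E ∈ HomDer m n b) : superComm a b D E ∈ HomDer m n (a + b) := by
  refine ⟨fun q f hf => ?_, fun q f hf h => ?_⟩
  · simp only [superComm, LinearMap.sub_apply, LinearMap.smul_apply, LinearMap.comp_apply]
    refine sub_mem ?_ (Submodule.smul_mem _ _ ?_)
    · rw [add_assoc]; exact hD.1 _ _ (hE.1 _ _ hf)
    · rw [add_comm a b, add_assoc]; exact hE.1 _ _ (hD.1 _ _ hf)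
  · simp only [superComm, LinearMap.sub_apply, LinearMap.smul_apply, LinearMap.comp_apply,
      map_add, map_smul, hD.2 _ _ (hE.1 _ _ hf), hE.2 _ _ (hD.1 _ _ hf),
      hD.2 _ _ hf, hE.2 _ _ hf, koszul_add_left, koszul_add_right, smul_add, smul_sub, sub_mul,
      mul_sub, smul_smul, smul_mul_assoc, mul_smul_comm]
    have h1 : koszul a b * (koszul b a * koszul b q) = koszul b q := by
      rw [koszul_comm b a, ← mul_assoc, koszul_mul_self, one_mul]
    have h2 : koszul a q * koszul b q * koszul a b = koszul a b * (koszul b q * koszul a q) := by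
      ring
    rw [h1, h2, mul_comm (koszul b q) (koszul a q)]
    abel

end Partial

/-! ### Hadamard's lemma -/

section Hadamard

variable {H : Type} [NormedAddCommGroup H] [NormedSpace ℝ H] [FiniteDimensional ℝ H]

/-- Differentiation under the integral sign: the partial derivative is continuous, hence bounded on
the compact product of a closed unit ball and [0, 1], and that bound is the dominating function. -/
theorem hasFDerivAt_integral_of_contDiff {E : Type} [NormedAddCommGroup E] [NormedSpace ℝ E]
    {F : H × ℝ → E} (hF : ContDiff ℝ 1 F) (x₀ : H) :
    HasFDerivAt (fun x => ∫ t in (0:ℝ)..1, F (x, t))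
      (∫ t in (0:ℝ)..1, (fderiv ℝ F (x₀, t)).comp (ContinuousLinearMap.inl ℝ H ℝ)) x₀ := by
  have hF' : Continuous fun p : H × ℝ => (fderiv ℝ F p).comp (ContinuousLinearMap.inl ℝ H ℝ) :=
    (hF.continuous_fderiv one_ne_zero).clm_comp continuous_const
  have hK : IsCompact (Metric.closedBall x₀ 1 ×ˢ Set.Icc (0:ℝ) 1) :=
    (isCompact_closedBall x₀ 1).prod isCompact_Icc
  obtain ⟨C, hC⟩ := hK.exists_bound_of_continuousOn hF'.continuousOn
  refine intervalIntegral.hasFDerivAt_integral_of_dominated_of_fderiv_le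
    (F' := fun x t => (fderiv ℝ F (x, t)).comp (ContinuousLinearMap.inl ℝ H ℝ))
    (bound := fun _ => C) (Metric.closedBall_mem_nhds x₀ one_pos) ?_ ?_ ?_ ?_ ?_ ?_
  · exact Filter.Eventually.of_forall fun x =>
      (hF.continuous.comp (by fun_prop : Continuous fun t : ℝ => (x, t))).aestronglyMeasurable
  · exact (hF.continuous.comp (by fun_prop : Continuous fun t : ℝ => (x₀, t))).intervalIntegrable
      _ _
  · exact (hF'.comp (by fun_prop : Continuous fun t : ℝ => (x₀, t))).aestronglyMeasurable
  · refine Filter.Eventually.of_forall fun t ht x hx => hC (x, t) ⟨hx, ?_⟩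
    rw [Set.uIoc_of_le zero_le_one] at ht
    exact Set.Ioc_subset_Icc_self ht
  · exact intervalIntegrable_const
  · refine Filter.Eventually.of_forall fun t _ x _ => ?_
    have h1 := (hF.differentiable one_ne_zero (x, t)).hasFDerivAt
    exact h1.comp x (hasFDerivAt_prodMk_left x t)

/-- The derivative is again such a parameter integral, with values in linear maps to `E`; for this
reason the induction is over all target spaces at once. -/
theorem contDiff_integral_nat (k : ℕ) {E : Type} [NormedAddCommGroup E] [NormedSpace ℝ E]
    {F : H × ℝ → E} (hF : ContDiff ℝ ∞ F) :
    ContDiff ℝ k (fun x => ∫ t in (0:ℝ)..1, F (x, t)) := by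
  induction k generalizing E with
  | zero =>
    have : Continuous (fun x => ∫ t in (0:ℝ)..1, F (x, t)) :=
      continuous_iff_continuousAt.2 fun x =>
        (hasFDerivAt_integral_of_contDiff (hF.of_le (by simp)) x).continuousAt
    exact contDiff_zero.2 this
  | succ k ih =>
    have h := contDiff_succ_iff_hasFDerivAt (𝕜 := ℝ) (n := k)
      (f := fun x => ∫ t in (0:ℝ)..1, F (x, t))
    push_cast
    refine h.2 ⟨_, ?_, fun x => hasFDerivAt_integral_of_contDiff (hF.of_le (by simp)) x⟩
    exact ih (F := fun p => (fderiv ℝ F p).comp (ContinuousLinearMap.inl ℝ H ℝ))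
      ((hF.fderiv_right (by simp)).clm_comp contDiff_const)

theorem contDiff_integral {E : Type} [NormedAddCommGroup E] [NormedSpace ℝ E]
    {F : H × ℝ → E} (hF : ContDiff ℝ ∞ F) :
    ContDiff ℝ ∞ (fun x => ∫ t in (0:ℝ)..1, F (x, t)) :=
  contDiff_infty.2 fun k => contDiff_integral_nat k hF

/-- The fundamental theorem of calculus along the segment from `a` to `x`: G(x) is the mean of the
derivative of `f` over that segment. -/
theorem exists_contDiff_sub_eq {f : H → ℝ} (hf : ContDiff ℝ ∞ f) (a : H) :
    ∃ G : H → H →L[ℝ] ℝ, ContDiff ℝ ∞ G ∧ ∀ x, f x - f a = G x (x - a) := by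
  have hd : ContDiff ℝ ∞ (fun p : H × ℝ => fderiv ℝ f (a + p.2 • (p.1 - a))) :=
    (hf.fderiv_right (m := ∞) (by simp)).comp (by fun_prop)
  refine ⟨fun x => ∫ t in (0:ℝ)..1, fderiv ℝ f (a + t • (x - a)), contDiff_integral hd,
    fun x => ?_⟩
  have hc : Continuous fun t : ℝ => fderiv ℝ f (a + t • (x - a)) :=
    hd.continuous.comp (by fun_prop : Continuous fun t : ℝ => (x, t))
  rw [ContinuousLinearMap.intervalIntegral_apply (hc.intervalIntegrable _ _)]
  have h := intervalIntegral.integral_eq_sub_of_hasDerivAt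
    (f := fun t : ℝ => f (a + t • (x - a))) (f' := fun t => fderiv ℝ f (a + t • (x - a)) (x - a))
    (a := 0) (b := 1) ?_ ((hc.clm_apply continuous_const).intervalIntegrable _ _)
  · rw [h]; simp
  · intro t _
    have h1 := (hf.differentiable (by simp) (a + t • (x - a))).hasFDerivAt
    have h2 : HasDerivAt (fun t : ℝ => a + t • (x - a)) (x - a) t := by
      simpa using ((hasDerivAt_id t).smul_const (x - a)).const_add a
    exact h1.comp_hasDerivAt t h2

end Hadamard

/-! ### Hadamard's lemma in coordinates and its consequences for superfunctions -/

section

variable {m n : ℕ}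

/-- A smooth function on `ℝ^m` as a section over the whole space. -/
def ofContDiff {f : Body m → ℝ} (hf : ContDiff ℝ ∞ f) : Smooth (⊤ : Opens (Body m)) :=
  ⟨fun x => f x, hf.contMDiff.comp contMDiff_subtype_val⟩

theorem toBody_ofContDiff {f : Body m → ℝ} (hf : ContDiff ℝ ∞ f) (x : Body m) :
    toBody (ofContDiff hf) x = f x := rfl

theorem hadamard (f : Smooth (⊤ : Opens (Body m))) (a : Body m) :
    ∃ g : Fin m → Smooth (⊤ : Opens (Body m)),
      f = algebraMap ℝ _ (toBody f a) + ∑ i, (bosCoord i - algebraMap ℝ _ (a i)) * g i := by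
  obtain ⟨G, hG, h⟩ := exists_contDiff_sub_eq (contDiff_toBody f) a
  refine ⟨fun i => ofContDiff (f := fun x => G x (Pi.single i 1)) (hG.clm_apply contDiff_const), ?_⟩
  refine smooth_ext fun p => ?_
  let ev : Smooth (⊤ : Opens (Body m)) →ₐ[ℝ] ℝ :=
    (Pi.evalAlgHom ℝ (fun _ => ℝ) (⟨p, trivial⟩ : (⊤ : Opens (Body m)))).comp
        ContMDiffMap.coeFnAlgHom
  have hev : ∀ f, toBody f p = ev f := fun _ => rfl
  have hc : ∀ r, ev (algebraMap ℝ _ r) = r := fun r => AlgHom.commutes ev r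
  have h0 : ∀ i, ev ((bosCoord i - algebraMap ℝ _ (a i)) *
      ofContDiff (f := fun x => G x (Pi.single i 1)) (hG.clm_apply contDiff_const)) =
      (p i - a i) * G p (Pi.single i 1) := by
    intro i
    rw [map_mul, map_sub, hc, ← hev, ← hev, toBody_ofContDiff, toBody_bosCoord]
  rw [hev (_ + _), map_add, map_sum, hc, Finset.sum_congr rfl fun i _ => h0 i]
  have h1 := h p
  have h2 : p - a = ∑ i, (p i - a i) • Pi.single i (1 : ℝ) := by
    ext j
    simp [Finset.sum_apply, Pi.single_apply]
  rw [h2, map_sum] at h1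
  simp only [map_smul, smul_eq_mul] at h1
  rw [← h1]
  ring

theorem hadamard_glob (f : Smooth (⊤ : Opens (Body m))) (a : Body m) :
    ∃ g : Fin m → Smooth (⊤ : Opens (Body m)),
      (f ⊗ₜ 1 : Glob m n) = algebraMap ℝ _ (toBody f a) +
        ∑ i, (coord (Sum.inl i) - algebraMap ℝ _ (a i)) * (g i ⊗ₜ 1) := by
  obtain ⟨g, hg⟩ := hadamard f a
  refine ⟨g, ?_⟩
  let inc : Smooth (⊤ : Opens (Body m)) →ₐ[ℝ] Glob m n := Algebra.TensorProduct.includeLeft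
  have h := congrArg inc hg
  rw [map_add, map_sum, AlgHom.commutes] at h
  simp only [map_mul, map_sub, AlgHom.commutes] at h
  exact h

theorem evalGrass_coord_inl (i : Fin m) (p : Body m) :
    evalGrass p (coord (Sum.inl i) : Glob m n) = algebraMap ℝ _ (p i) := by
  rw [coord_inl, evalGrass_tmul, toBody_bosCoord, Algebra.algebraMap_eq_smul_one]

theorem evalGrass_coord_inr (k : Fin n × Fin 2) (p : Body m) :
    evalGrass p (coord (Sum.inr k) : Glob m n) = ExteriorAlgebra.ι ℝ (Pi.single k 1) := by
  rw [coord_inr, evalGrass_tmul]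
  exact one_smul _ _

/-! ### Vector fields are determined by their action on the coordinates -/

theorem tmul_eq_mul (f : Smooth (⊤ : Opens (Body m))) (x : Grass n) :
    (f ⊗ₜ x : Glob m n) = (f ⊗ₜ 1) * (1 ⊗ₜ x) := by
  rw [Algebra.TensorProduct.tmul_mul_tmul, one_mul, mul_one]

theorem one_tmul_ι (v : Fin n × Fin 2 → ℝ) :
    (1 ⊗ₜ ExteriorAlgebra.ι ℝ v : Glob m n) = ∑ k, v k • coord (Sum.inr k) := by
  rw [← sum_smul_ι, TensorProduct.tmul_sum]
  simp only [TensorProduct.tmul_smul, coord_inr]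

/-- At a point p, Hadamard writes f = f(p) + Σ (X_i − p_i) g_i. Since D kills constants and
coordinates, only (X_i − p_i) D(g_i) remains, which vanishes at p whatever D(g_i) is. The Grassmann
factor is handled by induction on generators with the Leibniz rule. -/
theorem HomDer_eq_zero {a : ZMod 2} {D : Op m n} (hD : D ∈ HomDer m n a)
    (h : ∀ i, D (coord i) = 0) : D = 0 := by
  have h1 : ∀ f : Smooth (⊤ : Opens (Body m)), D (f ⊗ₜ 1) = 0 := by
    intro f
    refine glob_ext fun p => ?_
    obtain ⟨g, hg⟩ := hadamard_glob (n := n) f p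
    rw [hg, LinearMap.map_add]
    rw [HomDer_algebraMap hD, zero_add]
    rw [map_sum]
    rw [map_sum]
    rw [map_zero]
    refine Finset.sum_eq_zero fun i _ => ?_
    have hp : (coord (Sum.inl i) - algebraMap ℝ _ (p i) : Glob m n) ∈ parity n ⊤ 0 :=
      sub_mem (coord_mem_parity (Sum.inl i)) (algebraMap_mem_parity (p i))
    rw [hD.2 0 _ hp]
    rw [map_sub]
    rw [h, HomDer_algebraMap hD, sub_zero, zero_mul, zero_add]
    rw [koszul_zero_right, one_smul, map_mul, map_sub]
    rw [evalGrass_coord_inl, AlgHom.commutes, sub_self,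
      zero_mul]
  have h2 : ∀ x : Grass n, D (1 ⊗ₜ x) = 0 := by
    intro x
    induction x using grass_induction with
    | h0 r =>
      have : (1 ⊗ₜ algebraMap ℝ (Grass n) r : Glob m n) = algebraMap ℝ (Glob m n) r := by
        rw [Algebra.algebraMap_eq_smul_one, TensorProduct.tmul_smul,
          Algebra.algebraMap_eq_smul_one, Algebra.TensorProduct.one_def]
      rw [this, HomDer_algebraMap hD]
    | hadd x y hx hy => rw [TensorProduct.tmul_add, map_add, hx, hy, add_zero]
    | hmul x v hx =>
      have : (1 ⊗ₜ (ExteriorAlgebra.ι ℝ v * x) : Glob m n) =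
          (1 ⊗ₜ ExteriorAlgebra.ι ℝ v) * (1 ⊗ₜ x) := by
        rw [Algebra.TensorProduct.tmul_mul_tmul, one_mul]
      rw [this, one_tmul_ι, Finset.sum_mul, map_sum]
      refine Finset.sum_eq_zero fun k _ => ?_
      rw [smul_mul_assoc, map_smul, hD.2 _ _ (coord_mem_parity _), h, hx, zero_mul, mul_zero,
        smul_zero, add_zero, smul_zero]
  refine TensorProduct.ext' fun f x => ?_
  rw [LinearMap.zero_apply, tmul_eq_mul,
    hD.2 0 _ (tmul_mem_parity f (SetLike.one_mem_graded _)), h1, h2, zero_mul,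
    mul_zero, smul_zero, add_zero]

theorem HomDer_ext {a : ZMod 2} {D E : Op m n} (hD : D ∈ HomDer m n a) (hE : E ∈ HomDer m n a)
    (h : ∀ i, D (coord i) = E (coord i)) : D = E := by
  have h0 : D + (-1 : ℝ) • E = 0 := by
    refine HomDer_eq_zero (add_mem hD (Submodule.smul_mem _ _ hE)) fun i => ?_
    rw [LinearMap.add_apply, LinearMap.smul_apply, h, neg_one_smul', add_neg_cancel]
  refine LinearMap.ext fun f => ?_
  have := LinearMap.congr_fun h0 f
  rw [LinearMap.add_apply, LinearMap.smul_apply, neg_one_smul'] at this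
  exact add_neg_eq_zero.1 this

theorem sum_mulLeft_partialX_coord (c : Idx m n → Glob m n) (j : Idx m n) :
    (∑ i, LinearMap.mulLeft ℝ (c i) ∘ₗ partialX i : Op m n) (coord j) = c j := by
  simp only [LinearMap.sum_apply, LinearMap.comp_apply, LinearMap.mulLeft_apply, partialX_coord,
    mul_ite, mul_one, mul_zero, Finset.sum_ite_eq', Finset.mem_univ, if_true]

theorem zmod_two_add_self_cancel (a b : ZMod 2) : a + b + b = a := by
  revert a b; decide

theorem sum_mulLeft_partialX_mem {a : ZMod 2} {c : Idx m n → Glob m n}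
    (hc : ∀ i, c i ∈ parity n ⊤ (a + deg i)) :
    (∑ i, LinearMap.mulLeft ℝ (c i) ∘ₗ partialX i : Op m n) ∈ HomDer m n a := by
  refine sum_mem fun i _ => ?_
  have := HomDer_mul_left (hc i) (partialX_mem_HomDer i)
  rwa [zmod_two_add_self_cancel] at this

/-- Both sides are superderivations of the same parity that agree on the coordinates. -/
theorem HomDer_eq_sum {a : ZMod 2} {D : Op m n} (hD : D ∈ HomDer m n a) :
    D = ∑ i, LinearMap.mulLeft ℝ (D (coord i)) ∘ₗ partialX i :=
  HomDer_ext hD (sum_mulLeft_partialX_mem fun i => hD.1 _ _ (coord_mem_parity i))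
    fun i => (sum_mulLeft_partialX_coord (fun i => D (coord i)) i).symm

/-! ### Superfunctions with vanishing derivatives -/

theorem coefL_partialX_inl (i : Fin m) (l : Module.Dual ℝ (Grass n)) (f : Glob m n) :
    coefL ⊤ l (partialX (Sum.inl i) f) = bosPartial i (coefL ⊤ l f) := by
  induction f using TensorProduct.induction_on with
  | zero => simp
  | tmul f x => rw [partialX_inl_tmul, coefL_tmul, coefL_tmul, map_smul]
  | add f g hf hg => simp only [map_add, hf, hg]

theorem evalGrass_partialX_inr (k : Fin n × Fin 2) (f : Glob m n) (p : Body m) :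
    evalGrass p (partialX (Sum.inr k) f) = contract (LinearMap.proj k) (evalGrass p f) := by
  induction f using TensorProduct.induction_on with
  | zero => simp
  | tmul f x => rw [partialX_inr_tmul, evalGrass_tmul, evalGrass_tmul, map_smul]
  | add f g hf hg => simp only [map_add, hf, hg]

theorem toBody_eq_of_bosPartial_eq_zero {f : Smooth (⊤ : Opens (Body m))}
    (h : ∀ i, bosPartial i f = 0) (p q : Body m) : toBody f p = toBody f q := by
  refine is_const_of_fderiv_eq_zero ((contDiff_toBody f).differentiable (by simp)) (fun x => ?_) p q
  have h1 : ∀ i, fderiv ℝ (toBody f) x (Pi.single i 1) = 0 := fun i =>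
    congrArg (fun g => toBody g x) (h i)
  refine ContinuousLinearMap.ext fun v => ?_
  rw [← Finset.univ_sum_single v, map_sum]
  refine Finset.sum_eq_zero fun i _ => ?_
  have h2 : (Pi.single i (v i) : Body m) = v i • Pi.single i (1 : ℝ) := by
    rw [← Pi.single_smul, smul_eq_mul, mul_one]
  rw [h2, map_smul, h1, smul_zero]

/-- The odd derivatives force the value at the origin to be a scalar; the even ones force every
Grassmann coefficient to be constant on ℝ^m. -/
theorem eq_algebraMap_of_partialX_eq_zero {f : Glob m n} (h : ∀ i, partialX i f = 0) :
    ∃ r, f = algebraMap ℝ _ r := by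
  obtain ⟨r, hr⟩ := eq_algebraMap_of_contract_eq_zero (evalGrass 0 f) fun k => by
    rw [← evalGrass_partialX_inr, h, map_zero]
  refine ⟨r, glob_ext fun p => ?_⟩
  rw [AlgHom.commutes, ← hr]
  refine (Module.forall_dual_apply_eq_zero_iff ℝ _).1 (fun l => ?_) |> sub_eq_zero.1
  have h1 : ∀ i, bosPartial i (coefL ⊤ l f) = 0 := fun i => by
    rw [← coefL_partialX_inl, h, map_zero]
  have h2 : ∀ p, toBody (coefL ⊤ l f) p = l (evalGrass p f) := fun p => coefL_apply l f _
  rw [map_sub, ← h2, ← h2, toBody_eq_of_bosPartial_eq_zero h1 p 0, sub_self]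

/-- A superfunction with vanishing second derivatives is affine. -/
theorem eq_affine_of_partialX_partialX_eq_zero {f : Glob m n}
    (h : ∀ i j, partialX i (partialX j f) = 0) :
    ∃ (r : ℝ) (M : Idx m n → ℝ), (∀ k, partialX k f = algebraMap ℝ _ (M k)) ∧
      f = algebraMap ℝ _ r + ∑ k, M k • coord k := by
  choose M hM using fun j => eq_algebraMap_of_partialX_eq_zero fun i => h i j
  have hz : ∀ i, partialX i (f - ∑ k, M k • coord k) = 0 := by
    intro i
    rw [map_sub, map_sum, hM]
    simp only [map_smul, partialX_coord, smul_ite, smul_zero, Finset.sum_ite_eq, Finset.mem_univ,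
      if_true, Algebra.algebraMap_eq_smul_one, sub_self]
  obtain ⟨r, hr⟩ := eq_algebraMap_of_partialX_eq_zero hz
  exact ⟨r, M, hM, sub_eq_iff_eq_add.1 hr⟩

end

/-! ### Morphisms are determined by the pull-backs of the coordinates -/

section Morphism

variable {m n : ℕ}

theorem delta_eq (p : Body m) (f : Glob m n) :
    delta p f = ExteriorAlgebra.algebraMapInv (evalGrass p f) := rfl

theorem evalAt_pull_res (Φ : SuperEnd m n) {U V : Opens (Body m)} (h : V ≤ U)
    (f : SuperFun n U) (p : Opens.comap Φ.base V) :
    evalAt p (Φ.pull V (res n h f)) =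
      evalAt (⟨p, Opens.comap_mono Φ.base h p.2⟩ : Opens.comap Φ.base U) (Φ.pull U f) := by
  rw [Φ.pull_res, evalAt_res]

theorem evalGrass_sharp (Φ : SuperEnd m n) (f : Glob m n) (p : Body m) :
    evalGrass p (sharp Φ f) =
      evalAt (⟨p, trivial⟩ : Opens.comap Φ.base ⊤) (Φ.pull ⊤ f) := by
  rw [sharp_apply]; rfl

/-- The reciprocal of `x_i - c` where `x_i ≠ c`. -/
def invCoordSub (i : Fin m) (c : ℝ) (V : Opens (Body m)) (hV : ∀ x ∈ V, x i ≠ c) : Smooth V :=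
  ⟨fun x => ((x : Body m) i - c)⁻¹, by
    intro x
    have h1 : ContDiffAt ℝ ∞ (fun y : Body m => (y i - c)⁻¹) x :=
      ((contDiff_apply ℝ ℝ i).contDiffAt.sub contDiffAt_const).inv (sub_ne_zero.2 (hV x x.2))
    exact h1.contMDiffAt.comp x contMDiff_subtype_val.contMDiffAt⟩

/-- Let c be the left side. If φ(p)_i ≠ c, then X_i − c is invertible on a neighbourhood V of φ(p).
Its pull-back is then invertible at p, although the body of that pull-back is c − c = 0 there.
Compatibility of φ♯ with restriction to V is what makes the argument possible. -/
theorem delta_sharp_coord (Φ : SuperEnd m n) (i : Fin m) (p : Body m) :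
    delta p (sharp Φ (coord (Sum.inl i))) = Φ.base p i := by
  by_contra hne
  set c := delta p (sharp Φ (coord (Sum.inl i))) with hc
  let V : Opens (Body m) := ⟨{y | y i ≠ c}, isOpen_ne_fun (continuous_apply i) continuous_const⟩
  have hp : p ∈ Opens.comap Φ.base V := fun h => hne h.symm
  let u : SuperFun n V := res n le_top (coord (Sum.inl i) - algebraMap ℝ _ c)
  let w : SuperFun n V := invCoordSub i c V (fun _ h => h) ⊗ₜ 1
  have huw : u * w = 1 := by
    refine superFun_ext fun q => ?_
    have h1 := evalGrass_coord_inl (n := n) i (q : Body m)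
    rw [evalGrass_eq] at h1
    rw [map_mul, evalAt_res, map_sub, AlgHom.commutes, evalAt_tmul, h1, ← map_sub, map_one,
      mul_smul_comm, mul_one, Algebra.algebraMap_eq_smul_one, smul_smul]
    have : invCoordSub i c V (fun _ h => h) q * ((q : Body m) i - c) = 1 :=
      inv_mul_cancel₀ (sub_ne_zero.2 q.2)
    rw [this, one_smul]
  have h2 := congrArg
    (fun f => ExteriorAlgebra.algebraMapInv (evalAt ⟨p, hp⟩ (Φ.pull V f))) huw
  simp only [map_mul, map_one] at h2
  have h3 : ExteriorAlgebra.algebraMapInv (evalAt ⟨p, hp⟩ (Φ.pull V u)) = 0 := by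
    rw [evalAt_pull_res, map_sub, AlgHom.commutes, map_sub, map_sub, AlgHom.commutes,
      AlgHom.commutes, sub_eq_zero]
    have h4 := evalGrass_sharp Φ (coord (Sum.inl i)) p
    rw [hc, delta_eq, h4]
    rfl
  rw [h3, zero_mul] at h2
  exact zero_ne_one h2

/-- Multiply by a bump function equal to 1 near `x` and with closed support inside `U`, and extend
by zero. -/
theorem exists_smooth_extension {U : Opens (Body m)} (f : Smooth U) {x : Body m} (hx : x ∈ U) :
    ∃ F : Smooth (⊤ : Opens (Body m)), ∃ V : Opens (Body m), x ∈ V ∧ ∃ h : V ≤ U,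
      ∀ y : V, toBody F y = f ⟨y, h y.2⟩ := by
  classical
  obtain ⟨r, hr, hrU⟩ := Metric.isOpen_iff.1 U.isOpen x hx
  let χ : ContDiffBump x := ⟨r / 4, r / 2, by positivity, by linarith⟩
  let F : Body m → ℝ := fun y => if h : y ∈ U then f ⟨y, h⟩ else 0
  have hFU : ∀ y : U, F y = f y := fun y => dif_pos y.2
  have hF : ContDiff ℝ ∞ fun y => χ y * F y := by
    refine contDiff_iff_contDiffAt.2 fun y => ?_
    by_cases hy : y ∈ U
    · refine χ.contDiff.contDiffAt.mul ?_
      rw [← contMDiffAt_iff_contDiffAt]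
      refine (contMDiffAt_subtype_iff (U := U) (x := ⟨y, hy⟩)).1 ?_
      have : (fun z : U => F z) = f := funext hFU
      rw [this]
      exact f.contMDiff.contMDiffAt
    · have h0 : (fun y => χ y * F y) =ᶠ[nhds y] fun _ => 0 := by
        have hcl : (tsupport χ)ᶜ ∈ nhds y := by
          refine (isClosed_tsupport χ).isOpen_compl.mem_nhds ?_
          rw [Set.mem_compl_iff, χ.tsupport_eq]
          intro h
          exact hy (hrU (Metric.closedBall_subset_ball (by simp [χ]; linarith) h))
        filter_upwards [hcl] with z hz
        rw [image_eq_zero_of_notMem_tsupport hz, zero_mul]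
      exact contDiffAt_const.congr_of_eventuallyEq h0
  refine ⟨ofContDiff hF, ⟨Metric.ball x (r / 4), Metric.isOpen_ball⟩,
    Metric.mem_ball_self (by positivity),
    fun y hy => hrU (Metric.ball_subset_ball (by linarith) hy), fun y => ?_⟩
  rw [toBody_ofContDiff, χ.one_of_mem_closedBall (Metric.ball_subset_closedBall y.2), one_mul]
  exact dif_pos _

/-- Pull-back at p depends only on the germ at φ(p), and every germ is that of a global section. The
section `F` is chosen before `Φ`, so one and the same `F` serves to compare two morphisms with the
same body. -/
theorem evalAt_pull_eq_evalGrass_sharp {U : Opens (Body m)} (f : Smooth U) (x : Grass n)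
    {q : Body m} (hq : q ∈ U) : ∃ F : Glob m n, ∀ (Φ : SuperEnd m n) (p : Body m)
      (hp : Φ.base p = q), evalAt (⟨p, by
        change Φ.base p ∈ U
        rwa [hp]⟩ : Opens.comap Φ.base U) (Φ.pull U (f ⊗ₜ x)) = evalGrass p (sharp Φ F) := by
  obtain ⟨F, V, hqV, hVU, hF⟩ := exists_smooth_extension f hq
  refine ⟨F ⊗ₜ x, fun Φ p hp => ?_⟩
  have hpV : p ∈ Opens.comap Φ.base V := by
    change Φ.base p ∈ V
    rwa [hp]
  have h : res n hVU (f ⊗ₜ x) = res n le_top (F ⊗ₜ x : Glob m n) := by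
    refine superFun_ext fun y => ?_
    rw [evalAt_res, evalAt_res, evalAt_tmul, evalAt_tmul]
    congr 1
    exact (hF y).symm
  have h1 := evalAt_pull_res Φ hVU (f ⊗ₜ x) ⟨p, hpV⟩
  rw [h, evalAt_pull_res] at h1
  rw [evalGrass_sharp]
  exact h1.symm

/-- The hypothesis `hΦ` says that at each point the pulled-back even coordinates take scalar values
c. First-order Hadamard at c then suffices, because φ♯(X_i − c_i) vanishes there exactly; with a
nilpotent remainder a higher Taylor expansion would be needed. Linear morphisms satisfy the
hypothesis, and only one of the two morphisms has to be known to do so. -/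
theorem sharp_ext {Φ Ψ : SuperEnd m n} (h : ∀ i, sharp Φ (coord i) = sharp Ψ (coord i))
    (hΦ : ∀ i p, ∃ c, evalGrass p (sharp Φ (coord (Sum.inl i))) = algebraMap ℝ _ c)
    (f : Glob m n) : sharp Φ f = sharp Ψ f := by
  refine glob_ext fun p => ?_
  choose c hc using fun i => hΦ i p
  have key : ∀ Χ : SuperEnd m n,
      (∀ i, evalGrass p (sharp Χ (coord (Sum.inl i))) = algebraMap ℝ _ (c i)) →
      ∀ f : Smooth (⊤ : Opens (Body m)),
        evalGrass p (sharp Χ (f ⊗ₜ 1)) = algebraMap ℝ _ (toBody f c) := by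
    intro Χ hX f
    obtain ⟨g, hg⟩ := hadamard_glob (n := n) f c
    rw [hg, map_add, map_add, AlgHom.commutes, AlgHom.commutes, map_sum, map_sum,
      Finset.sum_eq_zero, add_zero]
    intro i _
    rw [map_mul, map_mul, map_sub, map_sub, hX, AlgHom.commutes, AlgHom.commutes, sub_self,
      zero_mul]
  have h2 : ∀ x : Grass n, sharp Φ (1 ⊗ₜ x) = sharp Ψ (1 ⊗ₜ x) := by
    have : ((sharp Φ).comp Algebra.TensorProduct.includeRight : Grass n →ₐ[ℝ] Glob m n) =
        (sharp Ψ).comp Algebra.TensorProduct.includeRight := by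
      refine ExteriorAlgebra.hom_ext (LinearMap.ext fun v => ?_)
      change sharp Φ (1 ⊗ₜ ExteriorAlgebra.ι ℝ v) = sharp Ψ (1 ⊗ₜ ExteriorAlgebra.ι ℝ v)
      rw [one_tmul_ι, map_sum, map_sum]
      refine Finset.sum_congr rfl fun k _ => ?_
      rw [map_smul, map_smul, h]
    exact fun x => DFunLike.congr_fun this x
  induction f using TensorProduct.induction_on with
  | zero => simp
  | tmul f x =>
    rw [tmul_eq_mul, map_mul, map_mul, map_mul, map_mul, h2, key Φ hc,
      key Ψ fun i => by rw [← h, hc]]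
  | add f g hf hg => rw [map_add, map_add, map_add, map_add, hf, hg]

/-- The bodies agree by `delta_sharp_coord`, the global pull-backs by `sharp_ext`, and the
pull-backs over an arbitrary open set by replacing local sections with global ones point by point.
-/
theorem SuperEnd_ext {Φ Ψ : SuperEnd m n} (h : ∀ i, sharp Φ (coord i) = sharp Ψ (coord i))
    (hΦ : ∀ i p, ∃ c, evalGrass p (sharp Φ (coord (Sum.inl i))) = algebraMap ℝ _ c) :
    Φ = Ψ := by
  have hb : Φ.base = Ψ.base := by
    ext p i
    rw [← delta_sharp_coord, ← delta_sharp_coord, h]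
  have hs := sharp_ext h hΦ
  have hp : ∀ (U : Opens (Body m)) (f : Smooth U) (x : Grass n) (p : Body m)
      (h1 : p ∈ Opens.comap Φ.base U) (h2 : p ∈ Opens.comap Ψ.base U),
      evalAt (⟨p, h1⟩ : Opens.comap Φ.base U) (Φ.pull U (f ⊗ₜ x)) =
        evalAt (⟨p, h2⟩ : Opens.comap Ψ.base U) (Ψ.pull U (f ⊗ₜ x)) := by
    intro U f x p h1 h2
    obtain ⟨F, hF⟩ := evalAt_pull_eq_evalGrass_sharp f x (q := Φ.base p) h1
    rw [hF Φ p rfl, hF Ψ p (by rw [hb]), hs]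
  -- The types of the two `pull` fields involve the bases, so the bases are identified before the
  -- fields can be compared.
  obtain ⟨b, s, pull, p1, p2⟩ := Φ
  obtain ⟨b', s', pull', p1', p2'⟩ := Ψ
  obtain rfl : b = b' := hb
  have : pull = pull' := by
    funext U
    refine AlgHom.toLinearMap_injective (TensorProduct.ext' fun f x => ?_)
    exact superFun_ext fun p => hp U f x p p.2 p.2
  subst this
  rfl

end Morphism

/-! ### Linear morphisms -/

section Linear

variable {m n : ℕ}

theorem inv'_map (L : (Fin n × Fin 2 → ℝ) →ₗ[ℝ] (Fin n × Fin 2 → ℝ)) (x : Grass n) :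
    inv' n (ExteriorAlgebra.map L x) = ExteriorAlgebra.map L (inv' n x) := by
  have : (inv' n).comp (ExteriorAlgebra.map L) = (ExteriorAlgebra.map L).comp (inv' n) := by
    refine ExteriorAlgebra.hom_ext (LinearMap.ext fun v => ?_)
    change inv' n (ExteriorAlgebra.map L (ExteriorAlgebra.ι ℝ v)) =
      ExteriorAlgebra.map L (inv' n (ExteriorAlgebra.ι ℝ v))
    rw [inv'_ι, map_neg, ExteriorAlgebra.map_apply_ι, inv'_ι]
  exact DFunLike.congr_fun this x

/-- The linear endomorphism of `ℝ^{m|2n}` with body `x ↦ A x` and odd part given by `B`. -/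
def linEnd (A : Matrix (Fin m) (Fin m) ℝ) (B : Matrix (Fin n × Fin 2) (Fin n × Fin 2) ℝ) :
    SuperEnd m n where
  base := ⟨fun x => A *ᵥ x, (Matrix.mulVecLin A).toContinuousLinearMap.continuous⟩
  smooth := (Matrix.mulVecLin A).toContinuousLinearMap.contDiff
  pull U := Algebra.TensorProduct.map
    (smoothComp ⟨fun x => ⟨A *ᵥ (x : Body m), x.2⟩, by
      refine (ContMDiff.subtypeVal_comp_iff U _).1 ?_
      exact (Matrix.mulVecLin A).toContinuousLinearMap.contDiff.contMDiff.comp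
        contMDiff_subtype_val⟩)
    (ExteriorAlgebra.map (Matrix.toLin' Bᵀ))
  pull_parity U p f hf := by
    refine parity_induction (P := fun g => Algebra.TensorProduct.map _ _ g ∈ parity n _ p)
      ?_ ?_ ?_ hf
    · intro f x hx
      rw [Algebra.TensorProduct.map_tmul, mem_parity_iff, gradeInv_tmul, inv'_map, inv'_of_mem hx,
        map_smul, TensorProduct.tmul_smul]
    · rw [map_zero]; exact zero_mem _
    · intro f g hf hg
      rw [map_add]; exact add_mem hf hg
  pull_res U V h f := by
    induction f using TensorProduct.induction_on with
    | zero => simp only [map_zero]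
    | tmul f x => rfl
    | add f g hf hg => simp only [map_add, hf, hg]

theorem sharp_linEnd_tmul (A : Matrix (Fin m) (Fin m) ℝ)
    (B : Matrix (Fin n × Fin 2) (Fin n × Fin 2) ℝ) (f : Smooth (⊤ : Opens (Body m)))
    (x : Grass n) :
    sharp (linEnd A B) (f ⊗ₜ x) = linPull A f ⊗ₜ ExteriorAlgebra.map (Matrix.toLin' Bᵀ) x := by
  rw [sharp_apply]
  rfl

theorem toBody_linPull (A : Matrix (Fin m) (Fin m) ℝ) (f : Smooth (⊤ : Opens (Body m)))
    (p : Body m) : toBody (linPull A f) p = toBody f (A *ᵥ p) := rfl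

theorem linPull_bosCoord (A : Matrix (Fin m) (Fin m) ℝ) (i : Fin m) :
    linPull A (bosCoord i) = ∑ k, A i k • bosCoord k := by
  refine smooth_ext fun p => ?_
  have h : ∀ s : Finset (Fin m),
      toBody (∑ k ∈ s, A i k • bosCoord k) p = ∑ k ∈ s, A i k * p k := by
    classical
    intro s
    induction s using Finset.induction_on with
    | empty => rfl
    | insert a s ha ih =>
      rw [Finset.sum_insert ha, Finset.sum_insert ha, ← ih]
      rfl
  rw [h, toBody_linPull, toBody_bosCoord]
  rfl

/-- Accounts for the transpose in `linEnd`: the generators are coordinate functions, so the k-th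
must go to the combination given by the k-th row of `B`. -/
theorem toLin'_transpose_single (B : Matrix (Fin n × Fin 2) (Fin n × Fin 2) ℝ)
    (k : Fin n × Fin 2) : Matrix.toLin' Bᵀ (Pi.single k 1) = fun j => B k j := by
  ext j
  simp [Matrix.toLin'_apply]

theorem sharp_linEnd_coord (A : Matrix (Fin m) (Fin m) ℝ)
    (B : Matrix (Fin n × Fin 2) (Fin n × Fin 2) ℝ) (i : Idx m n) :
    sharp (linEnd A B) (coord i) = ∑ k, Matrix.fromBlocks A 0 0 B i k • coord k := by
  rw [Fintype.sum_sum_type]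
  rcases i with i | k
  · rw [coord_inl, sharp_linEnd_tmul, linPull_bosCoord, map_one, TensorProduct.sum_tmul]
    simp [coord_inl, TensorProduct.smul_tmul']
  · rw [coord_inr, sharp_linEnd_tmul, ExteriorAlgebra.map_apply_ι, toLin'_transpose_single, map_one,
      one_tmul_ι]
    simp

theorem evalGrass_sharp_linEnd (A : Matrix (Fin m) (Fin m) ℝ)
    (B : Matrix (Fin n × Fin 2) (Fin n × Fin 2) ℝ) (i : Fin m) (p : Body m) :
    ∃ c, evalGrass p (sharp (linEnd A B) (coord (Sum.inl i))) = algebraMap ℝ _ c :=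
  ⟨(A *ᵥ p) i, by
    rw [coord_inl, sharp_linEnd_tmul, evalGrass_tmul, map_one, toBody_linPull, toBody_bosCoord,
      Algebra.algebraMap_eq_smul_one]⟩

theorem linEnd_mul (A A' : Matrix (Fin m) (Fin m) ℝ)
    (B B' : Matrix (Fin n × Fin 2) (Fin n × Fin 2) ℝ) :
    linEnd (A * A') (B * B') = linEnd A B * linEnd A' B' := by
  refine SuperEnd_ext (fun i => ?_) (evalGrass_sharp_linEnd _ _)
  have : Matrix.fromBlocks (A * A') 0 0 (B * B') =
      (Matrix.fromBlocks A 0 0 B * Matrix.fromBlocks A' 0 0 B' : Matrix (Idx m n) (Idx m n) ℝ) := by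
    simp [Matrix.fromBlocks_multiply]
  rw [sharp_mul, sharp_linEnd_coord, sharp_linEnd_coord, map_sum, this]
  simp only [map_smul, sharp_linEnd_coord, Finset.smul_sum, smul_smul]
  rw [Finset.sum_comm]
  simp only [Matrix.mul_apply, Finset.sum_smul]

theorem linEnd_one : linEnd (1 : Matrix (Fin m) (Fin m) ℝ)
    (1 : Matrix (Fin n × Fin 2) (Fin n × Fin 2) ℝ) = 1 := by
  refine SuperEnd_ext (fun i => ?_) (evalGrass_sharp_linEnd _ _)
  rw [sharp_one, sharp_linEnd_coord, Matrix.fromBlocks_one]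
  simp [Matrix.one_apply]

/-- The linear diffeomorphism of an element of `O(m) × Sp(2n)`. -/
def linDiffeo (S : EvenGroup m n) : SuperDiffeo m n where
  val := linEnd S.1.1 S.2.1.1
  inv := linEnd S⁻¹.1.1 S⁻¹.2.1.1
  val_inv := by
    rw [← linEnd_mul, ← linEnd_one]
    congr 1
    · exact congrArg (fun T : EvenGroup m n => T.1.1) (mul_inv_cancel S)
    · exact congrArg (fun T : EvenGroup m n => T.2.1.1) (mul_inv_cancel S)
  inv_val := by
    rw [← linEnd_mul, ← linEnd_one]
    congr 1
    · exact congrArg (fun T : EvenGroup m n => T.1.1) (inv_mul_cancel S)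
    · exact congrArg (fun T : EvenGroup m n => T.2.1.1) (inv_mul_cancel S)

theorem linDiffeo_mul (S T : EvenGroup m n) :
    linDiffeo (S * T) = linDiffeo S * linDiffeo T :=
  Units.ext (linEnd_mul _ _ _ _)

theorem linDiffeo_inv (S : EvenGroup m n) : linDiffeo S⁻¹ = (linDiffeo S)⁻¹ := by
  refine eq_inv_of_mul_eq_one_left ?_
  rw [← linDiffeo_mul, inv_mul_cancel]
  exact Units.ext linEnd_one

theorem sharp_linDiffeo (S : EvenGroup m n) (f : Glob m n) :
    sharp (linDiffeo S).val f = subst S f := by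
  induction f using TensorProduct.induction_on with
  | zero => simp
  | tmul f x => exact sharp_linEnd_tmul _ _ f x
  | add f g hf hg => rw [map_add, map_add, hf, hg]

theorem sharp_linDiffeo_coord (S : EvenGroup m n) (i : Idx m n) :
    sharp (linDiffeo S).val (coord i) = ∑ k, toMat S i k • coord k :=
  sharp_linEnd_coord _ _ i

end Linear

/-! ### The metric as a pairing of vectors of superfunctions -/

section Pairing

variable {m n : ℕ}

theorem matG_eq_zero {i j : Idx m n} (h : deg i ≠ deg j) : matG m n i j = 0 := by
  rcases i with i | i <;> rcases j with j | j <;> simp [matG] at h ⊢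

theorem matJ_swap (k l : Fin n × Fin 2) : matJ n k l = -matJ n l k := by
  obtain ⟨k1, k2⟩ := k
  obtain ⟨l1, l2⟩ := l
  simp only [matJ, Matrix.of_apply]
  by_cases h : k1 = l1
  · subst h
    fin_cases k2 <;> fin_cases l2 <;> norm_num
  · rw [if_neg h, if_neg (Ne.symm h), neg_zero]

theorem matG_swap (i j : Idx m n) : matG m n i j = koszul (deg j) (deg j) * matG m n j i := by
  rcases i with i | i <;> rcases j with j | j <;> simp [matG]
  · simp [Matrix.one_apply, eq_comm]
  · exact matJ_swap i j

/-- The factor ½ in the blocks is squared; this is the origin of the inverse −4J used below. -/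
theorem matJ_mul_self : matJ n * matJ n = (-(1 / 4) : ℝ) • 1 := by
  ext ⟨k1, k2⟩ ⟨l1, l2⟩
  simp only [Matrix.mul_apply, Fintype.sum_prod_type, matJ, Matrix.of_apply, Matrix.smul_apply,
    Matrix.one_apply, Fin.sum_univ_two]
  rw [Finset.sum_eq_single k1]
  · by_cases h : k1 = l1
    · subst h
      fin_cases k2 <;> fin_cases l2 <;> norm_num
    · simp [h]
  · intro b _ hb
    simp [Ne.symm hb]
  · simp

theorem matJ_mul_smul_matJ : matJ n * ((-4 : ℝ) • matJ n) = 1 := by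
  rw [Matrix.mul_smul, matJ_mul_self, smul_smul]
  norm_num

theorem matJ_isUnit : IsUnit (matJ n) := IsUnit.of_mul_eq_one _ matJ_mul_smul_matJ

theorem matG_isUnit : IsUnit (matG m n) := by
  have h : matG m n * Matrix.fromBlocks 1 0 0 ((-4 : ℝ) • matJ n) = 1 := by
    rw [matG, Matrix.fromBlocks_multiply, matJ_mul_smul_matJ]
    simp
  exact IsUnit.of_mul_eq_one _ h

theorem matG_mul_inv : matG m n * (matG m n)⁻¹ = 1 :=
  Matrix.mul_nonsing_inv _ ((Matrix.isUnit_iff_isUnit_det _).1 matG_isUnit)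

theorem matG_inv_mul : (matG m n)⁻¹ * matG m n = 1 :=
  Matrix.nonsing_inv_mul _ ((Matrix.isUnit_iff_isUnit_det _).1 matG_isUnit)

/-- The pairing `∑_{ij} g^{ij} u_i v_j`, up to signs, for which
`⟨Y, Z⟩ = pairing (Y X) (Z X)`. -/
def pairing (u v : Idx m n → Glob m n) : Glob m n :=
  ∑ j, (∑ i, matG m n i j • u i) * (if deg j = 0 then v j else gradeInv n ⊤ (-v j))

/-- Replaces vector fields by their columns of values on the coordinates; from here on the metric is
studied as a form on such columns. -/
theorem metric_eq_pairing (Y Z : Op m n) :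
    metric Y Z = pairing (fun i => Y (coord i)) (fun i => Z (coord i)) := by
  simp only [metric, pairing, coordUp, map_sum, map_smul]

/-- The components `u_i` of parity `a + [i]`. -/
def IsHom (a : ZMod 2) (u : Idx m n → Glob m n) : Prop := ∀ i, u i ∈ parity n ⊤ (a + deg i)

/-- For odd j the explicit minus sign and the parity (−1)^{b+1} of v_j combine to (−1)^b, so the
twist by `gradeInv` becomes the sign (−1)^{[j]b}. -/
theorem pairing_eq {b : ZMod 2} (u : Idx m n → Glob m n) {v : Idx m n → Glob m n}
    (hv : IsHom b v) :
    pairing u v = ∑ j, ∑ i, (matG m n i j * koszul (deg j) b) • (u i * v j) := by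
  refine Finset.sum_congr rfl fun j _ => ?_
  have : (if deg j = 0 then v j else gradeInv n ⊤ (-v j)) = koszul (deg j) b • v j := by
    rcases zmod_two_cases (deg j) with h | h
    · rw [if_pos h, h, koszul_zero_left, one_smul]
    · rw [h, if_neg one_ne_zero, map_neg, gradeInv_of_mem (hv j), h, koszul_add_right,
        koszul_one_one, mul_neg, mul_one, ← neg_one_smul', smul_smul, neg_mul_neg, one_mul]
  rw [this, Finset.sum_mul]
  refine Finset.sum_congr rfl fun i _ => ?_
  rw [smul_mul_assoc, mul_smul_comm, smul_smul]

/-- Since g pairs only indices of equal parity, the index-dependent signs from exchanging u_i and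
v_j cancel against the antisymmetry of g on odd indices. Only (−1)^{ab} is left. -/
theorem pairing_symm {a b : ZMod 2} {u v : Idx m n → Glob m n} (hu : IsHom a u) (hv : IsHom b v) :
    pairing u v = koszul a b • pairing v u := by
  rw [pairing_eq u hv, pairing_eq v hu, Finset.sum_comm, Finset.smul_sum]
  refine Finset.sum_congr rfl fun i _ => ?_
  rw [Finset.smul_sum]
  refine Finset.sum_congr rfl fun j _ => ?_
  rw [supercomm (hu i) (hv j), smul_smul, smul_smul]
  congr 1
  by_cases h : deg i = deg j
  · rw [matG_swap i j, h]
    generalize deg j = d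
    simp only [koszul_add_left, koszul_add_right, koszul_comm a d]
    linear_combination matG m n j i * koszul a b * koszul d a *
      (koszul_mul_self d b * koszul d d * koszul d d + koszul_mul_self d d)
  · rw [matG_eq_zero h, matG_eq_zero (Ne.symm h)]
    ring

theorem pairing_leibniz {a b c : ZMod 2} {D : Op m n} (hD : D ∈ HomDer m n c)
    {u v : Idx m n → Glob m n} (hu : IsHom a u) (hv : IsHom b v) :
    D (pairing u v) = pairing (fun i => D (u i)) v + koszul c a • pairing u (fun i => D (v i)) := by
  have hDv : IsHom (c + b) (fun i => D (v i)) := fun i => by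
    rw [add_assoc]; exact hD.1 _ _ (hv i)
  rw [pairing_eq u hv, pairing_eq _ hv, pairing_eq _ hDv, map_sum, Finset.smul_sum,
    ← Finset.sum_add_distrib]
  refine Finset.sum_congr rfl fun j _ => ?_
  rw [map_sum, Finset.smul_sum, ← Finset.sum_add_distrib]
  refine Finset.sum_congr rfl fun i _ => ?_
  rw [map_smul, hD.2 _ _ (hu i), smul_add, smul_smul, smul_smul]
  congr 2
  by_cases h : deg i = deg j
  · rw [h, koszul_add_right, koszul_add_right, koszul_comm c (deg j)]
    ring
  · rw [matG_eq_zero h]; ring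

theorem pairing_mul_right {q s b : ZMod 2} {w v : Idx m n → Glob m n} {f : Glob m n}
    (hw : IsHom q w) (hf : f ∈ parity n ⊤ s) (hv : IsHom b v) :
    pairing w (fun i => f * v i) = koszul q s • (f * pairing w v) := by
  have hfv : IsHom (s + b) (fun i => f * v i) := fun i => by
    rw [add_assoc]; exact mul_mem_parity hf (hv i)
  rw [pairing_eq w hv, pairing_eq w hfv, Finset.mul_sum, Finset.smul_sum]
  refine Finset.sum_congr rfl fun j _ => ?_
  rw [Finset.mul_sum, Finset.smul_sum]
  refine Finset.sum_congr rfl fun i _ => ?_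
  rw [← mul_assoc, supercomm (hw i) hf, mul_smul_comm, smul_smul, smul_mul_assoc, smul_smul,
    mul_assoc f]
  congr 1
  by_cases h : deg i = deg j
  · rw [h, koszul_add_right, koszul_add_left]
    linear_combination matG m n i j * koszul (deg j) b * koszul q s * koszul_mul_self (deg j) s
  · rw [matG_eq_zero h]; ring

theorem pairing_smul_left (r : ℝ) (u v : Idx m n → Glob m n) :
    pairing (fun i => r • u i) v = r • pairing u v := by
  simp only [pairing, Finset.smul_sum, ← smul_mul_assoc, smul_comm r]

theorem pairing_add_left (u u' v : Idx m n → Glob m n) :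
    pairing (fun i => u i + u' i) v = pairing u v + pairing u' v := by
  simp only [pairing, smul_add, Finset.sum_add_distrib, add_mul]

theorem pairing_add_right (u v v' : Idx m n → Glob m n) :
    pairing u (fun i => v i + v' i) = pairing u v + pairing u v' := by
  simp only [pairing, ← Finset.sum_add_distrib, ← mul_add]
  refine Finset.sum_congr rfl fun j _ => ?_
  split_ifs
  · rfl
  · rw [neg_add, map_add]

theorem pairing_smul_right (r : ℝ) (u v : Idx m n → Glob m n) :
    pairing u (fun i => r • v i) = r • pairing u v := by
  simp only [pairing, Finset.smul_sum, ← mul_smul_comm]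
  refine Finset.sum_congr rfl fun j _ => ?_
  split_ifs
  · rfl
  · have : -(r • v j) = r • -v j := (smul_neg r (v j)).symm
    rw [this, map_smul]

theorem pairing_zero_left (v : Idx m n → Glob m n) : pairing (fun _ => 0) v = 0 := by
  simp [pairing]

theorem pairing_zero_right (u : Idx m n → Glob m n) : pairing u (fun _ => 0) = 0 := by
  simp [pairing]

theorem pairing_sum_right {ι : Type*} (s : Finset ι) (u : Idx m n → Glob m n)
    (v : ι → Idx m n → Glob m n) :
    pairing u (fun i => ∑ b ∈ s, v b i) = ∑ b ∈ s, pairing u (v b) := by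
  classical
  induction s using Finset.induction_on with
  | empty => simpa using pairing_zero_right u
  | insert b s hb ih => simp only [Finset.sum_insert hb, pairing_add_right, ih]

theorem smul_algebraMap_glob (r s : ℝ) :
    r • algebraMap ℝ (Glob m n) s = algebraMap ℝ (Glob m n) (r * s) := by
  rw [map_mul]
  exact Algebra.smul_def r (algebraMap ℝ (Glob m n) s)

theorem pairing_algebraMap (u v : Idx m n → ℝ) :
    pairing (fun i => algebraMap ℝ (Glob m n) (u i)) (fun i => algebraMap ℝ (Glob m n) (v i)) =
      algebraMap ℝ (Glob m n)
        (∑ j, ∑ i, matG m n i j * koszul (deg j) (deg j) * u i * v j) := by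
  rw [pairing, map_sum]
  refine Finset.sum_congr rfl fun j _ => ?_
  have : (if deg j = 0 then algebraMap ℝ (Glob m n) (v j)
      else gradeInv n ⊤ (-algebraMap ℝ (Glob m n) (v j))) =
        koszul (deg j) (deg j) • algebraMap ℝ (Glob m n) (v j) := by
    rcases zmod_two_cases (deg j) with h | h
    · rw [if_pos h, h, koszul_zero_left, one_smul]
    · rw [h, if_neg one_ne_zero, koszul_one_one, neg_one_smul', map_neg, AlgHom.commutes]
  rw [this, Finset.sum_mul, map_sum]
  refine Finset.sum_congr rfl fun i _ => ?_
  rw [smul_algebraMap_glob, smul_algebraMap_glob, ← map_mul]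
  congr 1
  ring

/-- Nondegeneracy: pairing with the k-th unit column gives, up to sign, the k-th component of gᵀw,
and g is invertible. -/
theorem eq_zero_of_pairing_single {w : Idx m n → Glob m n}
    (h : ∀ k, pairing w (fun j => if k = j then 1 else 0) = 0) : w = 0 := by
  have h1 : ∀ k, ∑ i, matG m n i k • w i = 0 := by
    intro k
    have h2 := h k
    rw [pairing, Finset.sum_eq_single k] at h2
    · rw [if_pos rfl] at h2
      rcases zmod_two_cases (deg k) with hk | hk
      · simpa [hk] using h2
      · rw [hk, if_neg one_ne_zero, map_neg, map_one] at h2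
        exact neg_eq_zero.1 ((mul_neg_one (∑ i, matG m n i k • w i)).symm.trans h2)
    · intro j _ hj
      rw [if_neg hj.symm, neg_zero, map_zero, ite_self, mul_zero]
    · simp
  funext l
  have h3 : ∑ k, (matG m n)⁻¹ k l • ∑ i, matG m n i k • w i = 0 := by simp [h1]
  simp only [Finset.smul_sum, smul_smul] at h3
  rw [Finset.sum_comm] at h3
  simp only [mul_comm ((matG m n)⁻¹ _ l), ← Finset.sum_smul, ← Matrix.mul_apply, matG_mul_inv] at h3
  simpa [Matrix.one_apply] using h3

end Pairing

/-- A tensor symmetric in the first two and antisymmetric in the last two arguments, up to signs,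
vanishes. -/
theorem eq_zero_of_symm_antisymm {I M : Type*} [AddCommGroup M] [Module ℝ M] (T : I → I → I → M)
    (s : I → I → ℝ) (hs : ∀ a b, s a b * s b a = 1)
    (h1 : ∀ a b c, T a b c = s a b • T b a c) (h2 : ∀ a b c, T a b c = (-s b c) • T a c b)
    (a b c : I) : T a b c = 0 := by
  -- Six swaps, alternately of the first two and of the last two arguments, run through all
  -- orderings and return to the start. Each factor s meets its reverse, while the three
  -- antisymmetric swaps contribute −1.
  have key : T a b c = (-((s a b * s b a) * (s a c * s c a) * (s b c * s c b))) • T a b c := by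
    conv_lhs =>
      rw [h1 a b c, h2 b a c, h1 b c a, h2 c b a, h1 c a b, h2 a c b]
    simp only [smul_smul]
    congr 1
    ring
  rw [hs, hs, hs] at key
  have h3 : (2 : ℝ) • T a b c = 0 := by
    rw [two_smul]
    nth_rewrite 1 [key]
    simp
  exact (smul_eq_zero.1 h3).resolve_left two_ne_zero

/-! ### Isometries are linear -/

section Isometry

variable {m n : ℕ}

theorem sharp_gradeInv (Φ : SuperEnd m n) (f : Glob m n) :
    sharp Φ (gradeInv n ⊤ f) = gradeInv n ⊤ (sharp Φ f) := by
  obtain ⟨f0, h0, f1, h1, rfl⟩ := exists_parity_add f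
  simp only [map_add, gradeInv_of_mem h0, gradeInv_of_mem h1,
    gradeInv_of_mem (sharp_parity Φ _ _ h0), gradeInv_of_mem (sharp_parity Φ _ _ h1), map_smul]

theorem sharp_pairing (Φ : SuperEnd m n) (u v : Idx m n → Glob m n) :
    sharp Φ (pairing u v) = pairing (fun i => sharp Φ (u i)) (fun i => sharp Φ (v i)) := by
  simp only [pairing, map_sum, map_mul, map_smul]
  refine Finset.sum_congr rfl fun j _ => ?_
  congr 1
  split_ifs
  · rfl
  · rw [sharp_gradeInv, map_neg]

/-- φ♯ cancels the inverse in Y_φ, so the isometry condition becomes an equation between Y and Z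
applied to φ_i = φ♯X_i, without (φ♯)⁻¹. -/
theorem sharp_metric_push (Φ : SuperDiffeo m n) (Y Z : Op m n) :
    sharp Φ.val (metric (push Φ Y) (push Φ Z)) =
      pairing (fun i => Y (sharp Φ.val (coord i))) (fun i => Z (sharp Φ.val (coord i))) := by
  simp only [metric_eq_pairing, sharp_pairing, push_apply, sharp_sharp_inv]

theorem push_mem_HomDer (Φ : SuperDiffeo m n) {p : ZMod 2} {Y : Op m n} (hY : Y ∈ HomDer m n p) :
    push Φ Y ∈ HomDer m n p := by
  refine ⟨fun q f hf => sharp_parity _ _ _ (hY.1 q _ (sharp_parity _ _ _ hf)),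
    fun q f hf h => ?_⟩
  simp only [push_apply, map_mul, hY.2 q _ (sharp_parity _ _ _ hf), map_add, map_smul,
    sharp_inv_sharp]

theorem HomDer_le_Der (p : ZMod 2) : HomDer m n p ≤ Der m n := by
  rcases zmod_two_cases p with rfl | rfl
  · exact le_sup_left
  · exact le_sup_right

theorem isHom_coord : IsHom 0 (coord : Idx m n → Glob m n) := fun i => by
  rw [zero_add]; exact coord_mem_parity i

theorem isHom_apply {a c : ZMod 2} {D : Op m n} (hD : D ∈ HomDer m n c)
    {u : Idx m n → Glob m n} (hu : IsHom a u) : IsHom (c + a) (fun i => D (u i)) := fun i => by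
  rw [add_assoc]; exact hD.1 _ _ (hu i)

theorem partialX_partialX_coord (a b i : Idx m n) :
    partialX a (partialX b (coord i : Glob m n)) = 0 := by
  rw [partialX_coord]
  split_ifs
  · exact HomDer_one (partialX_mem_HomDer a)
  · exact map_zero _

/-- Rigidity of isometries. `T` plays the part of Christoffel symbols with lowered index: it
vanishes by its conflicting symmetries, and nondegeneracy then kills the second derivatives. -/
theorem partialX_partialX_sharp_coord {Φ : SuperDiffeo m n} (hΦ : Φ ∈ isometryGroup m n)
    (c a i : Idx m n) : partialX c (partialX a (sharp Φ.val (coord i))) = 0 := by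
  set φ : Idx m n → Glob m n := fun j => sharp Φ.val (coord j) with hφ
  have hφ0 : IsHom 0 φ := fun j => sharp_parity _ _ _ (isHom_coord j)
  have hd : ∀ a, IsHom (deg a + 0) (fun j => partialX a (φ j)) := fun a =>
    isHom_apply (partialX_mem_HomDer a) hφ0
  have hdd : ∀ c a, IsHom (deg c + (deg a + 0)) (fun j => partialX c (partialX a (φ j))) :=
    fun c a => isHom_apply (partialX_mem_HomDer c) (hd a)
  let T : Idx m n → Idx m n → Idx m n → Glob m n := fun c a b =>
    pairing (fun j => partialX c (partialX a (φ j))) (fun j => partialX b (φ j))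
  have h1 : ∀ c a b, T c a b = koszul (deg c) (deg a) • T a c b := by
    intro c a b
    simp only [T]
    rw [← pairing_smul_left]
    congr 1
    funext j
    exact partialX_comm c a _
  -- Apply ∂_c to the isometry equation for ∂_a, ∂_b. The right side is the flat metric on
  -- coordinate fields, a constant, and disappears.
  have h0 : ∀ c a b, T c a b + koszul (deg c) (deg a) •
      pairing (fun j => partialX a (φ j)) (fun j => partialX c (partialX b (φ j))) = 0 := by
    intro c a b
    have hm : ∀ a, (partialX a : Op m n) ∈ Der m n := fun a =>
      HomDer_le_Der _ (partialX_mem_HomDer a)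
    have e := hΦ _ (hm a) _ (hm b)
    rw [sharp_metric_push, metric_eq_pairing] at e
    have e' := congrArg (partialX c) e
    rw [pairing_leibniz (partialX_mem_HomDer c) (hd a) (hd b),
      pairing_leibniz (partialX_mem_HomDer c)
        (isHom_apply (partialX_mem_HomDer a) isHom_coord)
        (isHom_apply (partialX_mem_HomDer b) isHom_coord)] at e'
    simp only [partialX_partialX_coord, pairing_zero_left, pairing_zero_right, smul_zero,
      add_zero] at e'
    exact e'
  have h2 : ∀ c a b, T c a b = (-koszul (deg a) (deg b)) • T c b a := by
    intro c a b
    have e := h0 c a b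
    rw [pairing_symm (hd a) (hdd c b), smul_smul] at e
    have e2 : koszul (deg c) (deg a) * koszul (deg a + 0) (deg c + (deg b + 0)) =
        koszul (deg a) (deg b) := by
      rw [add_zero, add_zero, koszul_add_right, koszul_comm (deg c), ← mul_assoc, koszul_mul_self,
        one_mul]
    rw [e2] at e
    have e3 : (-koszul (deg a) (deg b)) • T c b a = -(koszul (deg a) (deg b) • T c b a) :=
      neg_smul (koszul (deg a) (deg b)) (T c b a)
    rw [e3]
    exact eq_neg_of_add_eq_zero_left e
  have hT : ∀ c a b, T c a b = 0 := eq_zero_of_symm_antisymm T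
    (fun a b => koszul (deg a) (deg b))
    (fun a b => by rw [koszul_comm (deg b), koszul_mul_self]) h1 h2
  have hw : (fun j => partialX c (partialX a (φ j))) = 0 := by
    refine eq_zero_of_pairing_single fun k => ?_
    -- Invertibility of the Jacobian in coordinate-free form: this field sends φ_j to δ_kj.
    -- Expanding it in the ∂_b writes the k-th unit column as a combination of the columns ∂_bφ,
    -- against which T is already known to vanish.
    have hE : push Φ⁻¹ (partialX k) ∈ HomDer m n (deg k) :=
      push_mem_HomDer _ (partialX_mem_HomDer k)
    have hEφ : ∀ j, push Φ⁻¹ (partialX k) (φ j) = if k = j then 1 else 0 := by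
      intro j
      rw [push_apply, hφ, sharp_inv_sharp, partialX_coord, inv_inv]
      split_ifs
      · rw [map_one]
      · rw [map_zero]
    have hsum : ∀ j, (if k = j then 1 else 0 : Glob m n) =
        ∑ b, push Φ⁻¹ (partialX k) (coord b) * partialX b (φ j) := by
      intro j
      rw [← hEφ]
      conv_lhs => rw [HomDer_eq_sum hE]
      simp only [LinearMap.sum_apply, LinearMap.comp_apply, LinearMap.mulLeft_apply]
    simp only [hsum]
    rw [pairing_sum_right]
    refine Finset.sum_eq_zero fun b _ => ?_
    rw [pairing_mul_right (hdd c a) (hE.1 _ _ (coord_mem_parity b)) (hd b)]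
    have := hT c a b
    simp only [T] at this
    rw [this, mul_zero, smul_zero]
  exact congrFun hw i

theorem delta_coord (i : Idx m n) : delta 0 (coord i : Glob m n) = 0 := by
  rw [delta_eq]
  rcases i with i | k
  · rw [evalGrass_coord_inl, AlgHom.commutes]; rfl
  · rw [evalGrass_coord_inr]
    simp [ExteriorAlgebra.algebraMapInv]

theorem algebraMap_glob_injective : Function.Injective (algebraMap ℝ (Glob m n)) := by
  intro a b h
  have := congrArg (delta 0) h
  exact (AlgHom.commutes (delta 0) a).symm.trans (this.trans (AlgHom.commutes (delta 0) b))

theorem eq_zero_of_algebraMap_mem_parity_one {r : ℝ}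
    (h : algebraMap ℝ (Glob m n) r ∈ parity n ⊤ 1) : r = 0 := by
  have := eq_zero_of_mem_parity zero_ne_one (algebraMap_mem_parity r) h
  exact algebraMap_glob_injective (this.trans (map_zero _).symm)

theorem zmod_two_add_eq_one {a b : ZMod 2} (h : a ≠ b) : a + b = 1 := by
  revert a b; decide

/-- The matrix consists of the constants ∂_kφ_i. Such a constant has parity [i] + [k], so it is zero
when the parities differ; evaluation at the origin removes the affine term. -/
theorem exists_matrix_of_mem_isometryGroup₀ {Φ : SuperDiffeo m n}
    (hΦ : Φ ∈ isometryGroup₀ m n) : ∃ M : Matrix (Idx m n) (Idx m n) ℝ,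
      (∀ i, sharp Φ.val (coord i) = ∑ k, M i k • coord k) ∧
      (∀ i k, deg i ≠ deg k → M i k = 0) ∧ Mᵀ * matG m n * M = matG m n := by
  choose r M hM hφ using fun i =>
    eq_affine_of_partialX_partialX_eq_zero (partialX_partialX_sharp_coord hΦ.1 · · i)
  have hdeg : ∀ i k, deg i ≠ deg k → M i k = 0 := by
    intro i k hik
    have h := (partialX_mem_HomDer k).1 _ _ (sharp_parity Φ.val _ _ (coord_mem_parity i))
    rw [hM, zmod_two_add_eq_one hik.symm] at h
    exact eq_zero_of_algebraMap_mem_parity_one h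
  refine ⟨M, fun i => ?_, hdeg, ?_⟩
  · have h := hΦ.2 (coord i)
    rw [delta_coord, hφ i, map_add, AlgHom.commutes, map_sum, Finset.sum_eq_zero, add_zero] at h
    · have h0 : r i = 0 := h
      rw [hφ i, h0, map_zero, zero_add]
    · intro k _
      rw [map_smul, delta_coord, smul_zero]
  · ext a b
    have hm : ∀ a, (partialX a : Op m n) ∈ Der m n := fun a =>
      HomDer_le_Der _ (partialX_mem_HomDer a)
    have e := hΦ.1 _ (hm a) _ (hm b)
    rw [sharp_metric_push, metric_eq_pairing] at e
    have hc : ∀ a i, partialX a (coord i : Glob m n) =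
        algebraMap ℝ _ ((1 : Matrix (Idx m n) (Idx m n) ℝ) i a) := by
      intro a i
      rw [partialX_coord, Matrix.one_apply]
      by_cases h : a = i
      · rw [if_pos h, if_pos h.symm, map_one]
      · rw [if_neg h, if_neg (Ne.symm h), map_zero]
    simp only [hM, hc, pairing_algebraMap] at e
    have e1 := algebraMap_glob_injective e
    -- Block diagonality of N leaves only [j] = [b], so the sign comes out of the sum. Used for M
    -- and for the identity, it yields a common sign that cancels.
    have e2 : ∀ N : Matrix (Idx m n) (Idx m n) ℝ, (∀ i k, deg i ≠ deg k → N i k = 0) →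
        ∑ j, ∑ i, matG m n i j * koszul (deg j) (deg j) * N i a * N j b =
          koszul (deg b) (deg b) * (Nᵀ * matG m n * N) a b := by
      intro N hN
      rw [Matrix.mul_apply, Finset.mul_sum]
      refine Finset.sum_congr rfl fun j _ => ?_
      rw [Matrix.mul_apply, Finset.sum_mul, Finset.mul_sum]
      refine Finset.sum_congr rfl fun i _ => ?_
      by_cases h : deg j = deg b
      · rw [h, Matrix.transpose_apply]; ring
      · rw [hN j b h]; ring
    rw [e2 _ hdeg, e2 1 fun i k h => Matrix.one_apply_ne fun e => h (congrArg deg e)] at e1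
    have e3 := mul_left_cancel₀ (koszul_ne_zero _ _) e1
    simpa using e3

theorem toMat_eq_zero (S : EvenGroup m n) (i k : Idx m n) (h : deg i ≠ deg k) :
    toMat S i k = 0 := by
  rcases i with i | i <;> rcases k with k | k <;> simp [toMat] at h ⊢

theorem toMat_matG (S : EvenGroup m n) : (toMat S)ᵀ * matG m n * toMat S = matG m n := by
  have h1 : (S.1.1)ᵀ * S.1.1 = 1 := by
    have := (Matrix.mem_orthogonalGroup_iff' _ _).1 S.1.2
    exact this
  have h2 : (S.2.1.1)ᵀ * matJ n * S.2.1.1 = matJ n := S.2.2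
  simp only [toMat, matG, Matrix.fromBlocks_transpose, Matrix.fromBlocks_multiply]
  simp [h1, h2]

/-- The relation splits into the orthogonal and the symplectic one on the diagonal blocks;
invertibility of the odd block follows from det J ≠ 0. -/
theorem exists_toMat_eq {M : Matrix (Idx m n) (Idx m n) ℝ}
    (hdeg : ∀ i k, deg i ≠ deg k → M i k = 0) (hM : Mᵀ * matG m n * M = matG m n) :
    ∃ S : EvenGroup m n, toMat S = M := by
  have hb : M = Matrix.fromBlocks M.toBlocks₁₁ 0 0 M.toBlocks₂₂ := by
    conv_lhs => rw [← Matrix.fromBlocks_toBlocks M]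
    congr 1
    · ext i j; exact hdeg _ _ (by simp)
    · ext i j; exact hdeg _ _ (by simp)
  generalize M.toBlocks₁₁ = A at hb
  generalize M.toBlocks₂₂ = B at hb
  subst hb
  rw [matG, Matrix.fromBlocks_transpose, Matrix.fromBlocks_multiply,
    Matrix.fromBlocks_multiply] at hM
  have h1 := congrArg Matrix.toBlocks₁₁ hM
  have h2 := congrArg Matrix.toBlocks₂₂ hM
  simp only [Matrix.toBlocks_fromBlocks₁₁, Matrix.toBlocks_fromBlocks₂₂, Matrix.mul_one,
    Matrix.mul_zero, add_zero, zero_add, Matrix.zero_mul, Matrix.transpose_zero] at h1 h2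
  have hB : IsUnit B := by
    rw [Matrix.isUnit_iff_isUnit_det]
    have hd := congrArg Matrix.det h2
    rw [Matrix.det_mul] at hd
    have hJ := (Matrix.isUnit_iff_isUnit_det _).1 (matJ_isUnit (n := n))
    rw [← hd] at hJ
    exact isUnit_of_mul_isUnit_right hJ
  refine ⟨(⟨A, (Matrix.mem_orthogonalGroup_iff' _ _).2 h1⟩, ⟨hB.unit, ?_⟩), rfl⟩
  exact h2

theorem exists_linDiffeo_eq {Φ : SuperDiffeo m n} (hΦ : Φ ∈ isometryGroup₀ m n) :
    ∃ S, linDiffeo S = Φ := by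
  obtain ⟨M, h1, h2, h3⟩ := exists_matrix_of_mem_isometryGroup₀ hΦ
  obtain ⟨S, rfl⟩ := exists_toMat_eq h2 h3
  refine ⟨S, Units.ext (SuperEnd_ext (fun i => ?_) (evalGrass_sharp_linEnd _ _))⟩
  rw [h1, sharp_linDiffeo_coord]

/-- The twist by `gradeInv` depends only on the parity of the index, so it commutes with a block
diagonal M, and no homogeneity of the columns is required. What remains is MᵀgM = g after reordering
the sums. -/
theorem pairing_linear {M : Matrix (Idx m n) (Idx m n) ℝ}
    (hdeg : ∀ i k, deg i ≠ deg k → M i k = 0) (hM : Mᵀ * matG m n * M = matG m n)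
    (u v : Idx m n → Glob m n) :
    pairing (fun i => ∑ k, M i k • u k) (fun i => ∑ k, M i k • v k) = pairing u v := by
  let σ : ZMod 2 → Glob m n → Glob m n := fun d f => if d = 0 then f else gradeInv n ⊤ (-f)
  have hp : ∀ u v : Idx m n → Glob m n,
      pairing u v = ∑ j, ∑ i, matG m n i j • (u i * σ (deg j) (v j)) := by
    intro u v
    refine Finset.sum_congr rfl fun j _ => ?_
    rw [Finset.sum_mul]
    exact Finset.sum_congr rfl fun i _ => smul_mul_assoc _ _ _
  have hσ : ∀ j, σ (deg j) (∑ k, M j k • v k) = ∑ k, M j k • σ (deg k) (v k) := by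
    intro j
    have h1 : ∀ k, M j k • σ (deg k) (v k) = M j k • σ (deg j) (v k) := by
      intro k
      by_cases h : deg j = deg k
      · rw [h]
      · rw [hdeg j k h, zero_smul, zero_smul]
    simp only [h1, σ]
    split_ifs
    · rfl
    · simp only [map_neg, map_sum, map_smul, smul_neg, Finset.sum_neg_distrib]
  rw [hp, hp]
  simp only [hσ, Finset.sum_mul, Finset.mul_sum, smul_mul_assoc, mul_smul_comm, Finset.smul_sum,
    smul_smul]
  have hg : ∀ k l, matG m n k l = ∑ j, ∑ i, matG m n i j * (M i k * M j l) := by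
    intro k l
    conv_lhs => rw [← hM]
    rw [Matrix.mul_apply]
    refine Finset.sum_congr rfl fun j _ => ?_
    rw [Matrix.mul_apply, Finset.sum_mul]
    refine Finset.sum_congr rfl fun i _ => ?_
    rw [Matrix.transpose_apply]; ring
  calc _ = ∑ j, ∑ i, ∑ l, ∑ k, (matG m n i j * (M i k * M j l)) • (u k * σ (deg l) (v l)) := by
        refine Finset.sum_congr rfl fun j _ => Finset.sum_congr rfl fun i _ => ?_
        refine Finset.sum_congr rfl fun l _ => Finset.sum_congr rfl fun k _ => ?_
        congr 1
        ring
    _ = ∑ j, ∑ l, ∑ i, ∑ k, (matG m n i j * (M i k * M j l)) • (u k * σ (deg l) (v l)) :=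
        Finset.sum_congr rfl fun j _ => Finset.sum_comm
    _ = ∑ l, ∑ j, ∑ i, ∑ k, (matG m n i j * (M i k * M j l)) • (u k * σ (deg l) (v l)) :=
        Finset.sum_comm
    _ = ∑ l, ∑ j, ∑ k, ∑ i, (matG m n i j * (M i k * M j l)) • (u k * σ (deg l) (v l)) :=
        Finset.sum_congr rfl fun l _ => Finset.sum_congr rfl fun j _ => Finset.sum_comm
    _ = ∑ l, ∑ k, ∑ j, ∑ i, (matG m n i j * (M i k * M j l)) • (u k * σ (deg l) (v l)) :=
        Finset.sum_congr rfl fun l _ => Finset.sum_comm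
    _ = _ := by
        refine Finset.sum_congr rfl fun l _ => Finset.sum_congr rfl fun k _ => ?_
        rw [hg k l, Finset.sum_smul]
        exact Finset.sum_congr rfl fun j _ => (Finset.sum_smul ..).symm

theorem linDiffeo_mem (S : EvenGroup m n) : linDiffeo S ∈ isometryGroup₀ m n := by
  refine ⟨fun Y _ Z _ => ?_, fun f => ?_⟩
  · rw [sharp_metric_push, metric_eq_pairing]
    simp only [sharp_linDiffeo_coord, map_sum, map_smul]
    exact pairing_linear (toMat_eq_zero S) (toMat_matG S) _ _
  · induction f using TensorProduct.induction_on with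
    | zero => simp
    | tmul f x =>
      -- A substitution of generators leaves the part without generators unchanged; together with
      -- A·0 = 0 this shows that the origin is fixed.
      have h : ExteriorAlgebra.algebraMapInv.comp
          (ExteriorAlgebra.map (Matrix.toLin' (S.2.1.1)ᵀ)) =
            (ExteriorAlgebra.algebraMapInv : Grass n →ₐ[ℝ] ℝ) := by
        refine ExteriorAlgebra.hom_ext (LinearMap.ext fun v => ?_)
        simp [ExteriorAlgebra.algebraMapInv]
      rw [delta_eq, delta_eq]
      have h' : sharp (linDiffeo S).val (f ⊗ₜ x) = _ := sharp_linEnd_tmul _ _ f x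
      rw [h', evalGrass_tmul, evalGrass_tmul, map_smul, map_smul, toBody_linPull,
        Matrix.mulVec_zero]
      congr 1
      exact DFunLike.congr_fun h x
    | add f g hf hg => simp only [map_add, hf, hg]

end Isometry

/-! ### Linear vector fields -/

section LinField

variable {m n : ℕ}

/-- The vector field `X_i ↦ ∑_k N_{ik} X_k`. -/
def fieldOf (N : Matrix (Idx m n) (Idx m n) ℝ) : Op m n :=
  ∑ i, LinearMap.mulLeft ℝ (∑ k, N i k • coord k) ∘ₗ partialX i

theorem fieldOf_coord (N : Matrix (Idx m n) (Idx m n) ℝ) (i : Idx m n) :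
    fieldOf N (coord i) = ∑ k, N i k • coord k :=
  sum_mulLeft_partialX_coord (fun i => ∑ k, N i k • coord k) i

theorem fieldOf_apply (N : Matrix (Idx m n) (Idx m n) ℝ) (f : Glob m n) :
    fieldOf N f = ∑ i, ∑ k, N i k • (coord k * partialX i f) := by
  simp only [fieldOf, LinearMap.sum_apply, LinearMap.comp_apply, LinearMap.mulLeft_apply,
    Finset.sum_mul, smul_mul_assoc]

theorem fieldOf_add (N N' : Matrix (Idx m n) (Idx m n) ℝ) :
    fieldOf (N + N') = fieldOf N + fieldOf N' := by
  refine LinearMap.ext fun f => ?_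
  simp only [LinearMap.add_apply, fieldOf_apply, Matrix.add_apply, add_smul,
    Finset.sum_add_distrib]

theorem fieldOf_smul (r : ℝ) (N : Matrix (Idx m n) (Idx m n) ℝ) :
    fieldOf (r • N) = r • fieldOf N := by
  refine LinearMap.ext fun f => ?_
  simp only [LinearMap.smul_apply, fieldOf_apply, Matrix.smul_apply, smul_eq_mul, Finset.smul_sum,
    smul_smul]

theorem partialX_sum_smul_coord (c : Idx m n → ℝ) (k : Idx m n) :
    partialX k (∑ l, c l • coord l : Glob m n) = algebraMap ℝ _ (c k) := by
  rw [map_sum]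
  simp only [map_smul, partialX_coord, smul_ite, smul_zero, Finset.sum_ite_eq, Finset.mem_univ,
    if_true, Algebra.algebraMap_eq_smul_one]

theorem sum_smul_coord_injective {c d : Idx m n → ℝ}
    (h : (∑ l, c l • coord l : Glob m n) = ∑ l, d l • coord l) : c = d := by
  funext k
  have := congrArg (partialX k) h
  rw [partialX_sum_smul_coord, partialX_sum_smul_coord] at this
  exact algebraMap_glob_injective this

theorem fieldOf_injective :
    Function.Injective (fieldOf : Matrix (Idx m n) (Idx m n) ℝ → Op m n) := by
  intro N N' h
  ext i k
  have := LinearMap.congr_fun h (coord i)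
  rw [fieldOf_coord, fieldOf_coord] at this
  exact congrFun (sum_smul_coord_injective this) k

/-- Supermatrices of parity `a`. -/
def HasParity (a : ZMod 2) (N : Matrix (Idx m n) (Idx m n) ℝ) : Prop :=
  ∀ i j, deg i + deg j ≠ a → N i j = 0

theorem zmod_two_eq_add {a b c : ZMod 2} (h : b + c = a) : c = a + b := by
  revert a b c; decide

theorem sum_smul_mem_parity {a c : ZMod 2} {N : Matrix (Idx m n) (Idx m n) ℝ}
    (hN : HasParity a N) {u : Idx m n → Glob m n} (hu : IsHom c u) :
    IsHom (a + c) (fun i => ∑ k, N i k • u k) := by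
  refine fun i => sum_mem fun k _ => ?_
  by_cases h : deg i + deg k = a
  · have := hu k
    rw [zmod_two_eq_add h] at this
    refine Submodule.smul_mem _ _ ?_
    convert this using 2
    ring
  · rw [hN i k h, zero_smul]
    exact zero_mem _

theorem fieldOf_mem {a : ZMod 2} {N : Matrix (Idx m n) (Idx m n) ℝ} (hN : HasParity a N) :
    fieldOf N ∈ HomDer m n a := by
  refine sum_mulLeft_partialX_mem fun i => ?_
  have := sum_smul_mem_parity hN isHom_coord i
  rwa [add_zero] at this

/-- The entry N_ik is the constant ∂_k(F X_i), of parity [k] + a + [i]; an odd constant is zero. -/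
theorem hasParity_of_fieldOf_mem {a : ZMod 2} {N : Matrix (Idx m n) (Idx m n) ℝ}
    (h : fieldOf N ∈ HomDer m n a) : HasParity a N := by
  intro i k hik
  have h1 := (partialX_mem_HomDer k).1 _ _ (h.1 _ _ (coord_mem_parity i))
  rw [fieldOf_coord, partialX_sum_smul_coord] at h1
  have h2 : deg k + (a + deg i) = 1 := by
    rw [← zmod_two_add_eq_one hik]; ring
  rw [h2] at h1
  exact eq_zero_of_algebraMap_mem_parity_one h1

/-- The coefficient matrix of the vector field `linField A`. -/
def signed (A : Matrix (Idx m n) (Idx m n) ℝ) : Matrix (Idx m n) (Idx m n) ℝ :=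
  Matrix.of fun i k => -(koszul (deg i + deg k) (deg i) * A i k)

theorem signed_add (A B : Matrix (Idx m n) (Idx m n) ℝ) :
    signed (A + B) = signed A + signed B := by
  ext i k; simp [signed]; ring

theorem signed_smul (r : ℝ) (A : Matrix (Idx m n) (Idx m n) ℝ) :
    signed (r • A) = r • signed A := by
  ext i k; simp [signed]; ring

theorem signed_signed (A : Matrix (Idx m n) (Idx m n) ℝ) : signed (signed A) = A := by
  ext i k
  simp only [signed, Matrix.of_apply]
  linear_combination A i k * koszul_mul_self (deg i + deg k) (deg i)

theorem HasParity.signed_apply {a : ZMod 2} {A : Matrix (Idx m n) (Idx m n) ℝ}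
    (hA : HasParity a A) (i k : Idx m n) : signed A i k = -(koszul a (deg i) * A i k) := by
  simp only [signed, Matrix.of_apply]
  by_cases h : deg i + deg k = a
  · rw [h]
  · rw [hA i k h, mul_zero, mul_zero]

theorem HasParity.signed {a : ZMod 2} {A : Matrix (Idx m n) (Idx m n) ℝ}
    (hA : HasParity a A) : HasParity a (signed A) := fun i k h => by
  rw [hA.signed_apply, hA i k h, mul_zero, neg_zero]

theorem linField_eq (A : Matrix (Idx m n) (Idx m n) ℝ) : linField A = fieldOf (signed A) := by
  refine LinearMap.ext fun f => ?_
  rw [fieldOf_apply]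
  simp only [linField, LinearMap.neg_apply, LinearMap.sum_apply, LinearMap.smul_apply,
    LinearMap.comp_apply, LinearMap.mulLeft_apply, ← Finset.sum_neg_distrib]
  refine Finset.sum_congr rfl fun i _ => Finset.sum_congr rfl fun k _ => ?_
  exact (neg_smul (koszul (deg i + deg k) (deg i) * A i k) (coord k * partialX i f)).symm

theorem linField_add (A B : Matrix (Idx m n) (Idx m n) ℝ) :
    linField (A + B) = linField A + linField B := by
  rw [linField_eq, linField_eq, linField_eq, signed_add, fieldOf_add]

theorem linField_smul (r : ℝ) (A : Matrix (Idx m n) (Idx m n) ℝ) :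
    linField (r • A) = r • linField A := by
  rw [linField_eq, linField_eq, signed_smul, fieldOf_smul]

theorem linField_injective :
    Function.Injective (linField : Matrix (Idx m n) (Idx m n) ℝ → Op m n) := by
  intro A B h
  rw [linField_eq, linField_eq] at h
  rw [← signed_signed A, fieldOf_injective h, signed_signed]

theorem HasParity.linField_mem {a : ZMod 2} {A : Matrix (Idx m n) (Idx m n) ℝ}
    (hA : HasParity a A) : linField A ∈ HomDer m n a := by
  rw [linField_eq]; exact fieldOf_mem hA.signed

theorem HasParity.linField_coord {a : ZMod 2} {A : Matrix (Idx m n) (Idx m n) ℝ}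
    (hA : HasParity a A) (i : Idx m n) :
    linField A (coord i) = ∑ k, (-(koszul a (deg i) * A i k)) • coord k := by
  simp only [linField_eq, fieldOf_coord, hA.signed_apply]

theorem hasParity_of_linField_mem {a : ZMod 2} {A : Matrix (Idx m n) (Idx m n) ℝ}
    (h : linField A ∈ HomDer m n a) : HasParity a A := by
  rw [linField_eq] at h
  rw [← signed_signed A]
  exact (hasParity_of_fieldOf_mem h).signed

theorem ospHom_le_osp (a : ZMod 2) : ospHom m n a ≤ osp m n := by
  rcases zmod_two_cases a with rfl | rfl
  · exact le_sup_left
  · exact le_sup_right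

theorem mem_ospHom_of_hasParity {a : ZMod 2} {A : Matrix (Idx m n) (Idx m n) ℝ}
    (hA : A ∈ osp m n) (h : HasParity a A) : A ∈ ospHom m n a := by
  obtain ⟨A0, h0, A1, h1, rfl⟩ := Submodule.mem_sup.1 hA
  have key : ∀ {a b : ZMod 2} {A B : Matrix (Idx m n) (Idx m n) ℝ}, a ≠ b → A ∈ ospHom m n a →
      B ∈ ospHom m n b → HasParity a (A + B) → B = 0 := by
    intro a b A B hab hA hB h
    ext i k
    by_cases hik : deg i + deg k = b
    · have h2 := h i k (by rw [hik]; exact hab.symm)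
      rw [Matrix.add_apply, hA.1 i k (by rw [hik]; exact hab.symm), zero_add] at h2
      exact h2
    · exact hB.1 i k hik
  rcases zmod_two_cases a with rfl | rfl
  · rwa [key zero_ne_one h0 h1 h, add_zero]
  · rw [add_comm] at h
    rwa [key one_ne_zero h1 h0 h, zero_add]

/-! ### Linear Killing fields -/

/-- Infinitesimal invariance of the pairing. The coefficient of y_k z_l is the 𝔬𝔰𝔭 relation at (k,
l) times a sign, because g preserves index parity and A shifts it by a. -/
theorem pairing_infinitesimal {a c : ZMod 2} {A : Matrix (Idx m n) (Idx m n) ℝ}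
    (hA : A ∈ ospHom m n a) (y : Idx m n → Glob m n) {z : Idx m n → Glob m n} (hz : IsHom c z) :
    pairing (fun i => ∑ k, signed A i k • y k) z +
      koszul a c • pairing y (fun i => ∑ k, signed A i k • z k) = 0 := by
  have hp : HasParity a A := hA.1
  have h1 : pairing (fun i => ∑ k, signed A i k • y k) z =
      ∑ k, ∑ l, (∑ i, matG m n i l * koszul (deg l) c * signed A i k) • (y k * z l) := by
    rw [pairing_eq _ hz]
    simp only [Finset.sum_mul, smul_mul_assoc, Finset.smul_sum, smul_smul, Finset.sum_smul]
    calc _ = ∑ l, ∑ k, ∑ i, (matG m n i l * koszul (deg l) c * signed A i k) • (y k * z l) :=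
          Finset.sum_congr rfl fun l _ => Finset.sum_comm
      _ = _ := Finset.sum_comm
  have h2 : pairing y (fun i => ∑ k, signed A i k • z k) =
      ∑ k, ∑ l, (∑ j, matG m n k j * koszul (deg j) (a + c) * signed A j l) • (y k * z l) := by
    rw [pairing_eq _ (sum_smul_mem_parity hp.signed hz)]
    simp only [Finset.mul_sum, mul_smul_comm, Finset.smul_sum, smul_smul, Finset.sum_smul]
    rw [Finset.sum_comm]
    exact Finset.sum_congr rfl fun k _ => Finset.sum_comm
  rw [h1, h2, Finset.smul_sum, ← Finset.sum_add_distrib]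
  refine Finset.sum_eq_zero fun k _ => ?_
  rw [Finset.smul_sum, ← Finset.sum_add_distrib]
  refine Finset.sum_eq_zero fun l _ => ?_
  rw [smul_smul, ← add_smul]
  have h3 := hA.2 k l
  have h4 : ∑ i, matG m n i l * koszul (deg l) c * signed A i k =
      -(koszul (deg l) c * (koszul a (deg l) * ∑ i, A i k * matG m n i l)) := by
    rw [Finset.mul_sum, Finset.mul_sum, ← Finset.sum_neg_distrib]
    refine Finset.sum_congr rfl fun i _ => ?_
    rw [hp.signed_apply]
    by_cases h : deg i = deg l
    · rw [h]; ring
    · rw [matG_eq_zero h]; ring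
  have h5 : koszul a c * ∑ j, matG m n k j * koszul (deg j) (a + c) * signed A j l =
      -(koszul (deg l) c * ∑ i, A i l * matG m n k i) := by
    rw [Finset.mul_sum, Finset.mul_sum, ← Finset.sum_neg_distrib]
    refine Finset.sum_congr rfl fun j _ => ?_
    rw [hp.signed_apply]
    by_cases h : deg j + deg l = a
    · have hl := zmod_two_eq_add h
      rw [hl, koszul_add_right, koszul_add_left, koszul_comm a (deg j)]
      linear_combination (-(koszul a c * matG m n k j * koszul (deg j) c * A j l)) *
        koszul_mul_self (deg j) a
    · rw [hp j l h]; ring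
  rw [h4, h5]
  have h6 : -(koszul (deg l) c * (koszul a (deg l) * ∑ i, A i k * matG m n i l)) +
      -(koszul (deg l) c * ∑ i, A i l * matG m n k i) = 0 := by
    linear_combination (-koszul (deg l) c) * h3
  rw [h6, zero_smul]

theorem superComm_coord {a b : ZMod 2} (F Y : Op m n) (i : Idx m n) :
    superComm a b F Y (coord i) =
      F (Y (coord i)) + (-koszul a b) • Y (F (coord i)) := by
  have : (-koszul a b) • Y (F (coord i)) = -(koszul a b • Y (F (coord i))) :=
    neg_smul (koszul a b) (Y (F (coord i)))
  rw [this, ← sub_eq_add_neg]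
  rfl

/-- By the Leibniz rule, the terms in which F differentiates the components of Y and Z occur on both
sides. What is left over is `pairing_infinitesimal` up to a sign. -/
theorem isKilling_linField {a : ZMod 2} {A : Matrix (Idx m n) (Idx m n) ℝ}
    (hA : A ∈ ospHom m n a) : IsKilling a (linField A) := by
  have hp : HasParity a A := hA.1
  have hF := hp.linField_mem
  refine ⟨hF, fun b c Y hY Z hZ => ?_⟩
  have hy := isHom_apply hY isHom_coord
  have hz := isHom_apply hZ isHom_coord
  rw [add_zero] at hy hz
  simp only [metric_eq_pairing, superComm_coord]
  rw [pairing_leibniz hF hy hz, pairing_add_left, pairing_add_right, pairing_smul_left,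
    pairing_smul_right]
  have h := pairing_infinitesimal hA (fun i => Y (coord i)) hz
  have e : ∀ (D : Op m n) i, D (linField A (coord i)) = ∑ k, signed A i k • D (coord k) := by
    intro D i
    rw [linField_eq, fieldOf_coord, map_sum]
    simp only [map_smul]
  simp only [e]
  set P := pairing (fun i => ∑ k, signed A i k • Y (coord k)) (fun i => Z (coord i))
  set R := pairing (fun i => Y (coord i)) (fun i => ∑ k, signed A i k • Z (coord k))
  have h' : (-koszul a b) • P + (koszul a b * -koszul a c) • R = 0 := by
    have h2 := congrArg (fun x => (-koszul a b) • x) h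
    simp only [smul_add, smul_smul, smul_zero] at h2
    rw [← h2]
    congr 2
    ring
  rw [smul_add, smul_smul, add_assoc, add_left_comm ((-koszul a b) • P), h', add_zero]

/-- Affine vector fields with linear part in `𝔬𝔰𝔭(m|2n)`. -/
theorem exists_of_isKilling {a : ZMod 2} {F : Op m n} (hF : IsKilling a F) :
    ∃ r : Idx m n → ℝ, ∃ A ∈ ospHom m n a,
      F = ∑ i, LinearMap.mulLeft ℝ (algebraMap ℝ (Glob m n) (r i)) ∘ₗ partialX i + linField A := by
  obtain ⟨hFd, hK⟩ := hF
  set φ : Idx m n → Glob m n := fun i => F (coord i) with hφ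
  have hφa : IsHom a φ := by
    have := isHom_apply hFd isHom_coord
    rwa [add_zero] at this
  have hd : ∀ p, IsHom (deg p + a) (fun i => partialX p (φ i)) := fun p =>
    isHom_apply (partialX_mem_HomDer p) hφa
  have hdd : ∀ c p, IsHom (deg c + (deg p + a)) (fun i => partialX c (partialX p (φ i))) :=
    fun c p => isHom_apply (partialX_mem_HomDer c) (hd p)
  have hx : ∀ p, IsHom (deg p) (fun i => partialX p (coord i : Glob m n)) := fun p => by
    have := isHom_apply (partialX_mem_HomDer p) (isHom_coord (m := m) (n := n))
    rwa [add_zero] at this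
  have hc : ∀ a i, partialX a (coord i : Glob m n) =
      algebraMap ℝ _ ((1 : Matrix (Idx m n) (Idx m n) ℝ) i a) := by
    intro a i
    rw [partialX_coord, Matrix.one_apply]
    by_cases h : a = i
    · rw [if_pos h, if_pos h.symm, map_one]
    · rw [if_neg h, if_neg (Ne.symm h), map_zero]
  have hsc : ∀ p i, superComm a (deg p) F (partialX p) (coord i) =
      (-koszul a (deg p)) • partialX p (φ i) := by
    intro p i
    rw [superComm_coord, hc, HomDer_algebraMap hFd, zero_add]
  have hE : ∀ p q, pairing (fun i => partialX p (φ i)) (fun i => partialX q (coord i)) +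
      koszul a (deg q) •
        pairing (fun i => partialX p (coord i)) (fun i => partialX q (φ i)) = 0 := by
    intro p q
    have e := hK _ _ _ (partialX_mem_HomDer p) _ (partialX_mem_HomDer q)
    simp only [metric_eq_pairing, hsc] at e
    rw [pairing_smul_left, pairing_smul_right] at e
    -- The metric of two coordinate fields is constant, so the left side of the Killing equation
    -- vanishes.
    have e0 : F (pairing (fun i => partialX p (coord i)) (fun i => partialX q (coord i))) = 0 := by
      simp only [hc, pairing_algebraMap, HomDer_algebraMap hFd]
    rw [e0] at e
    have e2 := congrArg (fun x => (-koszul a (deg p)) • x) e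
    simp only [smul_add, smul_smul, smul_zero] at e2
    rw [neg_mul_neg, koszul_mul_self, one_smul] at e2
    rw [e2]
    congr 2
    linear_combination (-koszul a (deg q)) * koszul_mul_self a (deg p)
  -- The prefactor (−1)^{a[q]} absorbs the parity of F: the symmetry signs of T then involve only
  -- index parities, as in the case of isometries.
  let T : Idx m n → Idx m n → Idx m n → Glob m n := fun c p q =>
    koszul a (deg q) •
      pairing (fun i => partialX c (partialX p (φ i))) (fun i => partialX q (coord i))
  have h1 : ∀ c p q, T c p q = koszul (deg c) (deg p) • T p c q := by
    intro c p q
    simp only [T]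
    rw [smul_comm, ← pairing_smul_left (koszul (deg c) (deg p))]
    congr 2
    funext j
    exact partialX_comm c p _
  have h2 : ∀ c p q, T c p q = (-koszul (deg p) (deg q)) • T c q p := by
    intro c p q
    have e := congrArg (partialX c) (hE p q)
    rw [map_add, map_zero, map_smul, pairing_leibniz (partialX_mem_HomDer c) (hd p) (hx q),
      pairing_leibniz (partialX_mem_HomDer c) (hx p) (hd q)] at e
    simp only [partialX_partialX_coord, pairing_zero_left, pairing_zero_right, smul_zero,
      add_zero, zero_add] at e
    rw [pairing_symm (hx p) (hdd c q), smul_smul, smul_smul] at e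
    have e2 := congrArg (fun x => koszul a (deg q) • x) e
    simp only [smul_add, smul_smul, smul_zero] at e2
    have e3 : koszul a (deg q) * (koszul a (deg q) * koszul (deg c) (deg p) *
        koszul (deg p) (deg c + (deg q + a))) =
          koszul (deg p) (deg q) * koszul a (deg p) := by
      rw [koszul_add_right, koszul_add_right, koszul_comm (deg c), koszul_comm (deg p) a]
      linear_combination (koszul (deg p) (deg q) * koszul a (deg p)) *
        (koszul (deg p) (deg c) * koszul (deg p) (deg c) * koszul_mul_self a (deg q) +
          koszul_mul_self (deg p) (deg c))
    rw [e3, ← smul_smul (koszul (deg p) (deg q))] at e2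
    have e4 : (-koszul (deg p) (deg q)) • T c q p = -(koszul (deg p) (deg q) • T c q p) :=
      neg_smul (koszul (deg p) (deg q)) (T c q p)
    rw [e4]
    exact eq_neg_of_add_eq_zero_left e2
  have hT : ∀ c p q, T c p q = 0 := eq_zero_of_symm_antisymm T
    (fun p q => koszul (deg p) (deg q))
    (fun p q => by rw [koszul_comm (deg q), koszul_mul_self]) h1 h2
  have hw : ∀ c p i, partialX c (partialX p (φ i)) = 0 := by
    intro c p
    -- Here ∂_kX is already a unit column, so nondegeneracy applies directly, without inverting a
    -- Jacobian.
    have : (fun i => partialX c (partialX p (φ i))) = 0 := by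
      refine eq_zero_of_pairing_single fun k => ?_
      have h3 := (smul_eq_zero.1 (hT c p k)).resolve_left (koszul_ne_zero _ _)
      simpa only [partialX_coord] using h3
    exact congrFun this
  choose r N hN hr using fun i => eq_affine_of_partialX_partialX_eq_zero fun c p => hw c p i
  have hNp : HasParity a (Matrix.of N) := by
    intro i k hik
    have h3 : partialX k (φ i) ∈ _ := hd k i
    rw [hN] at h3
    have h4 : deg k + a + deg i = 1 := by
      rw [← zmod_two_add_eq_one hik]; ring
    rw [h4] at h3
    exact eq_zero_of_algebraMap_mem_parity_one h3
  have hAp := hNp.signed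
  refine ⟨r, signed (Matrix.of N), ⟨hAp, fun k l => ?_⟩, ?_⟩
  · generalize hA : signed (Matrix.of N) = A at hAp
    have hNA : ∀ i j, N i j = -(koszul a (deg i) * A i j) := by
      intro i j
      rw [← hAp.signed_apply, ← hA, signed_signed]
      rfl
    -- When [k] + [l] ≠ a, both sums in the 𝔬𝔰𝔭 relation vanish by parity. Otherwise the relation is
    -- the Killing equation on ∂_k, ∂_l, and the signs match only because a = [k] + [l].
    by_cases hkl : deg k + deg l = a
    · have e := hE k l
      simp only [hN, hc, pairing_algebraMap] at e
      rw [smul_algebraMap_glob, ← map_add] at e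
      have e1 := algebraMap_glob_injective (e.trans (map_zero _).symm)
      simp only [Matrix.one_apply, mul_ite, mul_one, mul_zero, ite_mul, zero_mul] at e1
      rw [Finset.sum_comm] at e1
      simp only [Finset.sum_ite_eq', Finset.mem_univ, if_true, hNA] at e1
      have e2 : ∑ i, matG m n i l * koszul (deg l) (deg l) * -(koszul a (deg i) * A i k) =
          -(koszul (deg l) (deg l) * koszul a (deg l) * ∑ i, A i k * matG m n i l) := by
        rw [Finset.mul_sum, ← Finset.sum_neg_distrib]
        refine Finset.sum_congr rfl fun i _ => ?_
        by_cases h : deg i = deg l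
        · rw [h]; ring
        · rw [matG_eq_zero h]; ring
      have e3 : ∑ j, matG m n k j * koszul (deg j) (deg j) * -(koszul a (deg j) * A j l) =
          -(koszul (deg k) (deg k) * koszul a (deg k) * ∑ i, A i l * matG m n k i) := by
        rw [Finset.mul_sum, ← Finset.sum_neg_distrib]
        refine Finset.sum_congr rfl fun j _ => ?_
        by_cases h : deg k = deg j
        · rw [h]; ring
        · rw [matG_eq_zero h]; ring
      rw [e2, e3, ← hkl] at e1
      rw [← hkl]
      generalize (∑ i, A i k * matG m n i l) = s at e1 ⊢
      generalize (∑ i, A i l * matG m n k i) = t at e1 ⊢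
      rcases zmod_two_cases (deg k) with h | h <;> rcases zmod_two_cases (deg l) with h' | h' <;>
        simp [h, h', koszul_add_left] at e1 ⊢ <;> linarith
    · have e2 : ∑ i, A i l * matG m n k i = 0 := by
        refine Finset.sum_eq_zero fun i _ => ?_
        by_cases h : deg k = deg i
        · rw [hAp i l (by rwa [← h]), zero_mul]
        · rw [matG_eq_zero h, mul_zero]
      have e3 : ∑ i, A i k * matG m n i l = 0 := by
        refine Finset.sum_eq_zero fun i _ => ?_
        by_cases h : deg i = deg l
        · rw [hAp i k (by rwa [h, add_comm]), zero_mul]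
        · rw [matG_eq_zero h, mul_zero]
      rw [e2, e3, mul_zero, add_zero]
  · rw [linField_eq, signed_signed, HomDer_eq_sum hFd]
    refine LinearMap.ext fun f => ?_
    have hr' : ∀ i, F (coord i) = _ := hr
    simp only [LinearMap.add_apply, fieldOf, LinearMap.sum_apply, LinearMap.comp_apply,
      LinearMap.mulLeft_apply, ← Finset.sum_add_distrib, ← add_mul, Matrix.of_apply, hr']

theorem exists_of_mem_killing {F : Op m n} (hF : F ∈ killing m n) :
    ∃ r : Idx m n → ℝ, ∃ A ∈ osp m n,
      F = ∑ i, LinearMap.mulLeft ℝ (algebraMap ℝ (Glob m n) (r i)) ∘ₗ partialX i + linField A := by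
  induction hF using Submodule.span_induction with
  | mem F hF =>
    obtain ⟨a, ha⟩ := hF
    obtain ⟨r, A, hA, h⟩ := exists_of_isKilling ha
    exact ⟨r, A, ospHom_le_osp a hA, h⟩
  | zero =>
    refine ⟨0, 0, zero_mem _, LinearMap.ext fun f => ?_⟩
    have h0 : linField (0 : Matrix (Idx m n) (Idx m n) ℝ) = 0 := by
      have := linField_smul (m := m) (n := n) 0 0
      simpa only [zero_smul] using this
    rw [h0, add_zero, LinearMap.sum_apply]
    simp
  | add F G _ _ h1 h2 =>
    obtain ⟨r, A, hA, rfl⟩ := h1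
    obtain ⟨r', A', hA', rfl⟩ := h2
    refine ⟨r + r', A + A', add_mem hA hA', LinearMap.ext fun f => ?_⟩
    rw [linField_add]
    simp only [LinearMap.add_apply, LinearMap.sum_apply, LinearMap.comp_apply,
      LinearMap.mulLeft_apply, Pi.add_apply, map_add, add_mul, Finset.sum_add_distrib]
    abel
  | smul c F _ h1 =>
    obtain ⟨r, A, hA, rfl⟩ := h1
    refine ⟨c • r, c • A, Submodule.smul_mem _ c hA, LinearMap.ext fun f => ?_⟩
    rw [linField_smul]
    simp only [LinearMap.smul_apply, LinearMap.add_apply, LinearMap.sum_apply,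
      LinearMap.comp_apply, LinearMap.mulLeft_apply, Pi.smul_apply, smul_eq_mul, smul_add,
      Finset.smul_sum, ← smul_algebraMap_glob, smul_mul_assoc]

theorem linField_mem_killing₀ {A : Matrix (Idx m n) (Idx m n) ℝ} (hA : A ∈ osp m n) :
    linField A ∈ killing₀ m n := by
  refine ⟨?_, fun f => ?_⟩
  · obtain ⟨A0, h0, A1, h1, rfl⟩ := Submodule.mem_sup.1 hA
    rw [linField_add]
    exact add_mem (Submodule.subset_span ⟨0, isKilling_linField h0⟩)
      (Submodule.subset_span ⟨1, isKilling_linField h1⟩)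
  · rw [linField_eq, fieldOf_apply]
    simp only [map_sum, map_smul, map_mul, delta_coord, zero_mul, smul_zero, Finset.sum_const_zero]

/-- A linear field vanishes at the origin, so the value of F X_i there is exactly the translation
coefficient r_i. -/
theorem exists_of_mem_killing₀ {F : Op m n} (hF : F ∈ killing₀ m n) :
    ∃ A ∈ osp m n, linField A = F := by
  obtain ⟨r, A, hA, rfl⟩ := exists_of_mem_killing hF.1
  refine ⟨A, hA, ?_⟩
  have hr : ∀ i, r i = 0 := by
    intro i
    have h := hF.2 (coord i)
    rw [LinearMap.add_apply,
      sum_mulLeft_partialX_coord (fun i => algebraMap ℝ (Glob m n) (r i)), map_add,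
      (linField_mem_killing₀ hA).2, add_zero, AlgHom.commutes] at h
    exact h
  refine LinearMap.ext fun f => ?_
  simp [hr]

/-- The isomorphism of `𝔬𝔰𝔭(m|2n)` with the Killing fields vanishing at the origin. -/
def rho (m n : ℕ) : osp m n ≃ₗ[ℝ] killing₀ m n :=
  LinearEquiv.ofBijective
    { toFun := fun A => ⟨linField A.1, linField_mem_killing₀ A.2⟩
      map_add' := fun A B => Subtype.ext (linField_add A.1 B.1)
      map_smul' := fun r A => Subtype.ext (linField_smul r A.1) }
    ⟨fun A B h => Subtype.ext (linField_injective (congrArg Subtype.val h)), fun F => by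
      obtain ⟨A, hA, h⟩ := exists_of_mem_killing₀ F.2
      exact ⟨⟨A, hA⟩, Subtype.ext h⟩⟩

end LinField

/-! ### The orthosymplectic Lie superalgebra in matrix form -/

section Osp

variable {m n : ℕ}

/-- The diagonal matrix of the signs `(-1)^{a[i]}`. -/
def signMat (m n : ℕ) (a : ZMod 2) : Matrix (Idx m n) (Idx m n) ℝ :=
  Matrix.diagonal fun i => koszul a (deg i)

theorem signMat_mul (a b : ZMod 2) : signMat m n a * signMat m n b = signMat m n (a + b) := by
  rw [signMat, signMat, signMat, Matrix.diagonal_mul_diagonal]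
  congr 1
  funext i
  rw [koszul_add_left]

theorem HasParity.signMat_mul {a : ZMod 2} {A : Matrix (Idx m n) (Idx m n) ℝ}
    (hA : HasParity a A) (c : ZMod 2) :
    signMat m n c * A = koszul c a • (A * signMat m n c) := by
  ext i j
  rw [signMat, Matrix.diagonal_mul, Matrix.smul_apply, Matrix.mul_diagonal, smul_eq_mul]
  by_cases h : deg i + deg j = a
  · rw [← h, koszul_add_right]
    linear_combination (-(koszul c (deg i) * A i j)) * koszul_mul_self c (deg j)
  · rw [hA i j h]; ring

theorem hasParity_toMat (S : EvenGroup m n) : HasParity 0 (toMat S) := fun i j h => by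
  refine toMat_eq_zero S i j fun e => h ?_
  rw [e]
  exact CharTwo.add_self_eq_zero _

theorem HasParity.mul {a b : ZMod 2} {A B : Matrix (Idx m n) (Idx m n) ℝ}
    (hA : HasParity a A) (hB : HasParity b B) : HasParity (a + b) (A * B) := by
  intro i j h
  rw [Matrix.mul_apply]
  refine Finset.sum_eq_zero fun k _ => ?_
  by_cases h1 : deg i + deg k = a
  · by_cases h2 : deg k + deg j = b
    · refine absurd ?_ h
      rw [← h1, ← h2, add_assoc, ← add_assoc (deg k), CharTwo.add_self_eq_zero, zero_add]
    · rw [hB k j h2, mul_zero]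
  · rw [hA i k h1, zero_mul]

theorem HasParity.sub_smul {a : ZMod 2} {A B : Matrix (Idx m n) (Idx m n) ℝ}
    (hA : HasParity a A) (hB : HasParity a B) (r : ℝ) : HasParity a (A - r • B) := by
  intro i j h
  rw [Matrix.sub_apply, Matrix.smul_apply, hA i j h, hB i j h, smul_zero, sub_zero]

/-- In matrix form, with the signs (−1)^{a[l]} gathered in a diagonal matrix, brackets and
conjugations can be handled by matrix algebra. -/
theorem mem_ospHom_iff {a : ZMod 2} {A : Matrix (Idx m n) (Idx m n) ℝ} :
    A ∈ ospHom m n a ↔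
      HasParity a A ∧ matG m n * A = -(Aᵀ * matG m n * signMat m n a) := by
  refine and_congr Iff.rfl ?_
  rw [← Matrix.ext_iff]
  refine forall_congr' fun k => forall_congr' fun l => ?_
  rw [Matrix.neg_apply, signMat, Matrix.mul_diagonal, Matrix.mul_apply, Matrix.mul_apply,
    eq_neg_iff_add_eq_zero]
  simp only [Matrix.transpose_apply, mul_comm (matG m n k _)]
  rw [mul_comm (koszul a (deg l))]

theorem matComm_mem {a b : ZMod 2} {A B : Matrix (Idx m n) (Idx m n) ℝ}
    (hA : A ∈ ospHom m n a) (hB : B ∈ ospHom m n b) : matComm a b A B ∈ ospHom m n (a + b) := by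
  obtain ⟨pA, gA⟩ := mem_ospHom_iff.1 hA
  obtain ⟨pB, gB⟩ := mem_ospHom_iff.1 hB
  refine mem_ospHom_iff.2 ⟨?_, ?_⟩
  · refine (pA.mul pB).sub_smul ?_ _
    rw [add_comm]
    exact pB.mul pA
  -- Moving g past AB transposes the factors into (BA)ᵀ. The two terms of the superbracket are
  -- thereby interchanged, which produces the required minus sign.
  · have key : ∀ {a b : ZMod 2} {A B : Matrix (Idx m n) (Idx m n) ℝ}, HasParity b B →
        matG m n * A = -(Aᵀ * matG m n * signMat m n a) →
        matG m n * B = -(Bᵀ * matG m n * signMat m n b) →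
        matG m n * (A * B) = koszul a b • ((B * A)ᵀ * matG m n * signMat m n (a + b)) := by
      intro a b A B pB gA gB
      rw [← Matrix.mul_assoc, gA, Matrix.neg_mul, Matrix.mul_assoc, pB.signMat_mul,
        Matrix.mul_smul, ← Matrix.mul_assoc, Matrix.mul_assoc Aᵀ, gB, Matrix.mul_neg,
        Matrix.neg_mul, smul_neg, neg_neg, Matrix.transpose_mul]
      simp only [Matrix.mul_assoc]
      rw [signMat_mul, add_comm b a]
    have h1 := key pB gA gB
    have h2 := key pA gB gA
    rw [matComm, Matrix.mul_sub, Matrix.mul_smul, h1, h2, Matrix.transpose_sub,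
      Matrix.transpose_smul, Matrix.sub_mul, Matrix.sub_mul, smul_smul, koszul_comm b a,
      koszul_mul_self, one_smul, neg_sub, add_comm b a, Matrix.smul_mul, Matrix.smul_mul]

/-- Composing linear fields multiplies their matrices in reverse order. The overall minus sign in
`linField` turns this antihomomorphism into a homomorphism, and the factor (−1)^{|A|[i]} supplies
the Koszul signs. -/
theorem superComm_linField {a b : ZMod 2} {A B : Matrix (Idx m n) (Idx m n) ℝ}
    (hA : HasParity a A) (hB : HasParity b B) :
    superComm a b (linField A) (linField B) = linField (matComm a b A B) := by
  have hAB := hA.mul hB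
  have hBA := hB.mul hA
  rw [add_comm] at hBA
  have hC : HasParity (a + b) (matComm a b A B) := hAB.sub_smul hBA _
  refine HomDer_ext (superComm_mem_HomDer hA.linField_mem hB.linField_mem) hC.linField_mem
    fun i => ?_
  have key : ∀ {a b : ZMod 2} {A B : Matrix (Idx m n) (Idx m n) ℝ}, HasParity a A →
      HasParity b B → linField A (linField B (coord i)) =
        ∑ l, (koszul a b * koszul (a + b) (deg i) * (B * A) i l) • coord l := by
    intro a b A B hA hB
    rw [hB.linField_coord, map_sum]
    simp only [map_smul, hA.linField_coord, Finset.smul_sum, smul_smul]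
    rw [Finset.sum_comm]
    refine Finset.sum_congr rfl fun l _ => ?_
    rw [← Finset.sum_smul]
    congr 1
    rw [Matrix.mul_apply, Finset.mul_sum]
    refine Finset.sum_congr rfl fun k _ => ?_
    by_cases h : deg i + deg k = b
    · rw [zmod_two_eq_add h]
      simp only [koszul_add_left, koszul_add_right]
      ring
    · rw [hB i k h]; ring
  rw [superComm_coord, key hA hB, key hB hA, hC.linField_coord, Finset.smul_sum,
    ← Finset.sum_add_distrib]
  refine Finset.sum_congr rfl fun l _ => ?_
  rw [smul_smul, ← add_smul]
  congr 1
  rw [matComm, Matrix.sub_apply, Matrix.smul_apply, smul_eq_mul, koszul_comm b a, add_comm b a]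
  linear_combination (-(koszul (a + b) (deg i) * (A * B) i l)) * koszul_mul_self a b

theorem toMat_mul (S T : EvenGroup m n) : toMat (S * T) = toMat S * toMat T := by
  simp [toMat, Matrix.fromBlocks_multiply]

theorem toMat_one : toMat (1 : EvenGroup m n) = 1 := by
  simp [toMat]

theorem toMat_mul_inv (S : EvenGroup m n) : toMat S * toMat S⁻¹ = 1 := by
  rw [← toMat_mul, mul_inv_cancel, toMat_one]

theorem toMat_injective : Function.Injective (toMat : EvenGroup m n → _) := by
  intro S T h
  obtain ⟨h1, -, -, h2⟩ := Matrix.fromBlocks_inj.1 h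
  exact Prod.ext (Subtype.ext h1) (Subtype.ext (Units.ext h2))

theorem matG_mul_toMat_inv (S : EvenGroup m n) :
    matG m n * toMat S⁻¹ = (toMat S)ᵀ * matG m n := by
  conv_lhs => rw [← toMat_matG S]
  rw [Matrix.mul_assoc, toMat_mul_inv, Matrix.mul_one]

/-- S is even, so it commutes with the sign matrix, and it preserves g, so g passes through S as the
transposed inverse. -/
theorem conj_mem_ospHom {a : ZMod 2} (S : EvenGroup m n) {A : Matrix (Idx m n) (Idx m n) ℝ}
    (hA : A ∈ ospHom m n a) : toMat S * A * toMat S⁻¹ ∈ ospHom m n a := by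
  obtain ⟨pA, gA⟩ := mem_ospHom_iff.1 hA
  refine mem_ospHom_iff.2 ⟨?_, ?_⟩
  · have := ((hasParity_toMat S).mul pA).mul (hasParity_toMat S⁻¹)
    rwa [zero_add, add_zero] at this
  · have h1 : matG m n * toMat S = (toMat S⁻¹)ᵀ * matG m n := by
      have := matG_mul_toMat_inv S⁻¹
      rwa [inv_inv] at this
    have h2 : signMat m n a * toMat S⁻¹ = toMat S⁻¹ * signMat m n a := by
      rw [(hasParity_toMat S⁻¹).signMat_mul, koszul_zero_right, one_smul]
    calc matG m n * (toMat S * A * toMat S⁻¹)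
        = (toMat S⁻¹)ᵀ * (matG m n * A) * toMat S⁻¹ := by
          rw [← Matrix.mul_assoc, ← Matrix.mul_assoc, h1]; simp only [Matrix.mul_assoc]
      _ = -((toMat S⁻¹)ᵀ * Aᵀ * matG m n * (signMat m n a * toMat S⁻¹)) := by
          rw [gA]; simp only [Matrix.mul_assoc, Matrix.mul_neg, Matrix.neg_mul]
      _ = -((toMat S⁻¹)ᵀ * Aᵀ * (matG m n * toMat S⁻¹) * signMat m n a) := by
          rw [h2]; simp only [Matrix.mul_assoc]
      _ = _ := by
          rw [matG_mul_toMat_inv]; simp only [Matrix.transpose_mul, Matrix.mul_assoc]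

/-- It suffices to compare on coordinates. S mixes only indices of equal parity, so the sign
(−1)^{a[i]} passes through it. -/
theorem push_linField_of_hasParity {a : ZMod 2} (S : EvenGroup m n)
    {A : Matrix (Idx m n) (Idx m n) ℝ} (hA : HasParity a A) :
    push (linDiffeo S) (linField A) = linField (toMat S * A * toMat S⁻¹) := by
  have hC : HasParity a (toMat S * A * toMat S⁻¹) := by
    have := ((hasParity_toMat S).mul hA).mul (hasParity_toMat S⁻¹)
    rwa [zero_add, add_zero] at this
  refine HomDer_ext (push_mem_HomDer _ hA.linField_mem) hC.linField_mem fun i => ?_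
  have hk : ∀ k, sharp (linDiffeo S⁻¹).val (linField A (coord k)) =
      ∑ l, (∑ j, -(koszul a (deg k) * A k j) * toMat S⁻¹ j l) • coord l := by
    intro k
    rw [hA.linField_coord, map_sum]
    simp only [map_smul, sharp_linDiffeo_coord, Finset.smul_sum, smul_smul, Finset.sum_smul]
    exact Finset.sum_comm
  have e : ∀ l, ∑ k, toMat S i k * ∑ j, -(koszul a (deg k) * A k j) * toMat S⁻¹ j l =
      -(koszul a (deg i) * (toMat S * A * toMat S⁻¹) i l) := by
    intro l
    rw [Matrix.mul_assoc, Matrix.mul_apply, Finset.mul_sum, ← Finset.sum_neg_distrib]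
    refine Finset.sum_congr rfl fun k _ => ?_
    rw [Matrix.mul_apply, Finset.mul_sum, Finset.mul_sum, Finset.mul_sum,
      ← Finset.sum_neg_distrib]
    refine Finset.sum_congr rfl fun j _ => ?_
    by_cases h : deg i = deg k
    · rw [h]; ring
    · rw [toMat_eq_zero S i k h]; ring
  have h1 : push (linDiffeo S) (linField A) (coord i) =
      ∑ k, toMat S i k • sharp (linDiffeo S⁻¹).val (linField A (coord k)) := by
    rw [push_apply, sharp_linDiffeo_coord, ← linDiffeo_inv, map_sum, map_sum]
    refine Finset.sum_congr rfl fun k _ => ?_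
    rw [map_smul, map_smul]
  rw [h1, hC.linField_coord]
  simp only [hk, Finset.smul_sum, smul_smul]
  rw [Finset.sum_comm]
  refine Finset.sum_congr rfl fun l _ => ?_
  rw [← Finset.sum_smul, e]

theorem push_add (Φ : SuperDiffeo m n) (Y Z : Op m n) :
    push Φ (Y + Z) = push Φ Y + push Φ Z := by
  refine LinearMap.ext fun f => ?_
  simp only [push_apply, LinearMap.add_apply, map_add]

theorem conj_mem_osp (S : EvenGroup m n) {A : Matrix (Idx m n) (Idx m n) ℝ}
    (hA : A ∈ osp m n) : toMat S * A * toMat S⁻¹ ∈ osp m n ∧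
      push (linDiffeo S) (linField A) = linField (toMat S * A * toMat S⁻¹) := by
  obtain ⟨A0, h0, A1, h1, rfl⟩ := Submodule.mem_sup.1 hA
  rw [Matrix.mul_add, Matrix.add_mul, linField_add, linField_add, push_add,
    push_linField_of_hasParity S h0.1, push_linField_of_hasParity S h1.1]
  exact ⟨add_mem (ospHom_le_osp 0 (conj_mem_ospHom S h0)) (ospHom_le_osp 1 (conj_mem_ospHom S h1)),
    rfl⟩

/-! ### The operators `L_{ij}` -/

theorem matG_inv_eq_zero {i j : Idx m n} (h : deg i ≠ deg j) : (matG m n)⁻¹ i j = 0 := by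
  have e : (matG m n)⁻¹ = Matrix.fromBlocks 1 0 0 ((-4 : ℝ) • matJ n) := by
    refine Matrix.inv_eq_right_inv ?_
    rw [matG, Matrix.fromBlocks_multiply, matJ_mul_smul_matJ]
    simp
  rw [e]
  rcases i with i | i <;> rcases j with j | j <;> simp at h ⊢

theorem opL_apply (p q : Idx m n) (f : Glob m n) :
    opL p q f = coord p * nablaDown q f +
      (-koszul (deg p) (deg q)) • (coord q * nablaDown p f) := by
  have : (-koszul (deg p) (deg q)) • (coord q * nablaDown p f) =
      -(koszul (deg p) (deg q) • (coord q * nablaDown p f)) :=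
    neg_smul (koszul (deg p) (deg q)) (coord q * nablaDown p f)
  rw [this, ← sub_eq_add_neg]
  rfl

theorem nablaDown_apply (j : Idx m n) (f : Glob m n) :
    nablaDown j f = ∑ k, (matG m n)⁻¹ j k • partialX k f := by
  simp only [nablaDown, LinearMap.sum_apply, LinearMap.smul_apply]

theorem partialX_eq_sum_nablaDown (i : Idx m n) (f : Glob m n) :
    partialX i f = ∑ j, matG m n i j • nablaDown j f := by
  simp only [nablaDown_apply, Finset.smul_sum, smul_smul]
  rw [Finset.sum_comm]
  simp only [← Finset.sum_smul, ← Matrix.mul_apply, matG_mul_inv, Matrix.one_apply, ite_smul,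
    one_smul, zero_smul, Finset.sum_ite_eq, Finset.mem_univ, if_true]

/-- The coefficient matrix of `L_{pq}`. -/
def matL (p q : Idx m n) : Matrix (Idx m n) (Idx m n) ℝ :=
  Matrix.of fun i k => (if k = p then (matG m n)⁻¹ q i else 0) -
    koszul (deg p) (deg q) * (if k = q then (matG m n)⁻¹ p i else 0)

theorem opL_eq_fieldOf (p q : Idx m n) : opL p q = fieldOf (matL p q) := by
  refine LinearMap.ext fun f => ?_
  rw [opL_apply, fieldOf_apply, nablaDown_apply, nablaDown_apply, Finset.mul_sum, Finset.mul_sum,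
    Finset.smul_sum, ← Finset.sum_add_distrib]
  refine Finset.sum_congr rfl fun i _ => ?_
  have hL : ∀ k, matL p q i k = (if k = p then (matG m n)⁻¹ q i else 0) +
      (if k = q then -koszul (deg p) (deg q) * (matG m n)⁻¹ p i else 0) := by
    intro k
    rw [matL, Matrix.of_apply]
    split_ifs <;> ring
  simp only [hL, add_smul, Finset.sum_add_distrib, ite_smul, zero_smul, Finset.sum_ite_eq',
    Finset.mem_univ, if_true, mul_smul_comm, smul_smul]

theorem hasParity_matL (p q : Idx m n) : HasParity (deg p + deg q) (matL p q) := by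
  intro i k h
  have h1 : (if k = p then (matG m n)⁻¹ q i else 0) = 0 := by
    split_ifs with hk
    · subst hk
      exact matG_inv_eq_zero fun e => h (by rw [e, add_comm])
    · rfl
  have h2 : (if k = q then (matG m n)⁻¹ p i else 0) = 0 := by
    split_ifs with hk
    · subst hk
      exact matG_inv_eq_zero fun e => h (by rw [e])
    · rfl
  rw [matL, Matrix.of_apply, h1, h2, mul_zero, sub_zero]

theorem sum_matL_mul_matG (p q k l : Idx m n) :
    ∑ i, matL p q i l * matG m n i k =
      (if l = p then if k = q then 1 else 0 else 0) -
        koszul (deg p) (deg q) * (if l = q then if k = p then 1 else 0 else 0) := by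
  have h : ∀ q, ∑ i, (matG m n)⁻¹ q i * matG m n i k = if k = q then 1 else 0 := by
    intro q
    rw [← Matrix.mul_apply, matG_inv_mul, Matrix.one_apply]
    simp only [eq_comm]
  have h' : ∀ p q, ∑ i, (if l = p then (matG m n)⁻¹ q i else 0) * matG m n i k =
      if l = p then if k = q then 1 else 0 else 0 := by
    intro p q
    by_cases h1 : l = p
    · simp only [h1, if_true, h]
    · simp only [h1, if_false, zero_mul, Finset.sum_const_zero]
  rw [← h' p q, ← h' q p, Finset.mul_sum, ← Finset.sum_sub_distrib]
  refine Finset.sum_congr rfl fun i _ => ?_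
  rw [matL, Matrix.of_apply]
  ring

theorem signed_matL_mem (p q : Idx m n) : signed (matL p q) ∈ ospHom m n (deg p + deg q) := by
  have hp := (hasParity_matL p q).signed
  refine ⟨hp, fun k l => ?_⟩
  have h1 : ∑ i, signed (matL p q) i l * matG m n k i =
      -(koszul (deg p + deg q) (deg k) * koszul (deg k) (deg k)) *
        ∑ i, matL p q i l * matG m n i k := by
    rw [Finset.mul_sum]
    refine Finset.sum_congr rfl fun i _ => ?_
    rw [(hasParity_matL p q).signed_apply]
    by_cases h : deg k = deg i
    · rw [matG_swap k i, h]; ring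
    · rw [matG_eq_zero h, matG_eq_zero (Ne.symm h)]; ring
  have h2 : ∑ i, signed (matL p q) i k * matG m n i l =
      -koszul (deg p + deg q) (deg l) * ∑ i, matL p q i k * matG m n i l := by
    rw [Finset.mul_sum]
    refine Finset.sum_congr rfl fun i _ => ?_
    rw [(hasParity_matL p q).signed_apply]
    by_cases h : deg i = deg l
    · rw [h]; ring
    · rw [matG_eq_zero h]; ring
  rw [h1, h2, sum_matL_mul_matG, sum_matL_mul_matG]
  -- Contracting with g has turned the coefficients into Kronecker deltas; only (l, k) = (p, q) and
  -- (q, p) give nonzero terms, which cancel by signs.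
  by_cases h3 : l = p ∧ k = q
  · obtain ⟨rfl, rfl⟩ := h3
    by_cases h4 : l = k
    · subst h4
      rcases zmod_two_cases (deg l) with h | h <;> simp [h, CharTwo.add_self_eq_zero]
    · rcases zmod_two_cases (deg l) with h | h <;> rcases zmod_two_cases (deg k) with h' | h' <;>
        simp [h, h', h4, Ne.symm h4, koszul_add_left]
  · by_cases h4 : l = q ∧ k = p
    · obtain ⟨rfl, rfl⟩ := h4
      have h5 : ¬ l = k := fun e => h3 ⟨e, e.symm⟩
      rcases zmod_two_cases (deg l) with h | h <;> rcases zmod_two_cases (deg k) with h' | h' <;>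
        simp [h, h', h5, Ne.symm h5, koszul_add_left]
    · have e1 : (if l = p then if k = q then (1 : ℝ) else 0 else 0) = 0 := by
        rw [← ite_and, if_neg h3]
      have e2 : (if l = q then if k = p then (1 : ℝ) else 0 else 0) = 0 := by
        rw [← ite_and, if_neg h4]
      have e3 : (if k = q then if l = p then (1 : ℝ) else 0 else 0) = 0 := by
        rw [← ite_and, if_neg fun h => h3 h.symm]
      have e4 : (if k = p then if l = q then (1 : ℝ) else 0 else 0) = 0 := by
        rw [← ite_and, if_neg fun h => h4 h.symm]
      rw [e1, e2, e3, e4]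
      ring

theorem opL_mem_killing₀ (p q : Idx m n) : opL p q ∈ killing₀ m n := by
  have h := linField_mem_killing₀ (ospHom_le_osp _ (signed_matL_mem p q))
  rwa [linField_eq, signed_signed, ← opL_eq_fieldOf] at h

/-- Lowering an index with ∂_i = Σ_j g_ij ∇_j writes the field as Σ M_kj X_k ∇_j. The 𝔬𝔰𝔭 relation
is the super-antisymmetry of M, so antisymmetrizing X_k ∇_j changes nothing; the factor ½ is there
because each pair occurs twice. -/
theorem linField_eq_sum_opL {a : ZMod 2} {A : Matrix (Idx m n) (Idx m n) ℝ}
    (hA : A ∈ ospHom m n a) :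
    linField A = ∑ k, ∑ j, ((1 / 2 : ℝ) * -(koszul a (deg j) * ∑ i, A i k * matG m n i j)) •
      opL k j := by
  have hp : HasParity a A := hA.1
  set M : Idx m n → Idx m n → ℝ := fun k j => -(koszul a (deg j) * ∑ i, A i k * matG m n i j)
    with hM
  have hanti : ∀ k j, M k j * koszul (deg k) (deg j) = -M j k := by
    intro k j
    have h := hA.2 k j
    have h1 : ∑ i, A i j * matG m n k i =
        koszul (deg k) (deg k) * ∑ i, A i j * matG m n i k := by
      rw [Finset.mul_sum]
      refine Finset.sum_congr rfl fun i _ => ?_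
      by_cases hk : deg k = deg i
      · rw [matG_swap k i, hk]; ring
      · rw [matG_eq_zero hk, matG_eq_zero (Ne.symm hk)]; ring
    rw [h1] at h
    simp only [hM]
    by_cases hkj : deg k + deg j = a
    · rw [← hkj] at h ⊢
      generalize (∑ i, A i j * matG m n i k) = s at h ⊢
      generalize (∑ i, A i k * matG m n i j) = t at h ⊢
      rcases zmod_two_cases (deg k) with hk | hk <;> rcases zmod_two_cases (deg j) with hj | hj <;>
        simp [hk, hj, koszul_add_left] at h ⊢ <;> linarith
    · have e2 : ∑ i, A i j * matG m n i k = 0 := by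
        refine Finset.sum_eq_zero fun i _ => ?_
        by_cases h : deg i = deg k
        · rw [hp i j (by rwa [h]), zero_mul]
        · rw [matG_eq_zero h, mul_zero]
      have e3 : ∑ i, A i k * matG m n i j = 0 := by
        refine Finset.sum_eq_zero fun i _ => ?_
        by_cases h : deg i = deg j
        · rw [hp i k (by rwa [h, add_comm]), zero_mul]
        · rw [matG_eq_zero h, mul_zero]
      rw [e2, e3]; ring
  have hlin : ∀ f, linField A f = ∑ k, ∑ j, M k j • (coord k * nablaDown j f) := by
    intro f
    rw [linField_eq, fieldOf_apply, Finset.sum_comm]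
    refine Finset.sum_congr rfl fun k _ => ?_
    simp only [partialX_eq_sum_nablaDown _ f, Finset.mul_sum, mul_smul_comm, Finset.smul_sum,
      smul_smul]
    rw [Finset.sum_comm]
    refine Finset.sum_congr rfl fun j _ => ?_
    rw [← Finset.sum_smul]
    congr 1
    simp only [hM]
    rw [Finset.mul_sum, ← Finset.sum_neg_distrib]
    refine Finset.sum_congr rfl fun i _ => ?_
    rw [hp.signed_apply]
    by_cases h : deg i = deg j
    · rw [h]; ring
    · rw [matG_eq_zero h]; ring
  refine LinearMap.ext fun f => ?_
  simp only [LinearMap.sum_apply, LinearMap.smul_apply, opL_apply, smul_add, smul_smul,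
    Finset.sum_add_distrib]
  -- After exchanging k and j, super-antisymmetry makes the second half of the L_{kj} equal to the
  -- first.
  have h2 : ∑ k, ∑ j, ((1 / 2 : ℝ) * M k j * -koszul (deg k) (deg j)) •
      (coord j * nablaDown k f) = ∑ k, ∑ j, ((1 / 2 : ℝ) * M k j) • (coord k * nablaDown j f) := by
    rw [Finset.sum_comm]
    refine Finset.sum_congr rfl fun k _ => Finset.sum_congr rfl fun j _ => ?_
    congr 1
    linear_combination (-(1 / 2 : ℝ)) * hanti j k
  change _ = ∑ k, ∑ j, ((1 / 2 : ℝ) * M k j) • (coord k * nablaDown j f) +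
    ∑ k, ∑ j, ((1 / 2 : ℝ) * M k j * -koszul (deg k) (deg j)) • (coord j * nablaDown k f)
  rw [h2, hlin]
  simp only [← Finset.sum_add_distrib, ← add_smul]
  refine Finset.sum_congr rfl fun k _ => Finset.sum_congr rfl fun j _ => ?_
  congr 1
  ring

theorem killing₀_eq_span : killing₀ m n = Submodule.span ℝ {D | ∃ i j : Idx m n, D = opL i j} := by
  refine le_antisymm (fun F hF => ?_) (Submodule.span_le.2 ?_)
  · obtain ⟨A, hA, rfl⟩ := exists_of_mem_killing₀ hF
    obtain ⟨A0, h0, A1, h1, rfl⟩ := Submodule.mem_sup.1 hA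
    have key : ∀ a, ∀ A ∈ ospHom m n a,
        linField A ∈ Submodule.span ℝ {D | ∃ i j : Idx m n, D = opL i j} := by
      intro a A hA
      rw [linField_eq_sum_opL hA]
      exact sum_mem fun k _ => sum_mem fun j _ =>
        Submodule.smul_mem _ _ (Submodule.subset_span ⟨k, j, rfl⟩)
    rw [linField_add]
    exact add_mem (key 0 A0 h0) (key 1 A1 h1)
  · rintro _ ⟨p, q, rfl⟩
    exact opL_mem_killing₀ p q

end Osp

/-! ### One-parameter groups -/

section Exp

theorem hasDerivAt_exp_apply {ι : Type*} [Fintype ι] [DecidableEq ι] (A : Matrix ι ι ℝ)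
    (i j : ι) : HasDerivAt (fun t : ℝ => NormedSpace.exp (t • A) i j) (A i j) 0 := by
  -- A Banach algebra norm is needed only to differentiate exp; the entrywise conclusion does not
  -- mention it.
  open scoped Matrix.Norms.Operator in
  have h := hasDerivAt_exp_smul_const (𝕂 := ℝ) A (0 : ℝ)
  rw [zero_smul, NormedSpace.exp_zero, one_mul] at h
  exact (Matrix.entryLinearMap ℝ ℝ i j).toContinuousLinearMap.hasFDerivAt.comp_hasDerivAt 0 h

variable {m n : ℕ}

theorem signMat_zero : signMat m n 0 = 1 := by
  simp [signMat]

/-- Being even is the same as commuting with the sign matrix, a property inherited by the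
exponential. -/
theorem hasParity_exp {A : Matrix (Idx m n) (Idx m n) ℝ} (hA : HasParity 0 A) :
    HasParity 0 (NormedSpace.exp A) := by
  have h : Commute (signMat m n 1) A := by
    have := hA.signMat_mul 1
    rwa [koszul_zero_right, one_smul] at this
  have h' : signMat m n 1 * NormedSpace.exp A = NormedSpace.exp A * signMat m n 1 :=
    h.exp_right
  intro i j hij
  have e := congrFun (congrFun h' i) j
  rw [signMat, Matrix.diagonal_mul, Matrix.mul_diagonal] at e
  have hne : deg i ≠ deg j := fun h => hij (by rw [h]; exact CharTwo.add_self_eq_zero _)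
  rcases zmod_two_cases (deg i) with hi | hi <;> rcases zmod_two_cases (deg j) with hj | hj <;>
    simp [hi, hj] at e hne <;> linarith

/-- The relation reads Aᵀ = g(−A)g⁻¹, so exp(A)ᵀ = g exp(A)⁻¹ g⁻¹. -/
theorem exists_toMat_eq_exp {A : Matrix (Idx m n) (Idx m n) ℝ} (hA : A ∈ ospHom m n 0) :
    ∃ S : EvenGroup m n, toMat S = NormedSpace.exp A := by
  obtain ⟨pA, gA⟩ := mem_ospHom_iff.1 hA
  rw [signMat_zero, Matrix.mul_one] at gA
  refine exists_toMat_eq (fun i k h => hasParity_exp pA i k fun e => h ?_) ?_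
  · have := zmod_two_eq_add e
    rw [this, zero_add]
  have hT : Aᵀ = matG m n * -A * (matG m n)⁻¹ := by
    rw [Matrix.mul_neg, gA, neg_neg, Matrix.mul_assoc, matG_mul_inv, Matrix.mul_one]
  have hdet : IsUnit (NormedSpace.exp A).det :=
    (Matrix.isUnit_iff_isUnit_det _).1 (Matrix.isUnit_exp A)
  rw [← Matrix.exp_transpose, hT, Matrix.exp_conj _ _ matG_isUnit, Matrix.exp_neg,
    Matrix.mul_assoc _ _ (matG m n), matG_inv_mul, Matrix.mul_one, Matrix.mul_assoc,
    Matrix.nonsing_inv_mul _ hdet, Matrix.mul_one]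

/-- Differentiate at t = 0 the vanishing of the off-diagonal blocks and the relation EᵀgE = g. -/
theorem mem_ospHom_of_exp {A : Matrix (Idx m n) (Idx m n) ℝ}
    (h : ∀ t : ℝ, ∃ S : EvenGroup m n, toMat S = NormedSpace.exp (t • A)) :
    A ∈ ospHom m n 0 := by
  refine ⟨fun i j hij => ?_, fun k l => ?_⟩
  · refine (hasDerivAt_exp_apply A i j).unique ?_
    have : (fun t : ℝ => NormedSpace.exp (t • A) i j) = fun _ => 0 := by
      funext t
      obtain ⟨S, hS⟩ := h t
      rw [← hS, hasParity_toMat S i j hij]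
    rw [this]
    exact hasDerivAt_const _ _
  · let E : ℝ → Matrix (Idx m n) (Idx m n) ℝ := fun t => NormedSpace.exp (t • A)
    have hE : ∀ t, ∑ j, (∑ i, E t i k * matG m n i j) * E t j l = matG m n k l := by
      intro t
      obtain ⟨S, hS⟩ := h t
      have e := congrFun (congrFun (toMat_matG S) k) l
      rw [hS] at e
      simpa only [Matrix.mul_apply, Matrix.transpose_apply] using e
    have hd : ∀ i j, HasDerivAt (fun t => E t i j) (A i j) 0 := hasDerivAt_exp_apply A
    have h0 : E 0 = 1 := by
      simp only [E, zero_smul, NormedSpace.exp_zero]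
    have h1 := HasDerivAt.fun_sum (u := Finset.univ) fun j _ =>
      (HasDerivAt.fun_sum (u := Finset.univ) fun i _ => (hd i k).mul_const (matG m n i j)).mul
        (hd j l)
    have h2 : HasDerivAt (fun t => ∑ j, (∑ i, E t i k * matG m n i j) * E t j l) 0 0 := by
      simp only [hE]
      exact hasDerivAt_const _ _
    have h3 := h1.unique h2
    simp only [h0, Matrix.one_apply, mul_ite, ite_mul, mul_one, mul_zero, one_mul, zero_mul,
      Finset.sum_ite_eq', Finset.mem_univ, if_true, Finset.sum_add_distrib] at h3
    rw [koszul_zero_left, one_mul, ← h3, add_comm]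
    congr 1
    exact Finset.sum_congr rfl fun i _ => mul_comm _ _

theorem mem_ospHom_zero_iff {A : Matrix (Idx m n) (Idx m n) ℝ} : A ∈ ospHom m n 0 ↔
    ∀ t : ℝ, ∃ S : EvenGroup m n, toMat S = NormedSpace.exp (t • A) :=
  ⟨fun hA t => exists_toMat_eq_exp (Submodule.smul_mem _ t hA), mem_ospHom_of_exp⟩

end Exp

/-! ### Differentiating linear substitutions -/

section Deriv

variable {m n : ℕ}

/-- The derivation of the Grassmann algebra extending a linear endomorphism of the generators. -/
def grassDer (L : (Fin n × Fin 2 → ℝ) →ₗ[ℝ] (Fin n × Fin 2 → ℝ)) (x : Grass n) : Grass n :=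
  ∑ k, ExteriorAlgebra.ι ℝ (L (Pi.single k 1)) * contract (LinearMap.proj k) x

theorem grassDer_algebraMap (L : (Fin n × Fin 2 → ℝ) →ₗ[ℝ] (Fin n × Fin 2 → ℝ)) (r : ℝ) :
    grassDer L (algebraMap ℝ (Grass n) r) = 0 := by
  simp only [grassDer, contract_algebraMap, mul_zero, Finset.sum_const_zero]

theorem grassDer_add (L : (Fin n × Fin 2 → ℝ) →ₗ[ℝ] (Fin n × Fin 2 → ℝ)) (x y : Grass n) :
    grassDer L (x + y) = grassDer L x + grassDer L y := by
  simp only [grassDer, map_add, mul_add, Finset.sum_add_distrib]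

theorem grassDer_ι_mul (L : (Fin n × Fin 2 → ℝ) →ₗ[ℝ] (Fin n × Fin 2 → ℝ))
    (v : Fin n × Fin 2 → ℝ) (x : Grass n) :
    grassDer L (ExteriorAlgebra.ι ℝ v * x) =
      ExteriorAlgebra.ι ℝ (L v) * x + ExteriorAlgebra.ι ℝ v * grassDer L x := by
  have h : L v = ∑ k, v k • L (Pi.single k 1) := by
    conv_lhs => rw [pi_eq_sum_univ' v, map_sum]
    refine Finset.sum_congr rfl fun k _ => ?_
    rw [map_smul]
  rw [grassDer, h, map_sum, Finset.sum_mul, grassDer, Finset.mul_sum, ← Finset.sum_add_distrib]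
  refine Finset.sum_congr rfl fun k _ => ?_
  have e : (ExteriorAlgebra.ι ℝ v * ExteriorAlgebra.ι ℝ (L (Pi.single k 1)) : Grass n) =
      -(ExteriorAlgebra.ι ℝ (L (Pi.single k 1)) * ExteriorAlgebra.ι ℝ v) :=
    eq_neg_of_add_eq_zero_left (ExteriorAlgebra.ι_add_mul_swap (R := ℝ) _ _)
  rw [contract_ι_mul, mul_sub, ← mul_assoc, ← mul_assoc, e, map_smul, smul_mul_assoc,
    mul_smul_comm, neg_mul, sub_eq_add_neg]
  rfl

/-- Strips one generator and absorbs it into the functional. Inductions over all `l` then concern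
real-valued functions only, so no topology on the Grassmann algebra is needed. -/
theorem apply_map_ι_mul (l : Module.Dual ℝ (Grass n))
    (L : (Fin n × Fin 2 → ℝ) →ₗ[ℝ] (Fin n × Fin 2 → ℝ)) (v : Fin n × Fin 2 → ℝ) (x : Grass n) :
    l (ExteriorAlgebra.map L (ExteriorAlgebra.ι ℝ v * x)) = ∑ k, L v k *
      (l ∘ₗ LinearMap.mulLeft ℝ (ExteriorAlgebra.ι ℝ (Pi.single k 1)))
        (ExteriorAlgebra.map L x) := by
  rw [map_mul, ExteriorAlgebra.map_apply_ι, ← sum_smul_ι (L v), Finset.sum_mul, map_sum]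
  refine Finset.sum_congr rfl fun k _ => ?_
  rw [smul_mul_assoc, map_smul]
  rfl

theorem hasDerivAt_apply_map {L : ℝ → (Fin n × Fin 2 → ℝ) →ₗ[ℝ] (Fin n × Fin 2 → ℝ)}
    {L' : (Fin n × Fin 2 → ℝ) →ₗ[ℝ] (Fin n × Fin 2 → ℝ)} (h0 : L 0 = LinearMap.id)
    (hL : ∀ v k, HasDerivAt (fun t => L t v k) (L' v k) 0) (x : Grass n)
    (l : Module.Dual ℝ (Grass n)) :
    HasDerivAt (fun t => l (ExteriorAlgebra.map (L t) x)) (l (grassDer L' x)) 0 := by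
  induction x using grass_induction generalizing l with
  | h0 r =>
    simp only [AlgHom.commutes, grassDer_algebraMap, map_zero]
    exact hasDerivAt_const _ _
  | hadd x y hx hy =>
    simp only [map_add, grassDer_add]
    exact (hx l).add (hy l)
  | hmul x v hx =>
    simp only [apply_map_ι_mul]
    refine (HasDerivAt.fun_sum fun k _ => (hL v k).mul (hx _)).congr_deriv ?_
    rw [grassDer_ι_mul, map_add, ← sum_smul_ι (L' v), ← sum_smul_ι v, Finset.sum_mul,
      Finset.sum_mul, map_sum, map_sum, ← Finset.sum_add_distrib, h0, ExteriorAlgebra.map_id]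
    refine Finset.sum_congr rfl fun k _ => ?_
    rw [smul_mul_assoc, smul_mul_assoc, map_smul, map_smul]
    rfl

theorem continuous_apply_map {X : Type*} [TopologicalSpace X]
    {L : X → (Fin n × Fin 2 → ℝ) →ₗ[ℝ] (Fin n × Fin 2 → ℝ)}
    (hL : ∀ v k, Continuous fun t => L t v k) (x : Grass n) (l : Module.Dual ℝ (Grass n)) :
    Continuous fun t => l (ExteriorAlgebra.map (L t) x) := by
  induction x using grass_induction generalizing l with
  | h0 r =>
    simp only [AlgHom.commutes]
    exact continuous_const
  | hadd x y hx hy =>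
    simp only [map_add]
    exact (hx l).add (hy l)
  | hmul x v hx =>
    simp only [apply_map_ι_mul]
    exact continuous_finsetSum _ fun k _ => (hL v k).mul (hx _)

theorem apply_evalGrass_subst_tmul (S : EvenGroup m n) (f : Smooth (⊤ : Opens (Body m)))
    (x : Grass n) (p : Body m) (l : Module.Dual ℝ (Grass n)) :
    l (evalGrass p (subst S (f ⊗ₜ x))) = toBody f (S.1.1 *ᵥ p) *
      l (ExteriorAlgebra.map (Matrix.toLin' S.2.1.1ᵀ) x) := by
  have : subst S (f ⊗ₜ x) = linPull S.1.1 f ⊗ₜ ExteriorAlgebra.map (Matrix.toLin' S.2.1.1ᵀ) x :=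
    rfl
  rw [this, evalGrass_tmul, map_smul, toBody_linPull, smul_eq_mul]

/-- An even linear field has no mixed coefficients: it is a directional derivative on the smooth
factor plus a derivation of the Grassmann factor, matching the two factors of `subst`. -/
theorem evalGrass_fieldOf_tmul {N : Matrix (Idx m n) (Idx m n) ℝ} (hN : HasParity 0 N)
    (f : Smooth (⊤ : Opens (Body m))) (x : Grass n) (p : Body m) :
    evalGrass p (fieldOf N (f ⊗ₜ x)) =
      fderiv ℝ (toBody f) p (N.toBlocks₁₁ *ᵥ p) • x +
        toBody f p • grassDer (Matrix.toLin' N.toBlocks₂₂ᵀ) x := by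
  have h12 : ∀ i k, N (Sum.inl i) (Sum.inr k) = 0 := fun i k => hN _ _ (by simp [deg])
  have h21 : ∀ i k, N (Sum.inr i) (Sum.inl k) = 0 := fun i k => hN _ _ (by simp [deg])
  have e1 : fderiv ℝ (toBody f) p (N.toBlocks₁₁ *ᵥ p) =
      ∑ i, (∑ k, N (Sum.inl i) (Sum.inl k) * p k) * fderiv ℝ (toBody f) p (Pi.single i 1) := by
    rw [pi_eq_sum_univ' (N.toBlocks₁₁ *ᵥ p), map_sum]
    refine Finset.sum_congr rfl fun i _ => ?_
    rw [map_smul, smul_eq_mul]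
    rfl
  have e2 : ∀ k, (ExteriorAlgebra.ι ℝ (Matrix.toLin' N.toBlocks₂₂ᵀ (Pi.single k 1)) : Grass n) =
      ∑ j, N (Sum.inr k) (Sum.inr j) • ExteriorAlgebra.ι ℝ (Pi.single j (1 : ℝ)) := by
    intro k
    rw [toLin'_transpose_single, ← sum_smul_ι]
    rfl
  rw [fieldOf_apply, map_sum, Fintype.sum_sum_type, e1, Finset.sum_smul, grassDer, Finset.smul_sum]
  congr 1
  · refine Finset.sum_congr rfl fun i _ => ?_
    rw [map_sum, Fintype.sum_sum_type, Finset.sum_mul, Finset.sum_smul]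
    simp only [h12, zero_smul, map_zero, Finset.sum_const_zero, add_zero]
    refine Finset.sum_congr rfl fun k _ => ?_
    rw [map_smul, map_mul, evalGrass_coord_inl, partialX_inl_tmul, evalGrass_tmul,
      toBody_bosPartial, ← Algebra.smul_def, smul_smul, smul_smul, mul_assoc]
  · refine Finset.sum_congr rfl fun i _ => ?_
    rw [map_sum, Fintype.sum_sum_type, e2, Finset.sum_mul, Finset.smul_sum]
    simp only [h21, zero_smul, map_zero, Finset.sum_const_zero, zero_add]
    refine Finset.sum_congr rfl fun k _ => ?_
    rw [map_smul, map_mul, evalGrass_coord_inr, partialX_inr_tmul, evalGrass_tmul, mul_smul_comm,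
      smul_mul_assoc, smul_comm]

theorem hasDerivAt_subst {T : ℝ → EvenGroup m n} {N : Matrix (Idx m n) (Idx m n) ℝ}
    (hT : ∀ i j, HasDerivAt (fun t => toMat (T t) i j) (N i j) 0) (hT0 : T 0 = 1)
    (hN : HasParity 0 N) (f : Glob m n) (p : Body m) (l : Module.Dual ℝ (Grass n)) :
    HasDerivAt (fun t => l (evalGrass p (subst (T t) f))) (l (evalGrass p (fieldOf N f))) 0 := by
  induction f using TensorProduct.induction_on with
  | zero =>
    simp only [map_zero]
    exact hasDerivAt_const _ _
  | tmul f x =>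
    have h11 : ∀ i j, HasDerivAt (fun t => (T t).1.1 i j) (N.toBlocks₁₁ i j) 0 :=
      fun i j => hT (Sum.inl i) (Sum.inl j)
    have h22 : ∀ i j, HasDerivAt (fun t => (T t).2.1.1 i j) (N.toBlocks₂₂ i j) 0 :=
      fun i j => hT (Sum.inr i) (Sum.inr j)
    have hp : HasDerivAt (fun t => (T t).1.1 *ᵥ p) (N.toBlocks₁₁ *ᵥ p) 0 := by
      refine hasDerivAt_pi.2 fun i => ?_
      simp only [Matrix.mulVec, dotProduct]
      exact HasDerivAt.fun_sum fun k _ => (h11 i k).mul_const (p k)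
    have h0 : (T 0).1.1 *ᵥ p = p := by
      rw [hT0]
      exact Matrix.one_mulVec p
    have h0' : Matrix.toLin' (T 0).2.1.1ᵀ = LinearMap.id := by
      rw [hT0, ← Matrix.toLin'_one]
      congr 1
      exact Matrix.transpose_one
    have hd : HasFDerivAt (toBody f) (fderiv ℝ (toBody f) p) ((T 0).1.1 *ᵥ p) := by
      rw [h0]
      exact (differentiableAt_toBody f p).hasFDerivAt
    have hf : HasDerivAt (fun t => toBody f ((T t).1.1 *ᵥ p))
        (fderiv ℝ (toBody f) p (N.toBlocks₁₁ *ᵥ p)) 0 :=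
      HasFDerivAt.comp_hasDerivAt (f := fun t => (T t).1.1 *ᵥ p) (0 : ℝ) hd hp
    have hx := hasDerivAt_apply_map (L := fun t => Matrix.toLin' (T t).2.1.1ᵀ)
      (L' := Matrix.toLin' N.toBlocks₂₂ᵀ) h0' (fun v k => by
        simp only [Matrix.toLin'_apply]
        exact HasDerivAt.fun_sum fun j _ => (h22 j k).mul_const (v j)) x l
    simp only [apply_evalGrass_subst_tmul]
    refine (hf.mul hx).congr_deriv ?_
    rw [h0, h0', ExteriorAlgebra.map_id, evalGrass_fieldOf_tmul hN, map_add, map_smul, map_smul]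
    rfl
  | add f g hf hg =>
    simp only [map_add]
    exact hf.add hg

/-- The inverse curve is exp(−tA), whose velocity −A is the coefficient matrix of `linField A` when
A is even. -/
theorem hasDerivAt_subst_exp {A : Matrix (Idx m n) (Idx m n) ℝ} (hA : HasParity 0 A)
    {γ : ℝ → EvenGroup m n} (hγ : ∀ t, toMat (γ t) = NormedSpace.exp (t • A))
    (f : Glob m n) (p : Body m) (l : Module.Dual ℝ (Grass n)) :
    HasDerivAt (fun t => l (evalGrass p (subst (γ t)⁻¹ f)))
      (l (evalGrass p (linField A f))) 0 := by
  have hinv : ∀ t, toMat (γ t)⁻¹ = NormedSpace.exp (t • -A) := by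
    intro t
    rw [smul_neg, Matrix.exp_neg, ← hγ]
    exact (Matrix.inv_eq_right_inv (toMat_mul_inv _)).symm
  have h0 : (γ 0)⁻¹ = 1 := by
    refine toMat_injective ?_
    rw [hinv, zero_smul, NormedSpace.exp_zero, toMat_one]
  have hs : signed A = -A := by
    ext i k
    rw [hA.signed_apply, koszul_zero_left, one_mul]
    rfl
  rw [linField_eq, hs]
  refine hasDerivAt_subst (T := fun t => (γ t)⁻¹) (fun i j => ?_) h0 (fun i j h => ?_) f p l
  · simp only [hinv]
    exact hasDerivAt_exp_apply (-A) i j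
  · rw [Matrix.neg_apply, hA i j h, neg_zero]

end Deriv

/-! ### The topological group isomorphism -/

section Topology

variable {m n : ℕ}

theorem continuous_apply_evalGrass_subst (f : Glob m n) (p : Body m)
    (l : Module.Dual ℝ (Grass n)) :
    Continuous fun S : EvenGroup m n => l (evalGrass p (subst S f)) := by
  induction f using TensorProduct.induction_on with
  | zero =>
    simp only [map_zero]
    exact continuous_const
  | tmul f x =>
    have h1 : Continuous fun S : EvenGroup m n => (S.1.1 : Matrix (Fin m) (Fin m) ℝ) :=
      continuous_subtype_val.comp continuous_fst
    have h2 : Continuous fun S : EvenGroup m n =>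
        (S.2.1.1 : Matrix (Fin n × Fin 2) (Fin n × Fin 2) ℝ) :=
      Units.continuous_val.comp (continuous_subtype_val.comp continuous_snd)
    have h3 : Continuous (toBody f) := (contDiff_toBody f).continuous
    simp only [apply_evalGrass_subst_tmul]
    refine (h3.comp (h1.matrix_mulVec continuous_const)).mul ?_
    refine continuous_apply_map (L := fun S : EvenGroup m n => Matrix.toLin' S.2.1.1ᵀ)
      (fun v k => ?_) x l
    simp only [Matrix.toLin'_apply]
    exact (continuous_apply k).comp (h2.matrix_transpose.matrix_mulVec continuous_const)
  | add f g hf hg =>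
    simp only [map_add]
    exact hf.add hg

theorem continuous_linDiffeo :
    Continuous (linDiffeo : EvenGroup m n → SuperDiffeo m n) := by
  refine continuous_induced_rng.2 (continuous_pi fun x => ?_)
  have : ∀ S : EvenGroup m n, sharp (linDiffeo S).val x.1 = subst S x.1 :=
    fun S => sharp_linDiffeo S x.1
  simp only [Function.comp_def, this]
  exact continuous_apply_evalGrass_subst x.1 x.2.1 x.2.2

theorem continuous_apply_evalGrass_sharp (f : Glob m n) (p : Body m)
    (l : Module.Dual ℝ (Grass n)) :
    Continuous fun Φ : SuperDiffeo m n => l (evalGrass p (sharp Φ.val f)) :=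
  (continuous_pi_iff.1 (continuous_induced_dom (f := fun (Φ : SuperDiffeo m n)
    (x : Glob m n × Body m × Module.Dual ℝ (Grass n)) =>
      x.2.2 (evalGrass x.2.1 (sharp Φ.val x.1))))) (f, p, l)

/-- For even k, take the body at the k-th basis point; for odd k, contract with the k-th generator
and then take the scalar part. Matrix entries thus become coefficients that the topology on
diffeomorphisms controls. -/
theorem exists_dual_coord (k : Idx m n) : ∃ (p : Body m) (l : Module.Dual ℝ (Grass n)),
    ∀ i, l (evalGrass p (coord i)) = if i = k then 1 else 0 := by
  rcases k with k | k
  · refine ⟨Pi.single k 1, ExteriorAlgebra.algebraMapInv.toLinearMap, fun i => ?_⟩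
    rw [AlgHom.toLinearMap_apply]
    rcases i with i | i
    · rw [evalGrass_coord_inl, AlgHom.commutes, Pi.single_apply]
      simp
    · rw [evalGrass_coord_inr]
      simp [ExteriorAlgebra.algebraMapInv]
  · refine ⟨0, ExteriorAlgebra.algebraMapInv.toLinearMap ∘ₗ contract (LinearMap.proj k),
      fun i => ?_⟩
    rw [LinearMap.comp_apply, AlgHom.toLinearMap_apply]
    rcases i with i | i
    · rw [evalGrass_coord_inl, contract_algebraMap, map_zero]
      simp
    · rw [evalGrass_coord_inr, contract_ι, AlgHom.commutes, LinearMap.proj_apply,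
        Pi.single_apply]
      simp [eq_comm]

theorem exists_apply_evalGrass_sharp_linDiffeo (i k : Idx m n) :
    ∃ (p : Body m) (l : Module.Dual ℝ (Grass n)), ∀ S : EvenGroup m n,
      toMat S i k = l (evalGrass p (sharp (linDiffeo S).val (coord i))) := by
  obtain ⟨p, l, h⟩ := exists_dual_coord k
  refine ⟨p, l, fun S => ?_⟩
  rw [sharp_linDiffeo_coord, map_sum, map_sum]
  simp only [map_smul, h, smul_eq_mul, mul_ite, mul_one, mul_zero, Finset.sum_ite_eq',
    Finset.mem_univ, if_true]

/-- The topology on units also asks for continuity of the inverse, which S⁻¹ = g⁻¹Sᵀg provides. -/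
theorem continuous_of_toMat {X : Type*} [TopologicalSpace X] {s : X → EvenGroup m n}
    (hs : ∀ i k, Continuous fun x => toMat (s x) i k) : Continuous s := by
  have h : Continuous fun x => toMat (s x) := continuous_matrix hs
  have hinv : Continuous fun x => toMat (s x)⁻¹ := by
    have e : ∀ S : EvenGroup m n, toMat S⁻¹ = (matG m n)⁻¹ * ((toMat S)ᵀ * matG m n) := by
      intro S
      rw [← matG_mul_toMat_inv, ← Matrix.mul_assoc, matG_inv_mul, Matrix.one_mul]
    simp only [e]
    exact continuous_const.matrix_mul (h.matrix_transpose.matrix_mul continuous_const)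
  refine continuous_prodMk.2 ⟨Continuous.subtype_mk (f := fun x => (s x).1.1) ?_ _,
    Continuous.subtype_mk (f := fun x => (s x).2.1) ?_ _⟩
  · exact continuous_matrix fun i j => hs (Sum.inl i) (Sum.inl j)
  · refine Units.continuous_iff.2 ⟨?_, ?_⟩
    · exact continuous_matrix fun i j => hs (Sum.inr i) (Sum.inr j)
    · exact continuous_matrix fun i j => hinv.matrix_elem (Sum.inr i) (Sum.inr j)

/-- The isomorphism of `O(m) × Sp(2n)` with the group `ℋ₀` by linear substitutions. -/
def linIso (m n : ℕ) : EvenGroup m n ≃ₜ* isometryGroup₀ m n :=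
  let e : EvenGroup m n ≃* isometryGroup₀ m n := MulEquiv.ofBijective
    ({ toFun := fun S => ⟨linDiffeo S, linDiffeo_mem S⟩
       map_one' := Subtype.ext (Units.ext linEnd_one)
       map_mul' := fun S T => Subtype.ext (linDiffeo_mul S T) } :
      EvenGroup m n →* isometryGroup₀ m n)
    ⟨fun S T h => toMat_injective (Matrix.ext fun i k => by
        obtain ⟨p, l, hpl⟩ := exists_apply_evalGrass_sharp_linDiffeo i k
        have h' : linDiffeo S = linDiffeo T := congrArg Subtype.val h
        rw [hpl, hpl, h']),
      fun Φ => (exists_linDiffeo_eq Φ.2).imp fun _ h => Subtype.ext h⟩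
  { e with
    continuous_toFun := continuous_linDiffeo.subtype_mk _
    continuous_invFun := continuous_of_toMat fun i k => by
      obtain ⟨p, l, hpl⟩ := exists_apply_evalGrass_sharp_linDiffeo i k
      have h : ∀ Φ : isometryGroup₀ m n, linDiffeo (e.symm Φ) = Φ.1 := fun Φ =>
        congrArg Subtype.val (e.apply_symm_apply Φ)
      have : (fun Φ : isometryGroup₀ m n => toMat (e.symm Φ) i k) =
          fun Φ => l (evalGrass p (sharp Φ.1.val (coord i))) := by
        funext Φ
        rw [hpl, h]
      exact this ▸ (continuous_apply_evalGrass_sharp (coord i) p l).comp continuous_subtype_val }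

theorem linIso_apply (S : EvenGroup m n) : (linIso m n S : SuperDiffeo m n) = linDiffeo S := rfl

end Topology
end Superspace

end

/-! ### The theorem -/

open Superspace

theorem mainTheorem6 (m n : ℕ) :
    ∃ (Θ : EvenGroup m n ≃ₜ* isometryGroup₀ m n) (ρ : osp m n ≃ₗ[ℝ] killing₀ m n),
      -- `O(m) × Sp(2n)` acts on superfunctions by `f(x) ↦ f(S⁻¹ · x)`
      (∀ (S : EvenGroup m n) (f : Glob m n),
        sharp (((Θ S)⁻¹ : isometryGroup₀ m n) : SuperDiffeo m n).val f = subst S⁻¹ f) ∧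
      -- `𝔬𝔰𝔭(m|2n)` acts by linear vector fields, spanned by the operators `L_{ij}`
      (∀ A : osp m n, (ρ A : Op m n) = linField A) ∧
      killing₀ m n = Submodule.span ℝ {D | ∃ i j : Idx m n, D = opL i j} ∧
      -- `ρ` is an isomorphism of Lie superalgebras
      (∀ (a : ZMod 2) (A : osp m n), (A : Matrix (Idx m n) (Idx m n) ℝ) ∈ ospHom m n a ↔
        (ρ A : Op m n) ∈ HomDer m n a) ∧
      (∀ (a b : ZMod 2) (A B : osp m n), (A : Matrix (Idx m n) (Idx m n) ℝ) ∈ ospHom m n a →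
        (B : Matrix (Idx m n) (Idx m n) ℝ) ∈ ospHom m n b →
        ∃ C : osp m n, (C : Matrix (Idx m n) (Idx m n) ℝ) = matComm a b A B ∧
          (ρ C : Op m n) = superComm a b (ρ A : Op m n) (ρ B : Op m n)) ∧
      -- `Θ` and `ρ` intertwine the adjoint representations
      (∀ (S : EvenGroup m n) (A : osp m n),
        ∃ C : osp m n, (C : Matrix (Idx m n) (Idx m n) ℝ) =
            toMat S * (A : Matrix (Idx m n) (Idx m n) ℝ) * toMat S⁻¹ ∧
          (ρ C : Op m n) = push (Θ S : SuperDiffeo m n) (ρ A : Op m n)) ∧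
      -- the even part of `𝔬𝔰𝔭(m|2n)` is the Lie algebra of `O(m) × Sp(2n)`
      (∀ A : Matrix (Idx m n) (Idx m n) ℝ, A ∈ ospHom m n 0 ↔
        ∀ t : ℝ, ∃ S : EvenGroup m n, toMat S = NormedSpace.exp (t • A)) ∧
      -- on the even part `ρ` is the differential of the action of `O(m) × Sp(2n)`
      (∀ A : osp m n, (A : Matrix (Idx m n) (Idx m n) ℝ) ∈ ospHom m n 0 →
        ∀ γ : ℝ → EvenGroup m n,
          (∀ t, toMat (γ t) = NormedSpace.exp (t • (A : Matrix (Idx m n) (Idx m n) ℝ))) →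
          ∀ (f : Glob m n) (p : Body m) (l : Module.Dual ℝ (Grass n)),
            HasDerivAt
              (fun t => l (evalGrass p
                (sharp (((Θ (γ t))⁻¹ : isometryGroup₀ m n) : SuperDiffeo m n).val f)))
              (l (evalGrass p ((ρ A : Op m n) f))) 0) := by
  refine ⟨linIso m n, rho m n, fun S f => ?_, fun A => rfl, killing₀_eq_span, fun a A => ?_,
    fun a b A B hA hB => ?_, fun S A => ?_, fun A => mem_ospHom_zero_iff,
    fun A hA γ hγ f p l => ?_⟩
  · rw [← map_inv, linIso_apply, sharp_linDiffeo]
  · exact ⟨fun h => HasParity.linField_mem h.1,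
      fun h => mem_ospHom_of_hasParity A.2 (hasParity_of_linField_mem h)⟩
  · exact ⟨⟨matComm a b A B, ospHom_le_osp _ (matComm_mem hA hB)⟩, rfl,
      (superComm_linField hA.1 hB.1).symm⟩
  · exact ⟨⟨_, (conj_mem_osp S A.2).1⟩, rfl, (conj_mem_osp S A.2).2.symm⟩
  -- (Θ S)⁻¹ = Θ(S⁻¹), so the action along γ is substitution by γ(t)⁻¹. A curve γ as required exists
  -- by the exponential criterion for the even part.
  · have h : ∀ t, sharp (((linIso m n (γ t))⁻¹ : isometryGroup₀ m n) : SuperDiffeo m n).val f =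
        subst (γ t)⁻¹ f := fun t => by rw [← map_inv, linIso_apply, sharp_linDiffeo]
    simp only [h]
    exact hasDerivAt_subst_exp hA.1 hγ f p l
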